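/- Let $I=\{1,\dots,m\}$, $m\ge 2$, and let $I_i\subset[0,1]$ ($i\in I$) be disjoint intervals with non-empty interior. Let $F:\bigcup_i I_i\to[0,1]$ be an expanding map with full $C^{1+\epsilon}$ branches: each $F|_{I_i}$ extends continuously to a $C^1$ map $H_i$ of $\overline{I_i}$ onto $[0,1]$ with $\epsilon$-Hölder derivative for some $\epsilon>0$ and $|H_i'|\ge\lambda$ for some $\lambda>1$ (both independent of $i$). Put $h_i=H_i^{-1}$, let $\Sigma=I^{\mathbb N}$ with the left shift $\sigma$, let $\pi:\Sigma\to[0,1]$ be the coding map given by $\{\pi(\omega)\}=\bigcap_{n}h_{\omega_1}\circ\cdots\circ h_{\omega_n}([0,1])$, let $\pi(\Sigma)$ be the repeller of $F$, let $\mathcal D=\bigcup_{w}h_{w_1}\circ\cdots\circ h_{w_n}(\{0,1\})$ (union over all finite words $w$, including the empty one), and $\mathcal R=(\pi(\Sigma)\setminus\mathcal D)+\mathbb Z$. Let $\Psi:[0,1]\to\mathbb Z$ be constant on each $I_i$, let $\psi:\Sigma\to\mathbb Z$, $\psi(\omega)=\Psi|_{I_{\omega_1}}$, and let $$F_\Psi:\mathcal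 R\to\mathcal R,\qquad F_\Psi(x)=\sum_{k\in\mathbb Z}\bigl(k+F(x-k)+\Psi(x-k)\bigr)\mathbf 1_{[0,1]}(x-k).$$ Let $\varphi(\omega)=-\log|H_{\omega_1}'(\pi(\omega))|$ be the geometric potential. For $f:\Sigma\to\mathbb R$ and a finite word $w$ of length $n$, with cylinder $[w]$, put $S_nf=\sum_{k<n}f\circ\sigma^k$ and $S_wf=\sup_{[w]}S_nf$, and let $\mathfrak P(f)=\lim_n\frac1n\log\sum_{w\in I^n}e^{S_wf}$ be the topological pressure. A Gibbs measure for $f$ is a $\sigma$-invariant Borel probability measure $\mu$ for which there is $c\ge1$ with $c^{-1}\le\mu([w])/\exp(S_nf(x)-n\mathfrak P(f))\le c$ for all $n$, all $w\in I^n$ and all $x\in[w]$. For $K>0$ and $\alpha\in\mathbb R$, the $\alpha$-Poincaré exponent is $$\delta_\alpha=\inf\Bigl\{s\ge0:\sum_{w\in I^\star,\ |S_w(\psi-\alpha)|\le K}e^{s\,S_w\varphi}<\infty\Bigr\},$$ where $I^\star$ is the set of all finite words. Let $\mathbf R$ (respectively $\mathbf R_u$) be the recurrent (respectively uniformly recurrent)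 set, that is, the set of $x\in\mathcal R$ for which there is $K\in\mathbb R$ with $|F_\Psi^n(x)|\le K$ for infinitely many $n$ (respectively for all $n$). **Theorem.** There is a unique $\delta\in\mathbb R$ with $\mathfrak P(\delta\varphi)=0$; it is positive and equals the Hausdorff dimension of the repeller $\pi(\Sigma)$. There is a unique Gibbs measure $\mu_{\delta\varphi}$ for $\delta\varphi$. For every $K>0$ and every $\alpha\in\mathbb R$, $$\delta_\alpha=\delta\iff\int\psi\,d\mu_{\delta\varphi}=\alpha .$$ In particular, a dimension gap occurs if and only if the drift $\int\psi\,d\mu_{\delta\varphi}$ is non-zero: each of the three inequalities $$\delta_0<\delta\ \ (\text{for any } K>0),\qquad \dim_H(\mathbf R)<\dim_H(\mathcal R),\qquad \dim_H(\mathbf R_u)<\dim_H(\mathcal R)$$ holds if and only if $\int\psi\,d\mu_{\delta\varphi}\ne0$. -/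

import Mathlib

open Set Filter Topology MeasureTheory

noncomputable section

namespace SkewPeriodic

/-! ### Symbolic dynamics on the full shift over `m` letters -/

/-- The code space `Σ = I^ℕ`, with `I = Fin m`, product topology and product (= Borel)
`σ`-algebra. -/
abbrev Code (m : ℕ) : Type := ℕ → Fin m

/-- The left shift `σ`. -/
def shift {m : ℕ} (ω : Code m) : Code m := fun n => ω (n + 1)

/-- The initial word `ω|ₙ`. -/
def initial {m : ℕ} (ω : Code m) (n : ℕ) : List (Fin m) := List.ofFn fun k : Fin n => ω k

/-- The cylinder set `[w]` of a finite word `w ∈ I⋆`. -/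
def cylinder {m : ℕ} (w : List (Fin m)) : Set (Code m) := {ω | initial ω w.length = w}

/-- `S_w f = sup_{x ∈ [w]} S_{|w|} f (x)`, where `S_n f = ∑_{k < n} f ∘ σ^k`. -/
def wordSum {m : ℕ} (f : Code m → ℝ) (w : List (Fin m)) : ℝ :=
  sSup (birkhoffSum shift f w.length '' cylinder w)

/-- The classical topological pressure
`𝔓(f) = lim_n (1/n) log ∑_{w ∈ I^n} exp (S_w f)`. -/
def pressure {m : ℕ} (f : Code m → ℝ) : ℝ :=
  limUnder atTop fun n : ℕ =>
    (1 / (n : ℝ)) * Real.log (∑ w : Fin n → Fin m, Real.exp (wordSum f (List.ofFn w)))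

/-- `μ` is a Gibbs measure for `f`: a shift-invariant Borel probability measure with
`c⁻¹ ≤ μ[w] / exp (S_n f (x) - n 𝔓(f)) ≤ c` for all words `w` of length `n` and all `x ∈ [w]`. -/
structure IsGibbs {m : ℕ} (f : Code m → ℝ) (μ : Measure (Code m)) : Prop where
  prob : IsProbabilityMeasure μ
  invariant : MeasurePreserving shift μ μ
  gibbs : ∃ c : ℝ, 1 ≤ c ∧ ∀ w : List (Fin m), ∀ x ∈ cylinder w,
    c⁻¹ ≤ μ.real (cylinder w) /
        Real.exp (birkhoffSum shift f w.length x - w.length * pressure f) ∧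
      μ.real (cylinder w) /
        Real.exp (birkhoffSum shift f w.length x - w.length * pressure f) ≤ c

/-- The `α`-Poincaré exponent: the infimum of all `s ≥ 0` for which the series
`∑ exp (s S_w φ)` over all finite words `w` (the empty word included) with
`|S_w (ψ - α)| ≤ K` converges. -/
def poincareExponent {m : ℕ} (φ ψ : Code m → ℝ) (K α : ℝ) : ℝ :=
  sInf {s : ℝ | 0 ≤ s ∧
    Summable fun w : {w : List (Fin m) // |wordSum (fun ω => ψ ω - α) w| ≤ K} =>
      Real.exp (s * wordSum φ w)}

/-- The symbolic step length function `ψ`, with the constant value `p i` on the one-cylinder `[i]`. -/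
def stepFunction {m : ℕ} (p : Fin m → ℤ) (ω : Code m) : ℝ := (p (ω 0) : ℝ)

/-! ### Expanding interval maps and their lifts -/

/-- An expanding interval map with `m` full branches of class `C^{1+ε}`. The `i`-th branch lives on
the interval `J i ⊆ [0,1]` with endpoints `a i < b i` (each of which may or may not belong to
`J i`), and `H i` is its continuous continuation to the closed interval `[a i, b i]`. Values of
`F` outside `⋃ i, J i` and of `H i` outside `[a i, b i]` play no role. -/
structure ExpandingMap (m : ℕ) where
  F : ℝ → ℝ
  J : Fin m → Set ℝ
  a : Fin m → ℝ
  b : Fin m → ℝ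
  H : Fin m → ℝ → ℝ
  zero_le_a : ∀ i, 0 ≤ a i
  a_lt_b : ∀ i, a i < b i
  b_le_one : ∀ i, b i ≤ 1
  Ioo_subset : ∀ i, Ioo (a i) (b i) ⊆ J i
  subset_Icc : ∀ i, J i ⊆ Icc (a i) (b i)
  disjoint : Pairwise fun i j => Disjoint (J i) (J j)
  eqOn : ∀ i, EqOn F (H i) (J i)
  contDiffOn : ∀ i, ContDiffOn ℝ 1 (H i) (Icc (a i) (b i))
  holder : ∃ ε : NNReal, 0 < ε ∧ ∃ C : NNReal, ∀ i,
    HolderOnWith C ε (derivWithin (H i) (Icc (a i) (b i))) (Icc (a i) (b i))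
  expanding : ∃ l : ℝ, 1 < l ∧ ∀ i, ∀ x ∈ Icc (a i) (b i),
    l ≤ |derivWithin (H i) (Icc (a i) (b i)) x|
  full : ∀ i, H i '' Icc (a i) (b i) = Icc 0 1

namespace ExpandingMap

variable {m : ℕ} (E : ExpandingMap m)

/-- The inverse branch `h_i = H_i⁻¹ : [0,1] → [a i, b i]`. -/
def inv (i : Fin m) : ℝ → ℝ := Function.invFunOn (E.H i) (Icc (E.a i) (E.b i))

/-- `h_w = h_{w_1} ∘ ⋯ ∘ h_{w_n}`, with `h_∅ = id`. -/
def wordMap : List (Fin m) → ℝ → ℝ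
  | [] => id
  | i :: w => E.inv i ∘ wordMap w

/-- The coding map `π`: the point of `⋂ n, h_{ω_1} ∘ ⋯ ∘ h_{ω_n} [0,1]`, which is a singleton by
`iInter_eq_singleton` below. -/
def coding (ω : Code m) : ℝ := sInf (⋂ n : ℕ, E.wordMap (initial ω n) '' Icc 0 1)

/-- The repeller `π(Σ)`. -/
def repeller : Set ℝ := range E.coding

/-- The countable exceptional set `𝒟 = ⋃_w h_w {0, 1}`. -/
def exceptional : Set ℝ := ⋃ w : List (Fin m), E.wordMap w '' {0, 1}

/-- The geometric potential `φ(ω) = -log |F'(π ω)|`, where the derivative is that of the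
continuation of the branch with index `ω₁` (so it is one-sided at the endpoints). -/
def potential (ω : Code m) : ℝ :=
  -Real.log |derivWithin (E.H (ω 0)) (Icc (E.a (ω 0)) (E.b (ω 0))) (E.coding ω)|

/-- The set `ℛ = (π(Σ) ∖ 𝒟) + ℤ`. -/
def periodicRepeller : Set ℝ :=
  {x | ∃ y ∈ E.repeller \ E.exceptional, ∃ k : ℤ, x = y + k}

/-- The `Ψ`-lift `F_Ψ(x) = ∑_{k ∈ ℤ} (k + F(x - k) + Ψ(x - k)) 1_{[0,1]}(x - k)`
(at most two terms are non-zero). -/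
def lift (Ψ : ℝ → ℤ) (x : ℝ) : ℝ :=
  ∑ᶠ k : ℤ, (Icc (0 : ℝ) 1).indicator (fun y => (k : ℝ) + E.F y + (Ψ y : ℝ)) (x - k)

/-- The recurrent set of `F_Ψ`. -/
def recurrentSet (Ψ : ℝ → ℤ) : Set ℝ :=
  {x ∈ E.periodicRepeller | ∃ K : ℝ, ∃ᶠ n : ℕ in atTop, |(E.lift Ψ)^[n] x| ≤ K}

/-- The uniformly recurrent set of `F_Ψ`. -/
def uniformlyRecurrentSet (Ψ : ℝ → ℤ) : Set ℝ :=
  {x ∈ E.periodicRepeller | ∃ K : ℝ, ∀ n : ℕ, |(E.lift Ψ)^[n] x| ≤ K}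

/-! The coding map is well defined. -/

theorem inv_spec (i : Fin m) {y : ℝ} (hy : y ∈ Icc (0 : ℝ) 1) :
    E.inv i y ∈ Icc (E.a i) (E.b i) ∧ E.H i (E.inv i y) = y := by
  rw [← E.full i] at hy
  exact ⟨Function.invFunOn_mem hy, Function.invFunOn_eq hy⟩

theorem inv_mem (i : Fin m) {y : ℝ} (hy : y ∈ Icc (0 : ℝ) 1) : E.inv i y ∈ Icc (0 : ℝ) 1 :=
  ⟨(E.zero_le_a i).trans (E.inv_spec i hy).1.1, (E.inv_spec i hy).1.2.trans (E.b_le_one i)⟩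

theorem wordMap_mem (w : List (Fin m)) {y : ℝ} (hy : y ∈ Icc (0 : ℝ) 1) :
    E.wordMap w y ∈ Icc (0 : ℝ) 1 := by
  induction w with
  | nil => exact hy
  | cons i w ih => exact E.inv_mem i ih

theorem expand {l : ℝ} (hl : ∀ i, ∀ x ∈ Icc (E.a i) (E.b i),
    l ≤ |derivWithin (E.H i) (Icc (E.a i) (E.b i)) x|) (i : Fin m) {x y : ℝ}
    (hx : x ∈ Icc (E.a i) (E.b i)) (hy : y ∈ Icc (E.a i) (E.b i)) :
    l * |x - y| ≤ |E.H i x - E.H i y| := by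
  wlog h : x < y generalizing x y
  · rcases (not_lt.1 h).eq_or_lt with rfl | h'
    · simp
    · rw [abs_sub_comm x, abs_sub_comm (E.H i x)]
      exact this hy hx h'
  obtain ⟨c, hc, hd⟩ := exists_hasDerivAt_eq_slope (E.H i)
    (derivWithin (E.H i) (Icc (E.a i) (E.b i))) h
    ((E.contDiffOn i).continuousOn.mono (Icc_subset_Icc hx.1 hy.2))
    (fun z hz => by
      have hz' : Icc (E.a i) (E.b i) ∈ 𝓝 z :=
        Icc_mem_nhds (hx.1.trans_lt hz.1) (hz.2.trans_le hy.2)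
      exact (((E.contDiffOn i).differentiableOn one_ne_zero z
        (mem_of_mem_nhds hz')).hasDerivWithinAt).hasDerivAt hz')
  have hlc := hl i c ⟨hx.1.trans hc.1.le, hc.2.le.trans hy.2⟩
  rw [hd, abs_div, le_div_iff₀ (abs_pos.2 (sub_pos.2 h).ne')] at hlc
  rwa [abs_sub_comm x, abs_sub_comm (E.H i x)]

theorem dist_wordMap {l : ℝ} (hl1 : 1 < l) (hl : ∀ i, ∀ x ∈ Icc (E.a i) (E.b i),
    l ≤ |derivWithin (E.H i) (Icc (E.a i) (E.b i)) x|) (w : List (Fin m)) {x y : ℝ}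
    (hx : x ∈ Icc (0 : ℝ) 1) (hy : y ∈ Icc (0 : ℝ) 1) :
    |E.wordMap w x - E.wordMap w y| ≤ (l⁻¹) ^ w.length * |x - y| := by
  induction w with
  | nil => simp [wordMap]
  | cons i w ih =>
    have h1 := E.inv_spec i (E.wordMap_mem w hx)
    have h2 := E.inv_spec i (E.wordMap_mem w hy)
    have h := E.expand hl i h1.1 h2.1
    rw [h1.2, h2.2] at h
    have hl0 : 0 < l := by linarith
    calc |E.wordMap (i :: w) x - E.wordMap (i :: w) y|
        ≤ l⁻¹ * |E.wordMap w x - E.wordMap w y| := by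
          rw [le_inv_mul_iff₀ hl0]; exact h
      _ ≤ l⁻¹ * ((l⁻¹) ^ w.length * |x - y|) := by gcongr
      _ = _ := by rw [List.length_cons, pow_succ]; ring

theorem wordMap_concat (w : List (Fin m)) (i : Fin m) (y : ℝ) :
    E.wordMap (w ++ [i]) y = E.wordMap w (E.inv i y) := by
  induction w with
  | nil => rfl
  | cons j w ih => simp [wordMap, ih]

theorem iInter_eq_singleton (ω : Code m) :
    (⋂ n : ℕ, E.wordMap (initial ω n) '' Icc 0 1) = {E.coding ω} := by
  obtain ⟨l, hl1, hl⟩ := E.expanding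
  have hl0 : 0 < l := by linarith
  have hlen : ∀ n, (initial ω n).length = n := fun n => by simp [initial]
  have hcont : ∀ n, IsCompact (E.wordMap (initial ω n) '' Icc (0 : ℝ) 1) := by
    intro n
    refine isCompact_Icc.image_of_continuousOn ?_
    have : LipschitzOnWith 1 (E.wordMap (initial ω n)) (Icc (0 : ℝ) 1) := by
      refine LipschitzOnWith.of_dist_le_mul fun x hx y hy => ?_
      rw [Real.dist_eq, Real.dist_eq]
      refine (E.dist_wordMap hl1 hl _ hx hy).trans ?_
      have : (l⁻¹) ^ (initial ω n).length ≤ 1 :=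
        pow_le_one₀ (by positivity) (inv_le_one_of_one_le₀ hl1.le)
      simpa using mul_le_mul_of_nonneg_right this (abs_nonneg (x - y))
    exact this.continuousOn
  have hne : (⋂ n : ℕ, E.wordMap (initial ω n) '' Icc (0 : ℝ) 1).Nonempty := by
    refine IsCompact.nonempty_iInter_of_sequence_nonempty_isCompact_isClosed _ ?_ ?_ (hcont 0)
      fun n => (hcont n).isClosed
    · rintro n _ ⟨y, hy, rfl⟩
      refine ⟨E.inv (ω n) y, E.inv_mem _ hy, ?_⟩
      rw [← wordMap_concat]
      congr 1
      rw [initial, initial, List.ofFn_succ_last]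
      simp
    · exact fun n => (nonempty_Icc.2 zero_le_one).image _
  have hsub : (⋂ n : ℕ, E.wordMap (initial ω n) '' Icc (0 : ℝ) 1).Subsingleton := by
    intro x hx y hy
    have hle : ∀ n : ℕ, |x - y| ≤ (l⁻¹) ^ n := by
      intro n
      obtain ⟨u, hu, rfl⟩ := mem_iInter.1 hx n
      obtain ⟨v, hv, rfl⟩ := mem_iInter.1 hy n
      refine (E.dist_wordMap hl1 hl _ hu hv).trans ?_
      rw [hlen]
      have : |u - v| ≤ 1 := abs_sub_le_iff.2 ⟨by linarith [hu.2, hv.1], by linarith [hv.2, hu.1]⟩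
      exact mul_le_of_le_one_right (by positivity) this
    have h0 : |x - y| ≤ 0 := ge_of_tendsto'
      (tendsto_pow_atTop_nhds_zero_of_lt_one (by positivity) (inv_lt_one_of_one_lt₀ hl1)) hle
    exact sub_eq_zero.1 (abs_nonpos_iff.1 h0)
  obtain ⟨x, hx⟩ := hne
  have h := hsub.eq_singleton_of_mem hx
  rw [coding, h, csInf_singleton]

end ExpandingMap

end SkewPeriodic

end

open SkewPeriodic

open Set Filter Topology MeasureTheory

noncomputable section

namespace SkewPeriodic

variable {m : ℕ}

/-! ### Words, cylinders and Birkhoff sums -/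

/-! Write φ for the geometric potential and μ for the Gibbs measure of δφ. Bounded distortion makes
`wordSum` additive under concatenation up to a constant and makes exp(S_w φ) comparable to the
diameter of h_w[0,1]. Since the pressure of δφ vanishes, μ[w] is comparable to exp(δ S_w φ). The
level-n part of the α-Poincaré series at δ is therefore comparable to μ(|S_n(ψ - α)| ≤ K), and the
question about exponents becomes one about the return probabilities of an ergodic stationary random
walk with bounded steps.

If the drift is α, these probabilities are not summable. This is Atkinson's recurrence theorem,
`not_summable_measure_abs_birkhoffSum_le`. The series diverges at δ, so δ_α = δ.

If the drift is not α, the weak law yields t and n for which the exponential moment of t S_n(ψ - α)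
is as small as desired (`exists_integral_exp_birkhoffSum_lt`). The tilted weight exp(s S_w φ + t
S_w(ψ - α)) then has sum less than 1 over words of length n, even for some s slightly below δ. Being
submultiplicative, it is summable over all words. Where |S_w(ψ - α)| ≤ K the tilt costs only a
bounded factor, so δ_α ≤ s < δ, with s independent of K (`exists_summable_of_drift_ne`).

The dimensions follow the same dichotomy. A recurrent point lies in infinitely many h_w[0,1] with
|S_w ψ| ≤ K, so a convergent series bounds the dimension from above (`dimH_le_of_summable`). For
zero drift, integrality of ψ turns |S_w ψ| ≤ 1/2 into S_w ψ = 0, a condition closed under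
concatenation. Divergence at δ then provides, for each s < δ, finitely many separated blocks of
equal length whose free concatenations carry a Bernoulli measure of dimension at least s
(`le_dimH_of_not_summable`). All these codes are uniformly recurrent. The same construction with
every word allowed gives the dimension δ of the repeller. -/

/-- The finite set of words of length `n`. -/
def words (m n : ℕ) : Finset (List (Fin m)) :=
  Finset.univ.image fun w : Fin n → Fin m => List.ofFn w

theorem mem_words {n : ℕ} {w : List (Fin m)} : w ∈ words m n ↔ w.length = n := by
  simp only [words, Finset.mem_image, Finset.mem_univ, true_and]
  constructor
  · rintro ⟨v, rfl⟩
    simp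
  · rintro rfl
    exact ⟨w.get, List.ofFn_get w⟩

theorem sum_words {n : ℕ} (g : List (Fin m) → ℝ) :
    ∑ w ∈ words m n, g w = ∑ w : Fin n → Fin m, g (List.ofFn w) :=
  Finset.sum_image fun _ _ _ _ h => List.ofFn_injective h

theorem sum_words_add {n k : ℕ} (g : List (Fin m) → ℝ) :
    ∑ w ∈ words m (n + k), g w = ∑ u ∈ words m n, ∑ v ∈ words m k, g (u ++ v) := by
  rw [← Finset.sum_product']
  symm
  refine Finset.sum_bij (fun p _ => p.1 ++ p.2) ?_ ?_ ?_ fun _ _ => rfl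
  · intro p hp
    rw [Finset.mem_product, mem_words, mem_words] at hp
    rw [mem_words, List.length_append, hp.1, hp.2]
  · intro p hp q hq h
    rw [Finset.mem_product, mem_words, mem_words] at hp hq
    have := List.append_inj h (hp.1.trans hq.1.symm)
    exact Prod.ext this.1 this.2
  · intro w hw
    rw [mem_words] at hw
    refine ⟨(w.take n, w.drop n), ?_, List.take_append_drop n w⟩
    rw [Finset.mem_product, mem_words, mem_words]
    simp only [List.length_take, List.length_drop]
    omega

theorem shift_iterate_apply (n : ℕ) (ω : Code m) (k : ℕ) : shift^[n] ω k = ω (k + n) := by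
  induction n generalizing ω with
  | zero => rfl
  | succ n ih => rw [Function.iterate_succ_apply, ih]; rfl

@[simp] theorem length_initial (ω : Code m) (n : ℕ) : (initial ω n).length = n := by
  simp [initial]

theorem initial_succ (ω : Code m) (n : ℕ) : initial ω (n + 1) = ω 0 :: initial (shift ω) n := by
  rw [initial, List.ofFn_succ]
  rfl

theorem initial_add (ω : Code m) (n k : ℕ) :
    initial ω (n + k) = initial ω n ++ initial (shift^[n] ω) k := by
  induction n generalizing ω with
  | zero => simp [initial]
  | succ n ih =>
    rw [show n + 1 + k = n + k + 1 by omega, initial_succ, initial_succ, ih]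
    rfl

theorem initial_eq_iff {ω η : Code m} {n : ℕ} :
    initial ω n = initial η n ↔ ∀ k < n, ω k = η k := by
  rw [initial, initial, List.ofFn_inj]
  exact ⟨fun h k hk => congrFun h ⟨k, hk⟩, fun h => funext fun k => h k k.2⟩

theorem mem_cylinder {ω : Code m} {w : List (Fin m)} :
    ω ∈ cylinder w ↔ initial ω w.length = w := Iff.rfl

theorem mem_cylinder_initial (ω : Code m) (n : ℕ) : ω ∈ cylinder (initial ω n) := by
  rw [mem_cylinder, length_initial]

theorem cylinder_nil : cylinder ([] : List (Fin m)) = univ := by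
  ext ω
  simp [mem_cylinder, initial]

theorem mem_cylinder_append {ω : Code m} {u v : List (Fin m)} :
    ω ∈ cylinder (u ++ v) ↔ ω ∈ cylinder u ∧ shift^[u.length] ω ∈ cylinder v := by
  rw [mem_cylinder, mem_cylinder, mem_cylinder, List.length_append, initial_add]
  constructor
  · intro h
    exact List.append_inj h (by simp)
  · rintro ⟨h1, h2⟩
    rw [h1, h2]

/-- Prepend a finite word to an infinite one. -/
def cat : List (Fin m) → Code m → Code m
  | [], x => x
  | i :: w, x => fun n => Nat.casesOn n i (cat w x)

theorem shift_iterate_cat (w : List (Fin m)) (x : Code m) : shift^[w.length] (cat w x) = x := by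
  induction w with
  | nil => rfl
  | cons i w ih => exact ih

theorem initial_cat (w : List (Fin m)) (x : Code m) : initial (cat w x) w.length = w := by
  induction w with
  | nil => simp [initial]
  | cons i w ih =>
    rw [List.length_cons, initial_succ]
    exact congrArg (i :: ·) ih

theorem cat_mem_cylinder (w : List (Fin m)) (x : Code m) : cat w x ∈ cylinder w :=
  initial_cat w x

theorem cat_append (u v : List (Fin m)) (x : Code m) : cat (u ++ v) x = cat u (cat v x) := by
  induction u with
  | nil => rfl
  | cons i u ih =>
    funext n
    cases n with
    | zero => rfl
    | succ n => exact congrFun ih n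

theorem isClopen_cylinder (w : List (Fin m)) : IsClopen (cylinder w) := by
  have : Continuous fun ω : Code m => fun k : Fin w.length => ω k := by fun_prop
  have h := (isClopen_discrete {v : Fin w.length → Fin m | List.ofFn v = w}).preimage this
  exact h

theorem measurableSet_cylinder (w : List (Fin m)) : MeasurableSet (cylinder w) :=
  (isClopen_cylinder w).isOpen.measurableSet

theorem continuous_shift : Continuous (shift : Code m → Code m) :=
  continuous_pi fun n => continuous_apply (n + 1)

theorem measurable_shift : Measurable (shift : Code m → Code m) :=
  measurable_pi_lambda _ fun n => measurable_pi_apply (n + 1)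

theorem cylinder_nonempty (hm : 2 ≤ m) (w : List (Fin m)) : (cylinder w).Nonempty :=
  ⟨cat w fun _ => ⟨0, by omega⟩, cat_mem_cylinder _ _⟩

theorem disjoint_cylinder {u v : List (Fin m)} (hl : u.length = v.length) (h : u ≠ v) :
    Disjoint (cylinder u) (cylinder v) := by
  rw [Set.disjoint_left]
  intro ω hu hv
  rw [mem_cylinder] at hu hv
  exact h (hu.symm.trans (hl ▸ hv))

/-- The `σ`-algebra is generated by the `π`-system of cylinders. -/
theorem isPiSystem_cylinder : IsPiSystem (range (cylinder : List (Fin m) → Set (Code m))) := by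
  have key : ∀ u v : List (Fin m), u.length ≤ v.length → (cylinder u ∩ cylinder v).Nonempty →
      cylinder u ∩ cylinder v = cylinder v := by
    intro u v hl hne
    obtain ⟨ω, hu, hv⟩ := hne
    refine inter_eq_right.2 fun η hη => ?_
    rw [mem_cylinder] at hu hv hη ⊢
    refine Eq.trans (initial_eq_iff.2 fun k hk => ?_) hu
    exact initial_eq_iff.1 (hη.trans hv.symm) k (hk.trans_le hl)
  rintro _ ⟨u, rfl⟩ _ ⟨v, rfl⟩ hne
  rcases le_total u.length v.length with hl | hl
  · exact ⟨v, (key u v hl hne).symm⟩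
  · rw [inter_comm] at hne ⊢
    exact ⟨u, (key v u hl hne).symm⟩

theorem generateFrom_cylinder :
    (inferInstance : MeasurableSpace (Code m)) = MeasurableSpace.generateFrom (range cylinder) := by
  apply le_antisymm
  · refine iSup_le fun n => ?_
    rintro _ ⟨A, -, rfl⟩
    have : (fun ω : Code m => ω n) ⁻¹' A =
        ⋃ w ∈ {w : List (Fin m) | cylinder w ⊆ (fun ω : Code m => ω n) ⁻¹' A}, cylinder w := by
      ext ω
      simp only [mem_iUnion, exists_prop]
      constructor
      · intro h
        refine ⟨initial ω (n + 1), fun η hη => ?_, mem_cylinder_initial _ _⟩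
        rw [mem_cylinder, length_initial, initial_eq_iff] at hη
        have := hη n n.lt_succ_self
        simpa [this] using h
      · rintro ⟨w, hw, h⟩
        exact hw h
    rw [this]
    exact MeasurableSet.biUnion (to_countable _) fun w _ =>
      MeasurableSpace.measurableSet_generateFrom ⟨w, rfl⟩
  · refine MeasurableSpace.generateFrom_le ?_
    rintro _ ⟨w, rfl⟩
    exact measurableSet_cylinder w

theorem ext_of_cylinder {μ ν : Measure (Code m)} [IsProbabilityMeasure μ] [IsProbabilityMeasure ν]
    (h : ∀ w, μ (cylinder w) = ν (cylinder w)) : μ = ν := by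
  refine ext_of_generate_finite _ generateFrom_cylinder isPiSystem_cylinder ?_ (by simp)
  rintro _ ⟨w, rfl⟩
  exact h w

theorem integral_eq_sum_words {μ : Measure (Code m)} [IsProbabilityMeasure μ] (n : ℕ)
    {g : Code m → ℝ} (G : List (Fin m) → ℝ) (hg : ∀ ω, g ω = G (initial ω n)) :
    ∫ ω, g ω ∂μ = ∑ w ∈ words m n, G w * μ.real (cylinder w) := by
  have h1 : g = fun ω => ∑ w ∈ words m n, (cylinder w).indicator (fun _ => G w) ω := by
    funext ω
    rw [hg, Finset.sum_eq_single (initial ω n), indicator_of_mem (mem_cylinder_initial _ _)]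
    · intro w hw hne
      refine indicator_of_notMem (fun hω => hne ?_) _
      rw [mem_cylinder, mem_words.1 hw] at hω
      exact hω.symm
    · intro h
      exact absurd (mem_words.2 (length_initial _ _)) h
  rw [h1, integral_finsetSum]
  · refine Finset.sum_congr rfl fun w _ => ?_
    rw [integral_indicator_const _ (measurableSet_cylinder w), smul_eq_mul, mul_comm]
  · exact fun w _ => (integrable_const _).indicator (measurableSet_cylinder w)

theorem birkhoffSum_congr_initial (g : Fin m → ℝ) {n : ℕ} {ω η : Code m}
    (h : initial ω n = initial η n) :
    birkhoffSum shift (fun ω => g (ω 0)) n ω = birkhoffSum shift (fun ω => g (ω 0)) n η := by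
  rw [initial_eq_iff] at h
  refine Finset.sum_congr rfl fun k hk => ?_
  simp only [shift_iterate_apply, zero_add]
  rw [h k (Finset.mem_range.1 hk)]

/-! ### Bounded distortion and pressure -/

/-- `|f| ≤ M`, and the Birkhoff sums `S_n f` vary by at most `B` on cylinders of length `n`. -/
structure BoundedDistortion (f : Code m → ℝ) (M B : ℝ) : Prop where
  bound : ∀ ω, |f ω| ≤ M
  distortion : ∀ w : List (Fin m), ∀ x ∈ cylinder w, ∀ y ∈ cylinder w,
    birkhoffSum shift f w.length x ≤ birkhoffSum shift f w.length y + B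

theorem abs_birkhoffSum_le {α : Type*} {T : α → α} {f : α → ℝ} {M : ℝ} (hf : ∀ ω, |f ω| ≤ M)
    (n : ℕ) (x : α) : |birkhoffSum T f n x| ≤ n * M := by
  refine (Finset.abs_sum_le_sum_abs _ _).trans ?_
  refine (Finset.sum_le_sum fun k _ => hf _).trans ?_
  simp

theorem birkhoffSum_const_mul {α : Type*} {T : α → α} (f : α → ℝ) (s : ℝ) (n : ℕ) (x : α) :
    birkhoffSum T (fun ω => s * f ω) n x = s * birkhoffSum T f n x := by
  simp [birkhoffSum, Finset.mul_sum]

theorem birkhoffSum_sub_const {α : Type*} {T : α → α} (f : α → ℝ) (a : ℝ) (n : ℕ) (x : α) :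
    birkhoffSum T (fun ω => f ω - a) n x = birkhoffSum T f n x - n * a := by
  simp [birkhoffSum, Finset.sum_sub_distrib]

theorem birkhoffSum_mono {α : Type*} {T : α → α} {f g : α → ℝ} (h : ∀ x, f x ≤ g x) (n : ℕ)
    (x : α) : birkhoffSum T f n x ≤ birkhoffSum T g n x :=
  Finset.sum_le_sum fun _ _ => h _

theorem BoundedDistortion.const_mul {f : Code m → ℝ} {M B : ℝ} (hf : BoundedDistortion f M B)
    (s : ℝ) : BoundedDistortion (fun ω => s * f ω) (|s| * M) (|s| * B) where
  bound ω := by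
    rw [abs_mul]
    exact mul_le_mul_of_nonneg_left (hf.bound ω) (abs_nonneg s)
  distortion w x hx y hy := by
    rw [birkhoffSum_const_mul, birkhoffSum_const_mul]
    have h1 := hf.distortion w x hx y hy
    have h2 := hf.distortion w y hy x hx
    have h3 : |birkhoffSum shift f w.length x - birkhoffSum shift f w.length y| ≤ B :=
      abs_sub_le_iff.2 ⟨by linarith, by linarith⟩
    have h4 := (le_abs_self _).trans_eq
      (abs_mul s (birkhoffSum shift f w.length x - birkhoffSum shift f w.length y))
    nlinarith [mul_le_mul_of_nonneg_left h3 (abs_nonneg s)]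

theorem wordSum_const_mul {f : Code m → ℝ} {s : ℝ} (hs : 0 ≤ s) (w : List (Fin m)) :
    wordSum (fun ω => s * f ω) w = s * wordSum f w := by
  rw [wordSum, wordSum, ← smul_eq_mul, ← Real.sSup_smul_of_nonneg hs, ← image_smul, image_image]
  simp only [birkhoffSum_const_mul, smul_eq_mul]

/-- The Birkhoff sum of a function of the first letter is constant on the cylinder, so the supremum
is attained everywhere and no distortion constant enters. -/
theorem wordSum_letter (g : Fin m → ℝ) {w : List (Fin m)} {x : Code m}
    (hx : x ∈ cylinder w) :
    wordSum (fun ω => g (ω 0)) w = birkhoffSum shift (fun ω => g (ω 0)) w.length x := by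
  rw [wordSum]
  have : birkhoffSum shift (fun ω => g (ω 0)) w.length '' cylinder w =
      {birkhoffSum shift (fun ω => g (ω 0)) w.length x} := by
    refine Subsingleton.eq_singleton_of_mem ?_ (mem_image_of_mem _ hx)
    rintro _ ⟨y, hy, rfl⟩ _ ⟨z, hz, rfl⟩
    exact birkhoffSum_congr_initial g (hy.trans hz.symm)
  rw [this, csSup_singleton]

namespace BoundedDistortion

variable {f : Code m → ℝ} {M B : ℝ} (hf : BoundedDistortion f M B) (hm : 2 ≤ m)
include hf

theorem birkhoffSum_le_wordSum {w : List (Fin m)} {x : Code m} (hx : x ∈ cylinder w) :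
    birkhoffSum shift f w.length x ≤ wordSum f w :=
  le_csSup ⟨w.length * M, by
    rintro _ ⟨y, -, rfl⟩
    exact (abs_le.1 (abs_birkhoffSum_le hf.bound _ _)).2⟩ (mem_image_of_mem _ hx)

theorem wordSum_le {w : List (Fin m)} {x : Code m} (hx : x ∈ cylinder w) :
    wordSum f w ≤ birkhoffSum shift f w.length x + B := by
  refine csSup_le ⟨_, mem_image_of_mem _ hx⟩ ?_
  rintro _ ⟨y, hy, rfl⟩
  exact hf.distortion w y hy x hx

include hm

theorem distortion_nonneg : 0 ≤ B := by
  have h : (fun _ => ⟨0, by omega⟩ : Code m) ∈ cylinder [] := by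
    rw [cylinder_nil]
    trivial
  linarith [hf.distortion [] _ h _ h]

theorem wordSum_append_le (u v : List (Fin m)) :
    wordSum f (u ++ v) ≤ wordSum f u + wordSum f v := by
  refine csSup_le ((cylinder_nonempty hm _).image _) ?_
  rintro _ ⟨y, hy, rfl⟩
  rw [mem_cylinder_append] at hy
  rw [List.length_append, birkhoffSum_add]
  exact add_le_add (hf.birkhoffSum_le_wordSum hy.1) (hf.birkhoffSum_le_wordSum hy.2)

/-- In the full shift every point of `[v]` may be preceded by `u`. Only the contribution of `u`
depends on the point chosen, and it varies by at most `B`. -/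
theorem le_wordSum_append (u v : List (Fin m)) :
    wordSum f u + wordSum f v ≤ wordSum f (u ++ v) + B := by
  suffices h : wordSum f v ≤ wordSum f (u ++ v) + B - wordSum f u by linarith
  refine csSup_le ((cylinder_nonempty hm _).image _) ?_
  rintro _ ⟨y, hy, rfl⟩
  have h1 : cat u y ∈ cylinder (u ++ v) := by
    rw [mem_cylinder_append, shift_iterate_cat]
    exact ⟨cat_mem_cylinder _ _, hy⟩
  have h2 := hf.birkhoffSum_le_wordSum h1
  rw [List.length_append, birkhoffSum_add, shift_iterate_cat] at h2
  linarith [hf.wordSum_le (cat_mem_cylinder u y)]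

theorem abs_wordSum_le (w : List (Fin m)) : |wordSum f w| ≤ w.length * M := by
  obtain ⟨x, hx⟩ := cylinder_nonempty hm w
  rw [abs_le]
  refine ⟨(abs_le.1 (abs_birkhoffSum_le hf.bound _ x)).1.trans (hf.birkhoffSum_le_wordSum hx), ?_⟩
  refine csSup_le ⟨_, mem_image_of_mem _ hx⟩ ?_
  rintro _ ⟨y, -, rfl⟩
  exact (abs_le.1 (abs_birkhoffSum_le hf.bound _ y)).2

end BoundedDistortion

/-- Fekete's lemma. Its infimum form is what later gives bounds valid at every level `n`, not only
asymptotically. -/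
theorem tendsto_of_subadditive_log {u : ℕ → ℝ} (hu : Subadditive u) {C D : ℝ}
    (h : ∀ n, |u n| ≤ C + n * D) : Tendsto (fun n => u n / n) atTop (𝓝 hu.lim) ∧
      ∀ n, n ≠ 0 → hu.lim ≤ u n / n := by
  have hC : 0 ≤ C := by simpa using (abs_nonneg _).trans (h 0)
  have hb : BddBelow (range fun n => u n / n) := by
    refine ⟨-(C + |D|), ?_⟩
    rintro _ ⟨n, rfl⟩
    rcases Nat.eq_zero_or_pos n with rfl | hn
    · simp
      linarith [abs_nonneg D]
    · have hn' : (1 : ℝ) ≤ n := by exact_mod_cast hn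
      change _ ≤ u n / n
      rw [le_div_iff₀ (by linarith)]
      nlinarith [(abs_le.1 (h n)).1, le_abs_self D, mul_le_mul_of_nonneg_left hn' hC,
        mul_le_mul_of_nonneg_left (le_abs_self D) (by linarith : (0 : ℝ) ≤ n)]
  exact ⟨hu.tendsto_lim hb, fun n hn => hu.lim_le_div hb hn⟩

/-- The partition sums `∑_{w ∈ I^n} exp (S_w f)`. -/
def partitionSum (f : Code m → ℝ) (n : ℕ) : ℝ := ∑ w ∈ words m n, Real.exp (wordSum f w)

theorem words_nonempty (hm : 2 ≤ m) (n : ℕ) : (words m n).Nonempty :=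
  ⟨List.replicate n ⟨0, by omega⟩, mem_words.2 (by simp)⟩

theorem partitionSum_pos (hm : 2 ≤ m) (f : Code m → ℝ) (n : ℕ) : 0 < partitionSum f n :=
  Finset.sum_pos (fun _ _ => Real.exp_pos _) (words_nonempty hm n)

theorem card_words (m n : ℕ) : (words m n).card = m ^ n := by
  rw [words, Finset.card_image_of_injective _ List.ofFn_injective]
  simp

namespace BoundedDistortion

variable {f : Code m → ℝ} {M B : ℝ} (hf : BoundedDistortion f M B) (hm : 2 ≤ m)
include hf hm

theorem partitionSum_add_le (n k : ℕ) :
    partitionSum f (n + k) ≤ partitionSum f n * partitionSum f k := by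
  rw [partitionSum, sum_words_add, partitionSum, partitionSum, Finset.sum_mul_sum]
  gcongr with u _ v _
  rw [← Real.exp_add]
  exact Real.exp_le_exp.2 (hf.wordSum_append_le hm u v)

theorem le_partitionSum_add (n k : ℕ) :
    partitionSum f n * partitionSum f k ≤ Real.exp B * partitionSum f (n + k) := by
  rw [partitionSum, partitionSum, partitionSum, sum_words_add, Finset.sum_mul_sum, Finset.mul_sum]
  refine Finset.sum_le_sum fun u _ => ?_
  rw [Finset.mul_sum]
  refine Finset.sum_le_sum fun v _ => ?_
  rw [← Real.exp_add, ← Real.exp_add]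
  exact Real.exp_le_exp.2 (by linarith [hf.le_wordSum_append hm u v])

theorem log_partitionSum_bounds (n : ℕ) :
    |Real.log (partitionSum f n)| ≤ n * (Real.log m + M) := by
  have hm0 : (0 : ℝ) < m := by
    have : (2 : ℝ) ≤ m := by exact_mod_cast hm
    linarith
  have hlog : 0 ≤ Real.log m := Real.log_natCast_nonneg m
  have hexp : ∀ c : ℝ, ∑ _w ∈ words m n, Real.exp c = Real.exp (n * Real.log m + c) := by
    intro c
    rw [Finset.sum_const, card_words, nsmul_eq_mul, Real.exp_add, mul_comm (n : ℝ),
      ← Real.rpow_def_of_pos hm0]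
    simp
  have hl : ∀ w ∈ words m n, |wordSum f w| ≤ n * M := by
    intro w hw
    rw [← mem_words.1 hw]
    exact hf.abs_wordSum_le hm w
  have h1 : partitionSum f n ≤ Real.exp (n * (Real.log m + M)) := by
    rw [mul_add, ← hexp]
    exact Finset.sum_le_sum fun w hw => Real.exp_le_exp.2 (abs_le.1 (hl w hw)).2
  have h2 : Real.exp (-(n * (Real.log m + M))) ≤ partitionSum f n := by
    refine (Real.exp_le_exp.2 ?_).trans ((hexp (-(n * M))).symm.le.trans
      (Finset.sum_le_sum fun w hw => Real.exp_le_exp.2 (abs_le.1 (hl w hw)).1))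
    have : 0 ≤ n * Real.log m := by positivity
    linarith
  rw [abs_le]
  constructor
  · rwa [Real.le_log_iff_exp_le (partitionSum_pos hm f n)]
  · rwa [Real.log_le_iff_le_exp (partitionSum_pos hm f n)]

theorem subadditive_log : Subadditive fun n => Real.log (partitionSum f n) := by
  intro n k
  rw [← Real.log_mul (partitionSum_pos hm f n).ne' (partitionSum_pos hm f k).ne']
  exact Real.log_le_log (partitionSum_pos hm f _) (hf.partitionSum_add_le hm n k)

/-- Supermultiplicativity holds up to the factor `exp B`; one copy of `B` added to each term absorbs
it. -/
theorem subadditive_neg_log : Subadditive fun n => B - Real.log (partitionSum f n) := by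
  intro n k
  have := Real.log_le_log (mul_pos (partitionSum_pos hm f n) (partitionSum_pos hm f k))
    (hf.le_partitionSum_add hm n k)
  rw [Real.log_mul (partitionSum_pos hm f n).ne' (partitionSum_pos hm f k).ne',
    Real.log_mul (Real.exp_pos _).ne' (partitionSum_pos hm f _).ne', Real.log_exp] at this
  simp only
  linarith

theorem tendsto_pressure :
    Tendsto (fun n : ℕ => Real.log (partitionSum f n) / n) atTop (𝓝 (pressure f)) := by
  have h := (tendsto_of_subadditive_log (hf.subadditive_log hm) (C := 0)
    (D := Real.log m + M) (by simpa using hf.log_partitionSum_bounds hm)).1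
  have : pressure f = (hf.subadditive_log hm).lim := by
    refine Tendsto.limUnder_eq (h.congr fun n => ?_)
    rw [partitionSum, sum_words, one_div, inv_mul_eq_div]
  rwa [this]

theorem exp_pressure_le (n : ℕ) : Real.exp (n * pressure f) ≤ partitionSum f n := by
  rcases Nat.eq_zero_or_pos n with rfl | hn
  · have h := hf.partitionSum_add_le hm 0 0
    simp only [add_zero] at h
    have := partitionSum_pos hm f 0
    simp only [Nat.cast_zero, zero_mul, Real.exp_zero]
    nlinarith
  · have h := tendsto_of_subadditive_log (hf.subadditive_log hm) (C := 0)
      (D := Real.log m + M) (by simpa using hf.log_partitionSum_bounds hm)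
    have h2 := h.2 n hn.ne'
    rw [tendsto_nhds_unique h.1 (hf.tendsto_pressure hm),
      le_div_iff₀ (by exact_mod_cast hn)] at h2
    rw [← Real.le_log_iff_exp_le (partitionSum_pos hm f n)]
    linarith

/-- Fekete's lemma for the shifted negative logarithm. With `exp_pressure_le` it confines the
partition sums to `[1, exp B]` at zero pressure, which is the source of all Gibbs constants. -/
theorem partitionSum_le (n : ℕ) : partitionSum f n ≤ Real.exp (B + n * pressure f) := by
  rw [← Real.log_le_iff_le_exp (partitionSum_pos hm f n)]
  rcases Nat.eq_zero_or_pos n with rfl | hn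
  · have h := hf.subadditive_neg_log hm 0 0
    simp only [add_zero] at h
    simp only [Nat.cast_zero, zero_mul]
    linarith
  · have h := tendsto_of_subadditive_log (hf.subadditive_neg_log hm) (C := |B|)
      (D := Real.log m + M) fun n => by
        have h1 := hf.log_partitionSum_bounds hm n
        exact (abs_sub _ _).trans (by linarith)
    have h2 := h.2 n hn.ne'
    have h3 : Tendsto (fun n : ℕ => (B - Real.log (partitionSum f n)) / n) atTop
        (𝓝 (0 - pressure f)) := by
      simp only [sub_div]
      exact (tendsto_const_div_atTop_nhds_zero_nat B).sub (hf.tendsto_pressure hm)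
    rw [tendsto_nhds_unique h.1 h3, le_div_iff₀ (by exact_mod_cast hn)] at h2
    linarith

theorem pressure_le_pressure_add {g : Code m → ℝ} {M' B' : ℝ} (hg : BoundedDistortion g M' B')
    {a : ℝ} (h : ∀ ω, f ω ≤ g ω + a) : pressure f ≤ pressure g + a := by
  refine le_of_tendsto_of_tendsto (hf.tendsto_pressure hm)
    ((hg.tendsto_pressure hm).add_const a) ?_
  filter_upwards [eventually_gt_atTop 0] with n hn
  have hn' : (0 : ℝ) < n := by exact_mod_cast hn
  rw [div_add' _ _ _ hn'.ne']
  gcongr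
  rw [Real.log_le_iff_le_exp (partitionSum_pos hm f n), Real.exp_add,
    Real.exp_log (partitionSum_pos hm g n), partitionSum, partitionSum, Finset.sum_mul]
  gcongr with w hw
  rw [← Real.exp_add, Real.exp_le_exp]
  refine csSup_le ((cylinder_nonempty hm w).image _) ?_
  rintro _ ⟨y, hy, rfl⟩
  refine (birkhoffSum_mono (g := fun ω => g ω - -a) (fun ω => by linarith [h ω]) _ y).trans ?_
  rw [birkhoffSum_sub_const, mem_words.1 hw]
  have := hg.birkhoffSum_le_wordSum hy
  rw [mem_words.1 hw] at this
  linarith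

end BoundedDistortion

theorem pressure_zero_pos (hm : 2 ≤ m) : 0 < pressure (fun _ : Code m => (0 : ℝ)) := by
  have hf : BoundedDistortion (fun _ : Code m => (0 : ℝ)) 0 0 :=
    ⟨by simp, by simp [birkhoffSum]⟩
  have h := hf.partitionSum_le hm 1
  have h0 : partitionSum (fun _ : Code m => (0 : ℝ)) 1 = m := by
    rw [partitionSum, Finset.sum_congr rfl (g := fun _ => 1), Finset.sum_const, card_words]
    · simp
    · intro w _
      obtain ⟨x, hx⟩ := cylinder_nonempty hm w
      have := (abs_nonpos_iff.1 ((hf.abs_wordSum_le hm w).trans (by simp)))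
      rw [this, Real.exp_zero]
  rw [h0] at h
  have h2 : (2 : ℝ) ≤ m := by exact_mod_cast hm
  have : 1 < Real.exp (pressure fun _ : Code m => (0 : ℝ)) := by
    simp only [Nat.cast_one, one_mul, zero_add] at h
    linarith
  exact Real.one_lt_exp_iff.1 this

/-- For a potential bounded away from `0` and `-∞`, the pressure function `s ↦ 𝔓(s f)` is
strictly decreasing, and it has a unique zero, which is positive. -/
theorem exists_pressure_zero (hm : 2 ≤ m) {f : Code m → ℝ} {M B c : ℝ}
    (hf : BoundedDistortion f M B) (hc : 0 < c) (hfc : ∀ ω, f ω ≤ -c) :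
    ∃ δ : ℝ, 0 < δ ∧ (∀ s : ℝ, pressure (fun ω => s * f ω) = 0 ↔ s = δ) ∧
      ∀ s : ℝ, δ < s → pressure (fun ω => s * f ω) < 0 := by
  -- The two inequalities `hup` and `hlo` bound the slope of the pressure function between `-M` and
  -- `-c`, giving continuity and strict decrease at once.
  have hup : ∀ s t : ℝ, s ≤ t →
      pressure (fun ω => t * f ω) ≤ pressure (fun ω => s * f ω) + -((t - s) * c) := by
    intro s t hst
    refine (hf.const_mul t).pressure_le_pressure_add hm (hf.const_mul s) fun ω => ?_
    nlinarith [hfc ω]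
  have hlo : ∀ s t : ℝ, s ≤ t →
      pressure (fun ω => s * f ω) ≤ pressure (fun ω => t * f ω) + (t - s) * M := by
    intro s t hst
    refine (hf.const_mul s).pressure_le_pressure_add hm (hf.const_mul t) fun ω => ?_
    nlinarith [(abs_le.1 (hf.bound ω)).1]
  have hM : 0 ≤ M := (abs_nonneg _).trans (hf.bound fun _ => ⟨0, by omega⟩)
  set P : ℝ → ℝ := fun s => pressure (fun ω => s * f ω) with hP
  have hlip : LipschitzWith M.toNNReal P := by
    refine LipschitzWith.of_dist_le_mul fun s t => ?_
    rw [Real.coe_toNNReal _ hM, Real.dist_eq, Real.dist_eq]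
    wlog hst : s ≤ t generalizing s t
    · rw [abs_sub_comm, abs_sub_comm s]
      exact this t s (le_of_not_ge hst)
    have h1 := hup s t hst
    have h2 := hlo s t hst
    have h3 : 0 ≤ (t - s) * c := mul_nonneg (sub_nonneg.2 hst) hc.le
    rw [abs_sub_comm s, abs_of_nonneg (sub_nonneg.2 hst), abs_le]
    constructor <;> simp only [P] <;> nlinarith
  have h0 : 0 < P 0 := by simpa [P] using pressure_zero_pos hm
  have hanti : StrictAnti P := by
    intro s t hst
    have h1 := hup s t hst.le
    have h3 : 0 < (t - s) * c := mul_pos (sub_pos.2 hst) hc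
    simp only [P]
    linarith
  -- Falling at rate at least `c` from `P 0`, the pressure is used up by the time `P 0 / c`.
  have h1 : P (P 0 / c) ≤ 0 := by
    have := hup 0 (P 0 / c) (by positivity)
    rw [sub_zero, div_mul_cancel₀ _ hc.ne'] at this
    simpa [P] using this
  obtain ⟨δ, hδ, hPδ⟩ := intermediate_value_Icc' (by positivity : 0 ≤ P 0 / c)
    hlip.continuous.continuousOn ⟨h1, h0.le⟩
  refine ⟨δ, ?_, fun s => ⟨fun hs => hanti.injective (hs.trans hPδ.symm), ?_⟩, fun s hs => ?_⟩
  · rcases hδ.1.eq_or_lt with h | h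
    · rw [← h] at hPδ
      exact absurd hPδ h0.ne'
    · exact h
  · rintro rfl
    exact hPδ
  · exact (hanti hs).trans_eq hPδ

/-! ### Existence of Gibbs measures -/

/-- The space of probability measures is compact, so an ultrafilter has a limit in it. A clopen set
has empty frontier, so the portmanteau theorem gives convergence of its mass. -/
theorem exists_limit_probabilityMeasure {X : Type*} [TopologicalSpace X] [CompactSpace X]
    [T2Space X] [MeasurableSpace X] [BorelSpace X] [HasOuterApproxClosed X]
    (ρ : ℕ → ProbabilityMeasure X) (U : Ultrafilter ℕ) :
    ∃ μ : ProbabilityMeasure X, ∀ A : Set X, IsClopen A →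
      Tendsto (fun n => (ρ n : Measure X).real A) U (𝓝 ((μ : Measure X).real A)) := by
  obtain ⟨μ, -, hμ⟩ := isCompact_univ.ultrafilter_le_nhds (U.map ρ) (by simp)
  refine ⟨μ, fun A hA => ?_⟩
  have h := ProbabilityMeasure.tendsto_measure_of_null_frontier_of_tendsto' (μ := μ) (μs := ρ)
    (L := (U : Filter ℕ)) hμ (E := A) (by rw [hA.frontier_eq, measure_empty])
  exact (ENNReal.tendsto_toReal (measure_ne_top _ _)).comp h

/-- Any sequence of probability measures has an invariant limit of its Cesàro averages. -/
theorem exists_invariant_limit {X : Type*} [TopologicalSpace X] [CompactSpace X]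
    [T2Space X] [MeasurableSpace X] [BorelSpace X] [HasOuterApproxClosed X] {T : X → X}
    (hT : Continuous T) (ν : ℕ → Measure X) [∀ n, IsProbabilityMeasure (ν n)] :
    ∃ μ : Measure X, IsProbabilityMeasure μ ∧
      (∀ A, IsClopen A → μ.real (T ⁻¹' A) = μ.real A) ∧
      ∀ A, IsClopen A → ∀ a b : ℝ,
        (∀ᶠ n in atTop, ∀ k < n, (ν n).real (T^[k] ⁻¹' A) ∈ Icc a b) → μ.real A ∈ Icc a b := by
  have hTm : ∀ k, Measurable T^[k] := fun k => (hT.iterate k).measurable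
  set ρ : ℕ → Measure X := fun n =>
    ((n : NNReal) + 1)⁻¹ • ∑ k ∈ Finset.range (n + 1), (ν (n + 1)).map T^[k] with hρ
  have hreal : ∀ n A, MeasurableSet A → (ρ n).real A =
      ((n : ℝ) + 1)⁻¹ * ∑ k ∈ Finset.range (n + 1), (ν (n + 1)).real (T^[k] ⁻¹' A) := by
    intro n A hA
    have h1 : ∀ k, ((ν (n + 1)).map T^[k]).real A = (ν (n + 1)).real (T^[k] ⁻¹' A) :=
      fun k => map_measureReal_apply (hTm k) hA
    rw [hρ]
    simp only [measureReal_nnreal_smul_apply, NNReal.coe_inv, NNReal.coe_add, NNReal.coe_natCast,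
      NNReal.coe_one]
    rw [measureReal_def, Measure.finsetSum_apply, ENNReal.toReal_sum]
    · exact congrArg _ (Finset.sum_congr rfl fun k _ => h1 k)
    · intro k _
      rw [Measure.map_apply (hTm k) hA]
      exact measure_ne_top _ _
  have hprob : ∀ n, IsProbabilityMeasure (ρ n) := by
    intro n
    have h1 : ∀ k, (Measure.map T^[k] (ν (n + 1))) univ = 1 := by
      intro k
      rw [Measure.map_apply (hTm k) MeasurableSet.univ, preimage_univ, measure_univ]
    constructor
    rw [hρ]
    simp only [Measure.smul_apply, Measure.finsetSum_apply, h1, Finset.sum_const,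
      Finset.card_range, nsmul_eq_mul, mul_one]
    rw [ENNReal.smul_def, smul_eq_mul, ENNReal.coe_inv (by positivity)]
    push_cast
    exact ENNReal.inv_mul_cancel (by simp) (by finiteness)
  obtain ⟨μ, hμ⟩ := exists_limit_probabilityMeasure (fun n => ⟨ρ n, hprob n⟩) (hyperfilter ℕ)
  simp only [ProbabilityMeasure.coe_mk] at hμ
  refine ⟨μ, inferInstance, fun A hA => ?_, fun A hA a b hab => ?_⟩
  · have hd : Tendsto (fun n => (ρ n).real (T ⁻¹' A) - (ρ n).real A) atTop (𝓝 0) := by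
      refine squeeze_zero_norm (fun n => ?_) (tendsto_one_div_add_atTop_nhds_zero_nat (𝕜 := ℝ))
      rw [hreal n _ (hT.measurable hA.isOpen.measurableSet), hreal n _ hA.isOpen.measurableSet, ← mul_sub,
        ← Finset.sum_sub_distrib]
      have h2 : ∀ k, T^[k] ⁻¹' (T ⁻¹' A) = T^[k + 1] ⁻¹' A := by
        intro k
        rw [← preimage_comp, ← Function.iterate_succ']
      simp only [h2]
      rw [Finset.sum_range_sub (fun k => (ν (n + 1)).real (T^[k] ⁻¹' A)), norm_mul, one_div,
        Real.norm_of_nonneg (by positivity)]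
      refine mul_le_of_le_one_right (by positivity) ?_
      rw [Real.norm_eq_abs, abs_sub_le_iff]
      have h3 : ∀ B, (ν (n + 1)).real B ≤ 1 := fun B => measureReal_le_one
      have h4 : ∀ B, 0 ≤ (ν (n + 1)).real B := fun B => measureReal_nonneg
      constructor <;> linarith [h3 (T^[n + 1] ⁻¹' A), h3 (T^[0] ⁻¹' A), h4 (T^[n + 1] ⁻¹' A),
        h4 (T^[0] ⁻¹' A)]
    have h5 := (hμ _ (hA.preimage hT)).sub (hμ A hA)
    exact sub_eq_zero.1 (tendsto_nhds_unique h5 (hd.mono_left Nat.hyperfilter_le_atTop))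
  · refine isClosed_Icc.mem_of_tendsto (hμ A hA) (Nat.hyperfilter_le_atTop ?_)
    filter_upwards [(tendsto_add_atTop_nat 1).eventually hab] with n hn
    rw [hreal n A hA.isOpen.measurableSet]
    have hn0 : (0 : ℝ) < (n : ℝ) + 1 := by positivity
    rw [mem_Icc, le_inv_mul_iff₀ hn0, inv_mul_le_iff₀ hn0]
    constructor
    · simpa using Finset.card_nsmul_le_sum (Finset.range (n + 1)) _ a
        fun k hk => (hn k (Finset.mem_range.1 hk)).1
    · simpa using Finset.sum_le_card_nsmul (Finset.range (n + 1)) _ b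
        fun k hk => (hn k (Finset.mem_range.1 hk)).2

/-- The atomic probability measure that gives `cat w x` the mass proportional to `exp (S_w f)`,
for `w` of length `n`. -/
def atomicMeasure (f : Code m → ℝ) (x : Code m) (n : ℕ) : Measure (Code m) :=
  ∑ w ∈ words m n, ENNReal.ofReal (Real.exp (wordSum f w) / partitionSum f n) •
    Measure.dirac (cat w x)

theorem isProbabilityMeasure_atomicMeasure (hm : 2 ≤ m) (f : Code m → ℝ) (x : Code m) (n : ℕ) :
    IsProbabilityMeasure (atomicMeasure f x n) := by
  have hZ := partitionSum_pos hm f n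
  constructor
  rw [atomicMeasure, Measure.finsetSum_apply]
  simp only [Measure.smul_apply, measure_univ, smul_eq_mul, mul_one]
  rw [← ENNReal.ofReal_sum_of_nonneg fun w _ => by positivity, ← Finset.sum_div]
  change ENNReal.ofReal (partitionSum f n / partitionSum f n) = 1
  rw [div_self hZ.ne', ENNReal.ofReal_one]

theorem atomicMeasure_real (hm : 2 ≤ m) (f : Code m → ℝ) (x : Code m) (n : ℕ) {A : Set (Code m)}
    (hA : MeasurableSet A) : (atomicMeasure f x n).real A =
      (∑ w ∈ words m n, Real.exp (wordSum f w) * A.indicator 1 (cat w x)) / partitionSum f n := by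
  have hZ := partitionSum_pos hm f n
  rw [measureReal_def, atomicMeasure, Measure.finsetSum_apply, ENNReal.toReal_sum,
    Finset.sum_div]
  · refine Finset.sum_congr rfl fun w _ => ?_
    rw [Measure.smul_apply, Measure.dirac_apply' _ hA, smul_eq_mul, ENNReal.toReal_mul,
      ENNReal.toReal_ofReal (by positivity)]
    by_cases h : cat w x ∈ A <;> simp [h]
  · intro w _
    rw [Measure.smul_apply, smul_eq_mul]
    exact ENNReal.mul_ne_top ENNReal.ofReal_ne_top (measure_ne_top _ _)

/-- The words with `u` at position `k` are `a ++ (u ++ b)`, and their total weight is, up to `exp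
(-2B)`, the product of two partition sums and `exp (S_u f)`. At zero pressure each partition sum,
including the normalising one, lies in `[1, exp B]`. Below, two splittings and the normalisation
cost `3B`; above, two partition sums cost `2B`. -/
theorem BoundedDistortion.atomicMeasure_mem {f : Code m → ℝ} {M B : ℝ}
    (hf : BoundedDistortion f M B) (hm : 2 ≤ m) (hP : pressure f = 0) (x : Code m)
    (u : List (Fin m)) (k l : ℕ) :
    (atomicMeasure f x (k + (u.length + l))).real (shift^[k] ⁻¹' cylinder u) ∈
      Icc (Real.exp (-(3 * B)) * Real.exp (wordSum f u))
        (Real.exp (2 * B) * Real.exp (wordSum f u)) := by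
  have hZ1 : ∀ n, 1 ≤ partitionSum f n := fun n => by simpa [hP] using hf.exp_pressure_le hm n
  have hZ2 : ∀ n, partitionSum f n ≤ Real.exp B := fun n => by
    simpa [hP] using hf.partitionSum_le hm n
  have hB := hf.distortion_nonneg hm
  set n := k + (u.length + l)
  have hmeas : MeasurableSet (shift^[k] ⁻¹' cylinder u) :=
    (measurable_shift.iterate k) (measurableSet_cylinder u)
  have hsum : ∑ w ∈ words m n, Real.exp (wordSum f w) *
      (shift^[k] ⁻¹' cylinder u).indicator 1 (cat w x) =
      ∑ a ∈ words m k, ∑ b ∈ words m l, Real.exp (wordSum f (a ++ (u ++ b))) := by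
    rw [sum_words_add]
    refine Finset.sum_congr rfl fun a ha => ?_
    rw [sum_words_add]
    rw [Finset.sum_eq_single u]
    · refine Finset.sum_congr rfl fun b _ => ?_
      rw [indicator_of_mem, Pi.one_apply, mul_one]
      rw [mem_preimage, cat_append, ← mem_words.1 ha, shift_iterate_cat, cat_append]
      exact cat_mem_cylinder _ _
    · intro c hc hcu
      refine Finset.sum_eq_zero fun b _ => ?_
      rw [indicator_of_notMem, mul_zero]
      rw [mem_preimage, cat_append, ← mem_words.1 ha, shift_iterate_cat, cat_append]
      intro h
      rw [mem_cylinder, ← mem_words.1 hc, initial_cat] at h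
      exact hcu h
    · intro h
      exact absurd (mem_words.2 rfl) h
  have hprod : ∑ a ∈ words m k, ∑ b ∈ words m l,
      Real.exp (wordSum f a) * Real.exp (wordSum f u) * Real.exp (wordSum f b) =
      partitionSum f k * partitionSum f l * Real.exp (wordSum f u) := by
    rw [partitionSum, partitionSum, Finset.sum_mul_sum, Finset.sum_mul]
    refine Finset.sum_congr rfl fun a _ => ?_
    rw [Finset.sum_mul]
    refine Finset.sum_congr rfl fun b _ => ?_
    ring
  have hup : ∑ a ∈ words m k, ∑ b ∈ words m l, Real.exp (wordSum f (a ++ (u ++ b))) ≤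
      partitionSum f k * partitionSum f l * Real.exp (wordSum f u) := by
    rw [← hprod]
    refine Finset.sum_le_sum fun a _ => Finset.sum_le_sum fun b _ => ?_
    rw [← Real.exp_add, ← Real.exp_add, Real.exp_le_exp]
    linarith [hf.wordSum_append_le hm a (u ++ b), hf.wordSum_append_le hm u b]
  have hlo : Real.exp (-(2 * B)) * (partitionSum f k * partitionSum f l * Real.exp (wordSum f u)) ≤
      ∑ a ∈ words m k, ∑ b ∈ words m l, Real.exp (wordSum f (a ++ (u ++ b))) := by
    rw [← hprod, Finset.mul_sum]
    refine Finset.sum_le_sum fun a _ => ?_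
    rw [Finset.mul_sum]
    refine Finset.sum_le_sum fun b _ => ?_
    rw [← Real.exp_add, ← Real.exp_add, ← Real.exp_add, Real.exp_le_exp]
    linarith [hf.le_wordSum_append hm a (u ++ b), hf.le_wordSum_append hm u b]
  rw [atomicMeasure_real hm f x n hmeas, hsum, mem_Icc,
    le_div_iff₀ (partitionSum_pos hm f n), div_le_iff₀ (partitionSum_pos hm f n)]
  have hE := Real.exp_pos (wordSum f u)
  constructor
  · refine le_trans ?_ hlo
    calc Real.exp (-(3 * B)) * Real.exp (wordSum f u) * partitionSum f n
        ≤ Real.exp (-(3 * B)) * Real.exp (wordSum f u) * Real.exp B := by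
          gcongr
          exact hZ2 n
      _ = Real.exp (-(2 * B)) * (1 * 1 * Real.exp (wordSum f u)) := by
          rw [mul_right_comm, ← Real.exp_add]
          ring_nf
      _ ≤ _ := by
          gcongr
          · exact (partitionSum_pos hm f k).le
          · exact hZ1 k
          · exact hZ1 l
  · refine hup.trans ?_
    calc partitionSum f k * partitionSum f l * Real.exp (wordSum f u)
        ≤ Real.exp B * Real.exp B * Real.exp (wordSum f u) := by
          gcongr
          · exact (partitionSum_pos hm f l).le
          · exact hZ2 k
          · exact hZ2 l
      _ = Real.exp (2 * B) * Real.exp (wordSum f u) * 1 := by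
          rw [← Real.exp_add]
          ring_nf
      _ ≤ _ := by
          gcongr
          exact hZ1 n

theorem BoundedDistortion.exists_isGibbs {f : Code m → ℝ} {M B : ℝ}
    (hf : BoundedDistortion f M B) (hm : 2 ≤ m) (hP : pressure f = 0) :
    ∃ μ : Measure (Code m), IsGibbs f μ := by
  have hB := hf.distortion_nonneg hm
  set x : Code m := fun _ => ⟨0, by omega⟩
  have hpr := isProbabilityMeasure_atomicMeasure hm f x
  -- With words of length `2 * n`, each position `k < n` leaves room for `u` as soon as `n ≥
  -- u.length`.
  obtain ⟨μ, hμ, hinv, hlim⟩ := exists_invariant_limit continuous_shift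
    (fun n => atomicMeasure f x (2 * n))
  have hmem : ∀ u : List (Fin m), μ.real (cylinder u) ∈
      Icc (Real.exp (-(3 * B)) * Real.exp (wordSum f u))
        (Real.exp (2 * B) * Real.exp (wordSum f u)) := by
    intro u
    refine hlim _ (isClopen_cylinder u) _ _ ?_
    filter_upwards [eventually_ge_atTop u.length] with n hn k hk
    have := hf.atomicMeasure_mem hm hP x u k (2 * n - k - u.length)
    rwa [show k + (u.length + (2 * n - k - u.length)) = 2 * n by omega] at this
  refine ⟨μ, hμ, ⟨measurable_shift, ?_⟩, Real.exp (3 * B), Real.one_le_exp (by positivity),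
    fun w y hy => ?_⟩
  · have := Measure.isProbabilityMeasure_map (μ := μ) (measurable_shift (m := m)).aemeasurable
    refine ext_of_cylinder fun w => ?_
    rw [Measure.map_apply measurable_shift (measurableSet_cylinder w)]
    have := hinv _ (isClopen_cylinder w)
    rwa [measureReal_def, measureReal_def, ENNReal.toReal_eq_toReal_iff' (measure_ne_top _ _)
      (measure_ne_top _ _)] at this
  · rw [hP, mul_zero, sub_zero, le_div_iff₀ (Real.exp_pos _), div_le_iff₀ (Real.exp_pos _),
      ← Real.exp_neg]
    have h1 := hf.birkhoffSum_le_wordSum hy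
    have h2 := hf.wordSum_le hy
    constructor
    · refine le_trans ?_ (hmem w).1
      gcongr
    · refine (hmem w).2.trans ?_
      rw [← Real.exp_add, ← Real.exp_add, Real.exp_le_exp]
      linarith

/-! ### Ergodicity and uniqueness of Gibbs measures -/

/-- An inequality, unlike an equality, does not survive proper differences, so the π-λ argument is
not available. Instead, an open set is an increasing union of finite disjoint unions of cylinders,
and outer regularity of `ν` does the rest. -/
theorem measure_le_of_cylinder {μ ν : Measure (Code m)} [IsFiniteMeasure ν]
    (h : ∀ w, μ (cylinder w) ≤ ν (cylinder w)) : μ ≤ ν := by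
  classical
  have hopen : ∀ U : Set (Code m), IsOpen U → μ U ≤ ν U := by
    intro U hU
    set V : ℕ → Finset (List (Fin m)) := fun n => {w ∈ words m n | cylinder w ⊆ U} with hV
    set A : ℕ → Set (Code m) := fun n => ⋃ w ∈ V n, cylinder w with hA
    have hmemA : ∀ n ω, ω ∈ A n ↔ cylinder (initial ω n) ⊆ U := by
      intro n ω
      simp only [A, V, mem_iUnion, Finset.mem_filter, mem_words, exists_prop]
      constructor
      · rintro ⟨w, ⟨rfl, hw⟩, hω⟩
        rwa [mem_cylinder.1 hω]
      · exact fun hω => ⟨_, ⟨length_initial _ _, hω⟩, mem_cylinder_initial _ _⟩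
    have hmono : Monotone A := by
      refine monotone_nat_of_le_succ fun n ω hω => ?_
      rw [hmemA] at hω ⊢
      refine fun η hη => hω ?_
      rw [mem_cylinder, length_initial, initial_eq_iff] at hη ⊢
      exact fun k hk => hη k (hk.trans n.lt_succ_self)
    have hU' : U = ⋃ n, A n := by
      ext ω
      rw [mem_iUnion]
      constructor
      · intro hω
        obtain ⟨I, u, hu, hsub⟩ := isOpen_pi_iff.1 hU ω hω
        refine ⟨I.sup id + 1, (hmemA _ _).2 fun η hη => hsub fun k hk => ?_⟩
        rw [mem_cylinder, length_initial, initial_eq_iff] at hη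
        rw [hη k (Nat.lt_succ_of_le (Finset.le_sup (f := id) hk))]
        exact (hu k hk).2
      · rintro ⟨n, hn⟩
        exact (hmemA n ω).1 hn (mem_cylinder_initial _ _)
    have hmeas : ∀ (ρ : Measure (Code m)) n, ρ (A n) = ∑ w ∈ V n, ρ (cylinder w) := by
      intro ρ n
      refine measure_biUnion_finset (fun u hu v hv huv => ?_) fun w _ => measurableSet_cylinder w
      refine disjoint_cylinder ?_ huv
      rw [mem_words.1 (Finset.mem_filter.1 hu).1, mem_words.1 (Finset.mem_filter.1 hv).1]
    rw [hU', hmono.measure_iUnion, hmono.measure_iUnion]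
    refine iSup_mono fun n => ?_
    rw [hmeas, hmeas]
    exact Finset.sum_le_sum fun w _ => h w
  refine Measure.le_intro fun A _ _ => ?_
  rw [A.measure_eq_iInf_isOpen ν]
  exact le_iInf₂ fun U hAU => le_iInf fun hU => (measure_mono hAU).trans (hopen U hU)

/-- For an invariant set `s` the hypothesis extends from cylinders `[v]` to `s`, giving `μ[u] μ(s) ≤
C μ([u] ∩ s)`. Extending it once more from `[u]` to the complement of `s` gives `μ(sᶜ) μ(s) ≤ 0`. -/
theorem ergodic_of_mul_le {μ : Measure (Code m)} [IsProbabilityMeasure μ]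
    (hinv : MeasurePreserving shift μ μ) (C : NNReal)
    (h : ∀ u v, μ (cylinder u) * μ (cylinder v) ≤ C * μ (cylinder (u ++ v))) :
    Ergodic shift μ := by
  refine ⟨hinv, ⟨fun {s} hs hfs => ?_⟩⟩
  have hiter : ∀ n, shift^[n] ⁻¹' s = s := by
    intro n
    induction n with
    | zero => rfl
    | succ n ih => rw [Function.iterate_succ, preimage_comp, ih, hfs]
  have h1 : ∀ u : List (Fin m), μ (cylinder u) * μ s ≤ C * μ (cylinder u ∩ s) := by
    intro u
    have hmeas : Measurable (shift^[u.length] : Code m → Code m) := measurable_shift.iterate _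
    have hle : μ (cylinder u) • μ ≤
        C • (μ.restrict (cylinder u)).map shift^[u.length] := by
      refine measure_le_of_cylinder fun v => ?_
      rw [Measure.smul_apply, Measure.smul_apply, smul_eq_mul, ENNReal.smul_def, smul_eq_mul,
        Measure.map_apply hmeas (measurableSet_cylinder v),
        Measure.restrict_apply (hmeas (measurableSet_cylinder v))]
      refine (h u v).trans_eq ?_
      congr 2
      ext ω
      rw [mem_cylinder_append, mem_inter_iff, mem_preimage, and_comm]
    have := hle s
    rwa [Measure.smul_apply, Measure.smul_apply, smul_eq_mul, ENNReal.smul_def, smul_eq_mul,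
        Measure.map_apply hmeas hs, hiter, Measure.restrict_apply hs, inter_comm] at this
  have h2 : μ s • μ ≤ C • μ.restrict s := by
    refine measure_le_of_cylinder fun v => ?_
    rw [Measure.smul_apply, Measure.smul_apply, smul_eq_mul, ENNReal.smul_def, smul_eq_mul,
      Measure.restrict_apply (measurableSet_cylinder v), mul_comm]
    exact h1 v
  have h3 := h2 sᶜ
  rw [Measure.smul_apply, Measure.smul_apply, smul_eq_mul, ENNReal.smul_def, smul_eq_mul,
      Measure.restrict_apply hs.compl, compl_inter_self, measure_empty, mul_zero,
      nonpos_iff_eq_zero, mul_eq_zero] at h3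
  rw [Filter.eventuallyConst_set']
  rcases h3 with h3 | h3
  · exact Or.inl (ae_eq_empty.2 h3)
  · exact Or.inr (ae_eq_univ.2 h3)

namespace IsGibbs

variable {f : Code m → ℝ} {μ : Measure (Code m)} (hμ : IsGibbs f μ)
include hμ

theorem exists_bounds : ∃ c : ℝ, 1 ≤ c ∧ ∀ w : List (Fin m), ∀ x ∈ cylinder w,
    c⁻¹ * Real.exp (birkhoffSum shift f w.length x - w.length * pressure f) ≤
      μ.real (cylinder w) ∧
    μ.real (cylinder w) ≤
      c * Real.exp (birkhoffSum shift f w.length x - w.length * pressure f) := by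
  obtain ⟨c, hc, h⟩ := hμ.gibbs
  refine ⟨c, hc, fun w x hx => ?_⟩
  have := h w x hx
  rwa [le_div_iff₀ (Real.exp_pos _), div_le_iff₀ (Real.exp_pos _)] at this

/-- Birkhoff sums are additive along an orbit, so the Gibbs bounds make `μ` quasi-Bernoulli. The
constant `c * c * c` pays for one Gibbs bound on each of the three cylinders. -/
theorem ergodic (hm : 2 ≤ m) : Ergodic shift μ := by
  have := hμ.prob
  obtain ⟨c, hc, h⟩ := hμ.exists_bounds
  have hc0 : 0 < c := by linarith
  refine ergodic_of_mul_le hμ.invariant (c * c * c).toNNReal fun u v => ?_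
  rw [← ENNReal.toReal_le_toReal (by finiteness) (by finiteness), ENNReal.toReal_mul,
    ENNReal.toReal_mul, ENNReal.coe_toReal, Real.coe_toNNReal _ (by positivity)]
  change μ.real _ * μ.real _ ≤ _ * μ.real _
  obtain ⟨x, hx⟩ := cylinder_nonempty hm (u ++ v)
  have h3 := (h _ x hx).1
  rw [mem_cylinder_append] at hx
  have h1 := (h u x hx.1).2
  have h2 := (h v _ hx.2).2
  rw [List.length_append, birkhoffSum_add] at h3
  rw [inv_mul_le_iff₀ hc0] at h3
  refine (mul_le_mul h1 h2 measureReal_nonneg (by positivity)).trans ?_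
  calc _ = c * c * Real.exp (birkhoffSum shift f u.length x +
        birkhoffSum shift f v.length (shift^[u.length] x) -
          ((u.length + v.length : ℕ) : ℝ) * pressure f) := by
        rw [mul_mul_mul_comm, ← Real.exp_add]
        push_cast
        ring_nf
    _ ≤ c * c * (c * μ.real (cylinder (u ++ v))) := by gcongr
    _ = _ := by ring

/-- Both measures are comparable to the same exponentials on cylinders, hence `ν ≪ μ`. An invariant
probability measure absolutely continuous with respect to an ergodic one equals it. -/
theorem eq_of_isGibbs (hm : 2 ≤ m) {ν : Measure (Code m)} (hν : IsGibbs f ν) : ν = μ := by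
  have := hμ.prob
  have := hν.prob
  obtain ⟨c, hc, h⟩ := hμ.exists_bounds
  obtain ⟨d, hd, h'⟩ := hν.exists_bounds
  have hc0 : 0 < c := by linarith
  have hle : ν ≤ (d * c).toNNReal • μ := by
    refine measure_le_of_cylinder fun w => ?_
    rw [Measure.smul_apply, ENNReal.smul_def, smul_eq_mul,
      ← ENNReal.toReal_le_toReal (by finiteness) (by finiteness), ENNReal.toReal_mul,
      ENNReal.coe_toReal, Real.coe_toNNReal _ (by positivity)]
    change ν.real _ ≤ _ * μ.real _
    obtain ⟨x, hx⟩ := cylinder_nonempty hm w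
    refine (h' w x hx).2.trans ?_
    rw [mul_assoc]
    have := (h w x hx).1
    rw [inv_mul_le_iff₀ hc0] at this
    gcongr
  refine (hμ.ergodic hm).eq_of_absolutelyContinuous hν.invariant ?_
  exact (Measure.absolutelyContinuous_of_le hle).trans (Measure.smul_absolutelyContinuous)

end IsGibbs

/-! ### The weak law of large numbers -/

section Ergodic

variable {X : Type*} [MeasurableSpace X] {μ : Measure X} {T : X → X} {f : X → ℝ}

theorem measurable_birkhoffSum (hT : Measurable T) (hf : Measurable f) (n : ℕ) :
    Measurable (birkhoffSum T f n) := by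
  unfold birkhoffSum
  exact Finset.measurable_sum _ fun k _ => hf.comp (hT.iterate k)

theorem memLp_birkhoffSum (hT : MeasurePreserving T μ μ) (hf : MemLp f 2 μ) (n : ℕ) :
    MemLp (birkhoffSum T f n) 2 μ := by
  have : birkhoffSum T f n = ∑ k ∈ Finset.range n, f ∘ T^[k] := by
    funext x
    simp [birkhoffSum]
  rw [this]
  exact memLp_finsetSum' _ fun k _ => hf.comp_measurePreserving (hT.iterate k)

/-- The mean ergodic theorem, in the form of the weak law of large numbers. -/
theorem tendsto_measure_birkhoffSum [IsProbabilityMeasure μ] (hT : Ergodic T μ) (hf : MemLp f 2 μ) {ε : ℝ} (hε : 0 < ε) :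
    Tendsto (fun n : ℕ => μ.real {x | ε ≤ |(n : ℝ)⁻¹ * birkhoffSum T f n x - ∫ x, f x ∂μ|})
      atTop (𝓝 0) := by
  have hTm := hT.toMeasurePreserving
  -- Von Neumann's theorem for the Koopman operator: the averages converge in L² to the projection
  -- onto its fixed vectors, which are constants by ergodicity.
  set U : Lp ℝ 2 μ →L[ℝ] Lp ℝ 2 μ :=
    (Lp.compMeasurePreservingₗᵢ ℝ T hTm).toContinuousLinearMap with hU
  have hU1 : ‖U‖ ≤ 1 := LinearIsometry.norm_toContinuousLinearMap_le _
  have hlim := U.tendsto_birkhoffAverage_orthogonalProjection hU1 (hf.toLp f)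
  set P : Lp ℝ 2 μ := ((U.eqLocus (1 : Lp ℝ 2 μ →L[ℝ] Lp ℝ 2 μ)).orthogonalProjectionOnto
    (hf.toLp f) : Lp ℝ 2 μ) with hP
  have hPfix : Lp.compMeasurePreserving T hTm P = P :=
    ((U.eqLocus (1 : Lp ℝ 2 μ →L[ℝ] Lp ℝ 2 μ)).orthogonalProjectionOnto (hf.toLp f)).2
  obtain ⟨c, hc⟩ := hT.ae_eq_const_of_ae_eq_comp_ae (Lp.aestronglyMeasurable P)
    ((Lp.coeFn_compMeasurePreserving P hTm).symm.trans (by rw [hPfix]))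
  have hsum : ∀ n, birkhoffSum U _root_.id n (hf.toLp f) =
      (memLp_birkhoffSum hTm hf n).toLp _ := by
    intro n
    induction n with
    | zero =>
      rw [birkhoffSum_zero]
      refine (Lp.ext ?_).symm
      refine (MemLp.coeFn_toLp _).trans ?_
      filter_upwards [Lp.coeFn_zero ℝ 2 μ] with x hx
      rw [birkhoffSum_zero, hx]
      rfl
    | succ n ih =>
      have hit : U^[n] (hf.toLp f) = (hf.comp_measurePreserving (hTm.iterate n)).toLp _ := by
        have : (U : Lp ℝ 2 μ → Lp ℝ 2 μ) = Lp.compMeasurePreserving T hTm := rfl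
        rw [this, Lp.compMeasurePreserving_iterate]
        rfl
      rw [birkhoffSum_succ, ih, id, hit, ← MemLp.toLp_add]
      congr 1
      funext x
      rw [birkhoffSum_succ]
      rfl
  have hcoe : ∀ n : ℕ, (birkhoffAverage ℝ U _root_.id n (hf.toLp f) - P : Lp ℝ 2 μ) =ᵐ[μ]
      fun x => (n : ℝ)⁻¹ * birkhoffSum T f n x - c := by
    intro n
    refine (Lp.coeFn_sub _ _).trans ?_
    have h1 : (birkhoffAverage ℝ U _root_.id n (hf.toLp f) : Lp ℝ 2 μ) =ᵐ[μ]
        fun x => (n : ℝ)⁻¹ * birkhoffSum T f n x := by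
      rw [birkhoffAverage, hsum]
      refine (Lp.coeFn_smul _ _).trans ?_
      filter_upwards [(memLp_birkhoffSum hTm hf n).coeFn_toLp] with x hx
      simp [hx]
    filter_upwards [h1, hc] with x h1 h2
    simp [h1, h2]
  have hmem : ∀ n : ℕ, MemLp (fun x => (n : ℝ)⁻¹ * birkhoffSum T f n x - c) 2 μ := fun n =>
    ((memLp_birkhoffSum hTm hf n).const_mul _).sub (memLp_const c)
  have hnorm : Tendsto (fun n : ℕ => ∫ x, |(n : ℝ)⁻¹ * birkhoffSum T f n x - c| ∂μ) atTop
      (𝓝 0) := by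
    have h0 : Tendsto (fun n : ℕ => ‖birkhoffAverage ℝ U _root_.id n (hf.toLp f) - P‖) atTop
        (𝓝 0) := tendsto_iff_norm_sub_tendsto_zero.1 hlim
    refine squeeze_zero (fun n => integral_nonneg fun x => abs_nonneg _) (fun n => ?_) h0
    rw [Lp.norm_def, eLpNorm_congr_ae (hcoe n)]
    have h2 := eLpNorm_le_eLpNorm_of_exponent_le (p := 1) (q := 2) (by norm_num)
      (hmem n).aestronglyMeasurable
    have h3 : ∫ x, |(n : ℝ)⁻¹ * birkhoffSum T f n x - c| ∂μ =
        (eLpNorm (fun x => (n : ℝ)⁻¹ * birkhoffSum T f n x - c) 1 μ).toReal := by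
      rw [eLpNorm_one_eq_lintegral_enorm, ← integral_norm_eq_lintegral_enorm
        (hmem n).aestronglyMeasurable]
      rfl
    rw [h3]
    exact ENNReal.toReal_mono (hmem n).2.ne h2
  have hint : ∀ n : ℕ, n ≠ 0 → ∫ x, (n : ℝ)⁻¹ * birkhoffSum T f n x ∂μ = ∫ x, f x ∂μ := by
    intro n hn
    rw [integral_const_mul]
    have h1 : ∀ k, ∫ x, f (T^[k] x) ∂μ = ∫ x, f x ∂μ := by
      intro k
      have h2 := (hTm.iterate k).map_eq
      conv_rhs => rw [← h2]
      rw [integral_map (hTm.iterate k).measurable.aemeasurable]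
      rw [h2]
      exact hf.aestronglyMeasurable
    simp only [birkhoffSum]
    rw [integral_finsetSum]
    · simp only [h1]
      rw [Finset.sum_const, Finset.card_range, nsmul_eq_mul, inv_mul_cancel_left₀]
      exact_mod_cast hn
    · intro k _
      exact (hf.comp_measurePreserving (hTm.iterate k)).integrable (by norm_num)
  -- Each average has the integral of `f`, and the averages converge to `c` in L¹.
  have hceq : ∫ x, f x ∂μ = c := by
    have h1 : Tendsto (fun _ : ℕ => |(∫ x, f x ∂μ) - c|) atTop (𝓝 0) := by
      refine squeeze_zero' (Eventually.of_forall fun n => abs_nonneg _) ?_ hnorm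
      filter_upwards [eventually_ne_atTop 0] with n hn
      rw [← hint n hn]
      have : (∫ x, (n : ℝ)⁻¹ * birkhoffSum T f n x ∂μ) - c =
          ∫ x, ((n : ℝ)⁻¹ * birkhoffSum T f n x - c) ∂μ := by
        rw [integral_sub (((memLp_birkhoffSum hTm hf n).const_mul _).integrable (by norm_num))
          (integrable_const c)]
        simp
      rw [this]
      exact abs_integral_le_integral_abs
    exact sub_eq_zero.1 (abs_eq_zero.1 (tendsto_nhds_unique tendsto_const_nhds h1))
  rw [hceq]
  have h5 := hnorm.div_const ε
  rw [zero_div] at h5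
  refine squeeze_zero (fun n => measureReal_nonneg) (fun n => ?_) h5
  rw [le_div_iff₀ hε, mul_comm]
  exact mul_meas_ge_le_integral_of_nonneg (Eventually.of_forall fun x => abs_nonneg _)
    ((hmem n).integrable (by norm_num)).abs ε

end Ergodic

/-! ### Recurrence of centred Birkhoff sums -/

/-- Sort the values in `[-L, L]` into at most `2R + 1` bins of width `K`. Two values in one bin are
closer than `K`, so the squares of the bin counts sum to at most the number of close pairs;
Cauchy-Schwarz compares this sum with the square of the total. -/
theorem sq_card_le_mul_card_pairs (s : ℕ → ℝ) (T R : ℕ) {K L : ℝ} (hK : 0 < K)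
    (hR : L / K + 1 ≤ R) :
    ((Finset.card {i ∈ Finset.range T | |s i| ≤ L} : ℕ) : ℝ) ^ 2 ≤ (2 * R + 1) *
      (Finset.card {q ∈ Finset.range T ×ˢ Finset.range T | |s q.2 - s q.1| ≤ K} : ℕ) := by
  classical
  set G : Finset ℕ := {i ∈ Finset.range T | |s i| ≤ L} with hG
  set Q : Finset (ℕ × ℕ) := {q ∈ Finset.range T ×ˢ Finset.range T | |s q.2 - s q.1| ≤ K}
    with hQ
  set b : ℕ → ℤ := fun i => ⌊s i / K⌋ with hb
  set N : Finset ℤ := Finset.Icc (-(R : ℤ)) R with hN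
  set Fb : ℤ → Finset ℕ := fun z => {i ∈ G | b i = z} with hFb
  have hmaps : ∀ i ∈ G, b i ∈ N := by
    intro i hi
    have h1 : |s i| ≤ L := (Finset.mem_filter.1 hi).2
    have h2 : |s i / K| ≤ L / K := by
      rw [abs_div, abs_of_pos hK]
      gcongr
    rw [abs_le] at h2
    rw [hN, Finset.mem_Icc]
    constructor
    · rw [Int.le_floor]
      push_cast
      linarith
    · have h3 := Int.floor_le (s i / K)
      have : ((⌊s i / K⌋ : ℤ) : ℝ) ≤ ((R : ℤ) : ℝ) := by
        push_cast
        linarith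
      exact_mod_cast this
  have hcard : (G.card : ℝ) = ∑ z ∈ N, ((Fb z).card : ℝ) := by
    rw [Finset.card_eq_sum_card_fiberwise (f := b) (t := N) (fun i hi => hmaps i hi)]
    push_cast
    rfl
  have hpairs : ∑ z ∈ N, (Fb z).card ^ 2 ≤ Q.card := by
    calc ∑ z ∈ N, (Fb z).card ^ 2 = ∑ z ∈ N, (Fb z ×ˢ Fb z).card := by
          simp only [Finset.card_product, sq]
      _ = (N.biUnion fun z => Fb z ×ˢ Fb z).card := by
          rw [Finset.card_biUnion]
          intro z _ z' _ hzz
          refine Finset.disjoint_left.2 fun q hq hq' => ?_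
          rw [Finset.mem_product] at hq hq'
          exact hzz ((Finset.mem_filter.1 hq.1).2.symm.trans (Finset.mem_filter.1 hq'.1).2)
      _ ≤ Q.card := by
          refine Finset.card_le_card fun q hq => ?_
          obtain ⟨z, -, hq⟩ := Finset.mem_biUnion.1 hq
          rw [Finset.mem_product] at hq
          obtain ⟨h1, h1'⟩ := Finset.mem_filter.1 hq.1
          obtain ⟨h2, h2'⟩ := Finset.mem_filter.1 hq.2
          refine Finset.mem_filter.2 ⟨Finset.mem_product.2
            ⟨(Finset.mem_filter.1 h1).1, (Finset.mem_filter.1 h2).1⟩, ?_⟩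
          have h3 : |s q.2 / K - s q.1 / K| < 1 := Int.abs_sub_lt_one_of_floor_eq_floor
            (h2'.trans h1'.symm)
          rw [← sub_div, abs_div, abs_of_pos hK, div_lt_one hK] at h3
          exact h3.le
  have hNcard : (N.card : ℝ) = 2 * R + 1 := by
    rw [hN, Int.card_Icc]
    have : ((R : ℤ) + 1 - -(R : ℤ)).toNat = 2 * R + 1 := by omega
    rw [this]
    push_cast
    ring
  rw [hcard]
  refine sq_sum_le_card_mul_sum_sq.trans ?_
  rw [hNcard]
  gcongr
  exact_mod_cast hpairs

section Ergodic

variable {X : Type*} [MeasurableSpace X] {μ : Measure X} {T : X → X} {f : X → ℝ}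

theorem measure_abs_birkhoffSum_sub (hT : MeasurePreserving T μ μ) (hf : Measurable f) (K : ℝ)
    (i n : ℕ) : μ.real {x | |birkhoffSum T f (i + n) x - birkhoffSum T f i x| ≤ K} =
      μ.real {x | |birkhoffSum T f n x| ≤ K} := by
  have h : {x | |birkhoffSum T f (i + n) x - birkhoffSum T f i x| ≤ K} =
      T^[i] ⁻¹' {x | |birkhoffSum T f n x| ≤ K} := by
    ext x
    simp [birkhoffSum_add]
  rw [h, measureReal_def, measureReal_def, (hT.iterate i).measure_preimage]
  exact (measurableSet_le (measurable_birkhoffSum hT.measurable hf n).abs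
    measurable_const).nullMeasurableSet

/-- By stationarity a pair's probability depends only on the gap between its indices. Each index,
paired with the later or with the earlier ones, contributes at most the full series. -/
theorem sum_measure_pairs_le (hT : MeasurePreserving T μ μ) (hf : Measurable f) {K : ℝ}
    (hs : Summable fun n : ℕ => μ.real {x | |birkhoffSum T f n x| ≤ K}) (N : ℕ) :
    ∑ q ∈ Finset.range N ×ˢ Finset.range N,
      μ.real {x | |birkhoffSum T f q.2 x - birkhoffSum T f q.1 x| ≤ K} ≤
      2 * N * ∑' n : ℕ, μ.real {x | |birkhoffSum T f n x| ≤ K} := by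
  set a : ℕ → ℝ := fun n => μ.real {x | |birkhoffSum T f n x| ≤ K} with ha
  have ha0 : ∀ n, 0 ≤ a n := fun n => measureReal_nonneg
  have hpair : ∀ i j, μ.real {x | |birkhoffSum T f j x - birkhoffSum T f i x| ≤ K} ≤
      (if i ≤ j then a (j - i) else 0) + (if j ≤ i then a (i - j) else 0) := by
    intro i j
    rcases le_total i j with h | h
    · obtain ⟨n, rfl⟩ := Nat.exists_eq_add_of_le h
      rw [measure_abs_birkhoffSum_sub hT hf, if_pos h, Nat.add_sub_cancel_left]
      have : 0 ≤ if i + n ≤ i then a (i - (i + n)) else 0 := by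
        split_ifs
        exacts [ha0 _, le_rfl]
      simp only [a] at this ⊢
      linarith
    · obtain ⟨n, rfl⟩ := Nat.exists_eq_add_of_le h
      simp only [abs_sub_comm (birkhoffSum T f j _)]
      rw [measure_abs_birkhoffSum_sub hT hf, if_pos h, Nat.add_sub_cancel_left]
      have : 0 ≤ if j + n ≤ j then a (j - (j + n)) else 0 := by
        split_ifs
        exacts [ha0 _, le_rfl]
      simp only [a] at this ⊢
      linarith
  have h1 : ∀ i, ∑ j ∈ Finset.range N, (if i ≤ j then a (j - i) else 0) ≤ ∑' n, a n := by
    intro i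
    rw [← Finset.sum_filter]
    refine (le_of_eq ?_).trans (hs.sum_le_tsum
      ((Finset.filter (i ≤ ·) (Finset.range N)).image fun j => j - i) fun n _ => ha0 n)
    rw [Finset.sum_image]
    intro x hx y hy hxy
    have := (Finset.mem_filter.1 hx).2
    have := (Finset.mem_filter.1 hy).2
    simp only at hxy
    omega
  have h2 : ∀ j, ∑ i ∈ Finset.range N, (if j ≤ i then a (i - j) else 0) ≤ ∑' n, a n := h1
  calc _ ≤ ∑ q ∈ Finset.range N ×ˢ Finset.range N, ((if q.1 ≤ q.2 then a (q.2 - q.1) else 0) +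
        (if q.2 ≤ q.1 then a (q.1 - q.2) else 0)) := Finset.sum_le_sum fun q _ => hpair q.1 q.2
    _ = ∑ i ∈ Finset.range N, ∑ j ∈ Finset.range N, (if i ≤ j then a (j - i) else 0) +
        ∑ j ∈ Finset.range N, ∑ i ∈ Finset.range N, (if j ≤ i then a (i - j) else 0) := by
        rw [Finset.sum_add_distrib, Finset.sum_product, Finset.sum_product_right]
    _ ≤ ∑ _i ∈ Finset.range N, ∑' n, a n + ∑ _i ∈ Finset.range N, ∑' n, a n :=
        add_le_add (Finset.sum_le_sum fun i _ => h1 i) (Finset.sum_le_sum fun i _ => h2 i)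
    _ = _ := by
        rw [Finset.sum_const, Finset.card_range, nsmul_eq_mul]
        ring

/-- **Atkinson's recurrence theorem**: the Birkhoff sums of a centred function return to every
neighbourhood of zero so often that the return probabilities are not summable. -/
theorem not_summable_measure_abs_birkhoffSum_le [IsProbabilityMeasure μ] (hT : Ergodic T μ)
    (hf : Measurable f) (hf2 : MemLp f 2 μ) (h0 : ∫ x, f x ∂μ = 0) {K : ℝ} (hK : 0 < K) :
    ¬ Summable fun n : ℕ => μ.real {x | |birkhoffSum T f n x| ≤ K} := by
  intro hs
  have hTm := hT.toMeasurePreserving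
  set M : ℝ := ∑' n : ℕ, μ.real {x | |birkhoffSum T f n x| ≤ K} with hM
  have hM0 : 0 ≤ M := tsum_nonneg fun n => measureReal_nonneg
  -- Summable return probabilities allow only linearly many close pairs among `N` sums. The weak law
  -- keeps most sums within `ε * N`, that is, in about `2 * ε * N / K` bins, which forces more pairs
  -- than that once `ε` is small. The factor 32 makes the leading term in `h10` equal to `N / 8`,
  -- half of the `N / 4` in `h8`.
  set ε : ℝ := K / (32 * (M + 1)) with hε
  have hε0 : 0 < ε := by positivity
  have hSm := measurable_birkhoffSum hTm.measurable hf
  have hms : ∀ L n, MeasurableSet {x | |birkhoffSum T f n x| ≤ L} := fun L n =>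
    measurableSet_le (hSm n).abs measurable_const
  have hmp : ∀ q : ℕ × ℕ,
      MeasurableSet {x | |birkhoffSum T f q.2 x - birkhoffSum T f q.1 x| ≤ K} := fun q =>
    measurableSet_le ((hSm q.2).sub (hSm q.1)).abs measurable_const
  -- most of the Birkhoff sums are small
  obtain ⟨n₀, hn₀⟩ : ∃ n₀ : ℕ, ∀ n ≥ n₀, 3 / 4 ≤ μ.real {x | |birkhoffSum T f n x| ≤ ε * n} := by
    have h1 := tendsto_measure_birkhoffSum hT hf2 hε0
    rw [h0] at h1
    have h2 := (h1.eventually (gt_mem_nhds (by norm_num : (0 : ℝ) < 1 / 4))).and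
      (eventually_gt_atTop 0)
    obtain ⟨n₀, hn₀⟩ := eventually_atTop.1 h2
    refine ⟨n₀, fun n hn => ?_⟩
    obtain ⟨h3, h4⟩ := hn₀ n hn
    have hn' : (0 : ℝ) < n := by exact_mod_cast h4
    have h5 : {x | |birkhoffSum T f n x| ≤ ε * n}ᶜ ⊆
        {x | ε ≤ |(n : ℝ)⁻¹ * birkhoffSum T f n x - 0|} := by
      intro x hx
      rw [mem_compl_iff, mem_ofPred_eq, not_le] at hx
      rw [mem_ofPred_eq, sub_zero, abs_mul, abs_of_pos (inv_pos.2 hn'), le_inv_mul_iff₀ hn']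
      linarith
    have h6 := measureReal_mono (μ := μ) h5
    rw [probReal_compl_eq_one_sub (hms _ _)] at h6
    linarith
  -- compare on a long interval
  obtain ⟨N, hN⟩ := exists_nat_gt (4 * (n₀ : ℝ) + 200 * (M + 1))
  have hN0 : (0 : ℝ) ≤ N := N.cast_nonneg
  have hn₀0 : (0 : ℝ) ≤ n₀ := n₀.cast_nonneg
  set L : ℝ := ε * N with hL
  set R : ℕ := ⌈L / K + 1⌉₊ with hR
  have hLK : 0 ≤ L / K := by positivity
  have hR1 : L / K + 1 ≤ R := Nat.le_ceil _
  have hR2 : (R : ℝ) < L / K + 1 + 1 := Nat.ceil_lt_add_one (by positivity)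
  have hint : ∀ A : Set X, MeasurableSet A → Integrable (A.indicator (1 : X → ℝ)) μ := fun A hA =>
    (integrable_const (1 : ℝ)).indicator hA
  -- The square is replaced by its tangent, `y² ≥ N y - N² / 4`, so that only first moments have to
  -- be integrated.
  have hpt : ∀ x, (N : ℝ) * ∑ i ∈ Finset.range N,
      {x | |birkhoffSum T f i x| ≤ L}.indicator (1 : X → ℝ) x - N ^ 2 / 4 ≤
      (2 * R + 1) * ∑ q ∈ Finset.range N ×ˢ Finset.range N,
        {x | |birkhoffSum T f q.2 x - birkhoffSum T f q.1 x| ≤ K}.indicator (1 : X → ℝ) x := by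
    intro x
    have h1 := sq_card_le_mul_card_pairs (fun i => birkhoffSum T f i x) N R hK hR1
    rw [Finset.card_filter, Finset.card_filter] at h1
    push_cast at h1
    simp only [indicator_apply, mem_ofPred_eq, Pi.one_apply]
    nlinarith [sq_nonneg ((∑ i ∈ Finset.range N,
      if |birkhoffSum T f i x| ≤ L then (1 : ℝ) else 0) - N / 2)]
  have hI := integral_mono (μ := μ)
    (((integrable_finsetSum _ fun i _ => hint _ (hms L i)).const_mul (N : ℝ)).sub
      (integrable_const ((N : ℝ) ^ 2 / 4)))
    ((integrable_finsetSum _ fun q _ => hint _ (hmp q)).const_mul (2 * R + 1 : ℝ)) hpt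
  simp only [Pi.sub_apply] at hI
  rw [integral_sub ((integrable_finsetSum _ fun i _ => hint _ (hms L i)).const_mul (N : ℝ))
    (integrable_const _), integral_const_mul, integral_const_mul, integral_finsetSum _
    (fun i _ => hint _ (hms L i)), integral_finsetSum _ (fun q _ => hint _ (hmp q))] at hI
  simp only [integral_indicator_one (hms _ _), integral_indicator_one (hmp _), integral_const,
    probReal_univ, one_smul] at hI
  have hpairs := sum_measure_pairs_le hTm hf hs N
  have hlow : (N : ℝ) / 2 ≤ ∑ i ∈ Finset.range N, μ.real {x | |birkhoffSum T f i x| ≤ L} := by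
    have h1 : ∀ i ∈ Finset.range N, (if n₀ ≤ i then (3 / 4 : ℝ) else 0) ≤
        μ.real {x | |birkhoffSum T f i x| ≤ L} := by
      intro i hi
      split_ifs with h
      · refine (hn₀ i h).trans (measureReal_mono fun x hx => ?_)
        have : (i : ℝ) ≤ N := by exact_mod_cast (Finset.mem_range.1 hi).le
        exact le_trans hx (mul_le_mul_of_nonneg_left this hε0.le)
      · exact measureReal_nonneg
    refine le_trans ?_ (Finset.sum_le_sum h1)
    rw [← Finset.sum_filter, Finset.sum_const, nsmul_eq_mul]
    have h2 : N - n₀ ≤ (Finset.filter (n₀ ≤ ·) (Finset.range N)).card := by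
      have : Finset.Ico n₀ N ⊆ Finset.filter (n₀ ≤ ·) (Finset.range N) := by
        intro i hi
        rw [Finset.mem_Ico] at hi
        exact Finset.mem_filter.2 ⟨Finset.mem_range.2 hi.2, hi.1⟩
      simpa using Finset.card_le_card this
    have h3 : (N : ℝ) - n₀ ≤ (Finset.filter (n₀ ≤ ·) (Finset.range N)).card := by
      rw [sub_le_iff_le_add]
      exact_mod_cast Nat.sub_le_iff_le_add.1 h2
    linarith
  have hLK' : L / K = N / (32 * (M + 1)) := by
    rw [hL, hε]
    field_simp
  have h7 : (N : ℝ) * (N / 2) - N ^ 2 / 4 ≤ (2 * R + 1) * (2 * N * M) :=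
    (sub_le_sub_right (mul_le_mul_of_nonneg_left hlow hN0) _).trans
      (hI.trans (mul_le_mul_of_nonneg_left hpairs (by positivity)))
  have hNpos : (0 : ℝ) < N := by linarith
  have h8 : (N : ℝ) / 4 ≤ (2 * R + 1) * (2 * M) := by
    refine le_of_mul_le_mul_left ?_ hNpos
    nlinarith
  have h9 : (2 * (R : ℝ) + 1) * (2 * M) ≤ (2 * (L / K) + 5) * (2 * (M + 1)) := by
    have : 0 ≤ 2 * (L / K) + 5 := by positivity
    exact mul_le_mul (by linarith) (by linarith) (by positivity) this
  have h10 : (2 * (L / K) + 5) * (2 * (M + 1)) = N / 8 + 10 * (M + 1) := by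
    rw [hLK']
    field_simp
    ring
  linarith

/-- Exponential moments of Birkhoff sums with non-zero drift become arbitrarily small. -/
theorem exists_integral_exp_birkhoffSum_lt [IsProbabilityMeasure μ] (hT : Ergodic T μ)
    (hf : Measurable f) {M : ℝ} (hM : ∀ x, |f x| ≤ M) (h0 : ∫ x, f x ∂μ ≠ 0) {η : ℝ}
    (hη : 0 < η) :
    ∃ (t : ℝ) (n : ℕ), 0 < n ∧ ∫ x, Real.exp (t * birkhoffSum T f n x) ∂μ < η := by
  wlog hneg : ∫ x, f x ∂μ < 0 generalizing f
  · obtain ⟨t, n, hn, h⟩ := this hf.neg (fun x => by simpa using hM x)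
      (by simpa [integral_neg] using h0)
      (by simpa [integral_neg] using lt_of_le_of_ne (not_lt.1 hneg) h0.symm)
    refine ⟨-t, n, hn, ?_⟩
    convert h using 4 with x
    simp [birkhoffSum]
  have hf2 : MemLp f 2 μ := MemLp.of_bound hf.aestronglyMeasurable M (Eventually.of_forall hM)
  set a : ℝ := -∫ x, f x ∂μ with ha
  have ha0 : 0 < a := by linarith
  have hM0 : 0 ≤ M := by
    obtain ⟨x⟩ := nonempty_of_isProbabilityMeasure μ
    exact (abs_nonneg _).trans (hM x)
  -- With `t = l / n` the exponent is `l` times the average of `f`. It is at most `-l a / 2` off the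
  -- exceptional set `A` and at most `l M` on it. Since `l` is fixed first, a large `n` makes the
  -- contribution of `A` small.
  obtain ⟨l, hl0, hl⟩ : ∃ l : ℝ, 0 < l ∧ Real.exp (-(l * (a / 2))) < η / 2 := by
    have h1 : Tendsto (fun l : ℝ => Real.exp (-(l * (a / 2)))) atTop (𝓝 0) :=
      Real.tendsto_exp_neg_atTop_nhds_zero.comp (tendsto_id.atTop_mul_const (by positivity))
    exact ((eventually_gt_atTop 0).and (h1.eventually (gt_mem_nhds (half_pos hη)))).exists
  have h1 := tendsto_measure_birkhoffSum hT hf2 (half_pos ha0)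
  have h2 := h1.mul_const (Real.exp (l * M))
  rw [zero_mul] at h2
  obtain ⟨n, hn, hn0⟩ := ((h2.eventually (gt_mem_nhds (half_pos hη))).and
    (eventually_gt_atTop 0)).exists
  have hn' : (0 : ℝ) < n := by exact_mod_cast hn0
  have hSm := measurable_birkhoffSum hT.measurable hf n
  set A : Set X := {x | a / 2 ≤ |(n : ℝ)⁻¹ * birkhoffSum T f n x - ∫ x, f x ∂μ|} with hA
  have hAm : MeasurableSet A :=
    measurableSet_le measurable_const ((hSm.const_mul _).sub measurable_const).abs
  refine ⟨l / n, n, hn0, ?_⟩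
  have hpt : ∀ x, Real.exp (l / n * birkhoffSum T f n x) ≤
      Real.exp (-(l * (a / 2))) + A.indicator (fun _ => Real.exp (l * M)) x := by
    intro x
    by_cases hx : x ∈ A
    · rw [indicator_of_mem hx]
      have h3 := (abs_le.1 (abs_birkhoffSum_le hM n x : |birkhoffSum T f n x| ≤ _)).2
      have h4 : l / n * birkhoffSum T f n x ≤ l * M := by
        rw [div_mul_eq_mul_div, div_le_iff₀ hn']
        nlinarith
      have := Real.exp_le_exp.2 h4
      have := Real.exp_pos (-(l * (a / 2)))
      linarith
    · rw [indicator_of_notMem hx, add_zero, Real.exp_le_exp]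
      rw [hA, mem_ofPred_eq, not_le] at hx
      have h3 := (abs_lt.1 hx).2
      have h4 : (n : ℝ)⁻¹ * birkhoffSum T f n x ≤ -(a / 2) := by linarith
      calc l / n * birkhoffSum T f n x = l * ((n : ℝ)⁻¹ * birkhoffSum T f n x) := by ring
        _ ≤ l * -(a / 2) := by gcongr
        _ = _ := by ring
  have hint : Integrable (fun x => Real.exp (-(l * (a / 2))) +
      A.indicator (fun _ => Real.exp (l * M)) x) μ :=
    (integrable_const _).add ((integrable_const _).indicator hAm)
  have h5 := integral_mono_of_nonneg (μ := μ)
    (Eventually.of_forall fun x => (Real.exp_pos (l / n * birkhoffSum T f n x)).le) hint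
    (Eventually.of_forall hpt)
  rw [integral_add (integrable_const _) ((integrable_const _).indicator hAm), integral_const,
    integral_indicator_const _ hAm, probReal_univ, one_smul, smul_eq_mul] at h5
  linarith

end Ergodic

namespace ExpandingMap

variable (E : ExpandingMap m)

/-! ### Geometry of the inverse branches -/

theorem coding_mem (ω : Code m) (n : ℕ) : E.coding ω ∈ E.wordMap (initial ω n) '' Icc 0 1 := by
  have h : E.coding ω ∈ ⋂ n : ℕ, E.wordMap (initial ω n) '' Icc 0 1 := by
    rw [iInter_eq_singleton]
    exact mem_singleton _
  exact mem_iInter.1 h n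

theorem coding_mem_Icc (ω : Code m) : E.coding ω ∈ Icc (0 : ℝ) 1 := by
  obtain ⟨x, hx, h⟩ := E.coding_mem ω 0
  rw [← h]
  exact E.wordMap_mem _ hx

theorem coding_eq_inv (ω : Code m) : E.coding ω = E.inv (ω 0) (E.coding (shift ω)) := by
  symm
  rw [← mem_singleton_iff, ← iInter_eq_singleton, mem_iInter]
  intro n
  cases n with
  | zero => exact ⟨_, E.inv_mem _ (E.coding_mem_Icc _), rfl⟩
  | succ n =>
    obtain ⟨x, hx, h⟩ := E.coding_mem (shift ω) n
    rw [initial_succ]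
    exact ⟨x, hx, congrArg (E.inv (ω 0)) h⟩

theorem coding_eq_wordMap {w : List (Fin m)} {ω : Code m} (h : ω ∈ cylinder w) :
    E.coding ω = E.wordMap w (E.coding (shift^[w.length] ω)) := by
  induction w generalizing ω with
  | nil => rfl
  | cons i w ih =>
    rw [mem_cylinder, List.length_cons, initial_succ, List.cons.injEq] at h
    rw [coding_eq_inv, ih h.2, h.1]
    rfl

theorem wordMap_append (u v : List (Fin m)) (x : ℝ) :
    E.wordMap (u ++ v) x = E.wordMap u (E.wordMap v x) := by
  induction u with
  | nil => rfl
  | cons i u ih => exact congrArg (E.inv i) ih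

theorem exists_derivWithin_bound : ∃ M : ℝ, ∀ i, ∀ x ∈ Icc (E.a i) (E.b i),
    |derivWithin (E.H i) (Icc (E.a i) (E.b i)) x| ≤ M := by
  have h : ∀ i, ∃ M : ℝ, ∀ x ∈ Icc (E.a i) (E.b i),
      |derivWithin (E.H i) (Icc (E.a i) (E.b i)) x| ≤ M := by
    intro i
    have hc := (E.contDiffOn i).continuousOn_derivWithin (uniqueDiffOn_Icc (E.a_lt_b i)) le_rfl
    obtain ⟨M, hM⟩ := isCompact_Icc.exists_bound_of_continuousOn hc
    exact ⟨M, hM⟩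
  choose M hM using h
  refine ⟨∑ i, |M i|, fun i x hx => (hM i x hx).trans ((le_abs_self _).trans ?_)⟩
  exact Finset.single_le_sum (f := fun i => |M i|) (fun _ _ => abs_nonneg _) (Finset.mem_univ i)

/-- The mean value theorem for an inverse branch. -/
theorem exists_abs_sub_eq (i : Fin m) {u v : ℝ} (hu : u ∈ Icc (0 : ℝ) 1) (hv : v ∈ Icc (0 : ℝ) 1) :
    ∃ c ∈ Icc (E.a i) (E.b i), |c - E.inv i u| ≤ |E.inv i u - E.inv i v| ∧
      |u - v| = |derivWithin (E.H i) (Icc (E.a i) (E.b i)) c| * |E.inv i u - E.inv i v| := by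
  have hu' := E.inv_spec i hu
  have hv' := E.inv_spec i hv
  rcases eq_or_ne (E.inv i u) (E.inv i v) with h | h
  · refine ⟨E.inv i u, hu'.1, by simp, ?_⟩
    have : u = v := by rw [← hu'.2, h, hv'.2]
    simp [this]
  have key : ∀ x y : ℝ, x ∈ Icc (E.a i) (E.b i) → y ∈ Icc (E.a i) (E.b i) → x < y →
      ∃ c ∈ Ioo x y, |E.H i x - E.H i y| =
        |derivWithin (E.H i) (Icc (E.a i) (E.b i)) c| * |x - y| := by
    intro x y hx hy hxy
    obtain ⟨c, hc, hd⟩ := exists_hasDerivAt_eq_slope (E.H i)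
      (derivWithin (E.H i) (Icc (E.a i) (E.b i))) hxy
      ((E.contDiffOn i).continuousOn.mono (Icc_subset_Icc hx.1 hy.2))
      (fun z hz => by
        have hz' : Icc (E.a i) (E.b i) ∈ 𝓝 z :=
          Icc_mem_nhds (hx.1.trans_lt hz.1) (hz.2.trans_le hy.2)
        exact (((E.contDiffOn i).differentiableOn one_ne_zero z
          (mem_of_mem_nhds hz')).hasDerivWithinAt).hasDerivAt hz')
    refine ⟨c, hc, ?_⟩
    rw [hd, abs_div, abs_sub_comm x, abs_sub_comm (E.H i x), div_mul_cancel₀]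
    exact (abs_pos.2 (sub_pos.2 hxy).ne').ne'
  rcases lt_or_gt_of_ne h with h | h
  · obtain ⟨c, hc, he⟩ := key _ _ hu'.1 hv'.1 h
    refine ⟨c, ⟨hu'.1.1.trans hc.1.le, hc.2.le.trans hv'.1.2⟩, ?_, ?_⟩
    · rw [abs_of_pos (sub_pos.2 hc.1), abs_sub_comm, abs_of_pos (sub_pos.2 h)]
      linarith [hc.2]
    · rw [← he, hu'.2, hv'.2]
  · obtain ⟨c, hc, he⟩ := key _ _ hv'.1 hu'.1 h
    refine ⟨c, ⟨hv'.1.1.trans hc.1.le, hc.2.le.trans hu'.1.2⟩, ?_, ?_⟩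
    · rw [abs_sub_comm, abs_of_pos (sub_pos.2 hc.2), abs_of_pos (sub_pos.2 h)]
      linarith [hc.1]
    · rw [abs_sub_comm u, abs_sub_comm (E.inv i u), ← he, hu'.2, hv'.2]

/-- Expansion keeps the derivatives in the range `[1, ∞)` of absolute values, where the logarithm is
1-Lipschitz, so the Hölder condition carries over with the same constants. -/
theorem exists_log_derivWithin_holder : ∃ C e : ℝ, 0 ≤ C ∧ 0 < e ∧ ∀ i,
    ∀ x ∈ Icc (E.a i) (E.b i), ∀ y ∈ Icc (E.a i) (E.b i),
      |Real.log (|derivWithin (E.H i) (Icc (E.a i) (E.b i)) x|) -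
        Real.log (|derivWithin (E.H i) (Icc (E.a i) (E.b i)) y|)| ≤ C * |x - y| ^ e := by
  obtain ⟨ε, hε, C, hC⟩ := E.holder
  obtain ⟨l, hl1, hl⟩ := E.expanding
  refine ⟨C, ε, C.2, hε, fun i x hx y hy => ?_⟩
  have h1 := (hC i).dist_le hx hy
  rw [Real.dist_eq, Real.dist_eq] at h1
  have h2 := (abs_abs_sub_abs_le _ _).trans h1
  have hx1 := hl1.le.trans (hl i x hx)
  have hy1 := hl1.le.trans (hl i y hy)
  have key : ∀ p q : ℝ, 1 ≤ p → 1 ≤ q → Real.log p - Real.log q ≤ |p - q| := by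
    intro p q hp hq
    rw [← Real.log_div (by positivity) (by positivity)]
    refine (Real.log_le_sub_one_of_pos (by positivity)).trans ?_
    rw [div_sub_one (by positivity), div_le_iff₀ (by positivity)]
    nlinarith [le_abs_self (p - q), abs_nonneg (p - q)]
  rw [abs_sub_le_iff]
  exact ⟨(key _ _ hx1 hy1).trans h2, (key _ _ hy1 hx1).trans (by rwa [abs_sub_comm])⟩

/-- The distances `|h_w(u) - h_w(v)|` are comparable to `exp (S_n φ(ω)) |u - v|`, for `ω ∈ [w]`. -/
theorem exists_abs_wordMap_sub_bounds : ∃ B : ℝ, ∀ w : List (Fin m), ∀ ω ∈ cylinder w,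
    ∀ u ∈ Icc (0 : ℝ) 1, ∀ v ∈ Icc (0 : ℝ) 1,
      Real.exp (birkhoffSum shift E.potential w.length ω - B) * |u - v| ≤
        |E.wordMap w u - E.wordMap w v| ∧
      |E.wordMap w u - E.wordMap w v| ≤
        Real.exp (birkhoffSum shift E.potential w.length ω + B) * |u - v| := by
  obtain ⟨C, e, hC, he, hlog⟩ := E.exists_log_derivWithin_holder
  obtain ⟨l, hl1, hl⟩ := E.expanding
  have hl0 : 0 < l := by linarith
  set r : ℝ := l⁻¹ ^ e with hr
  have hr0 : 0 ≤ r := by positivity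
  have hr1 : r < 1 := Real.rpow_lt_one (by positivity) (inv_lt_one_of_one_lt₀ hl1) he
  set D : ℝ := C * 2 ^ e with hD
  have hD0 : 0 ≤ D := by positivity
  -- Each branch contributes a distortion error controlled by the Hölder condition at the scale of
  -- the remaining word, so the errors form a geometric series of ratio `r`.
  have main : ∀ w : List (Fin m), ∀ ω ∈ cylinder w,
      ∀ u ∈ Icc (0 : ℝ) 1, ∀ v ∈ Icc (0 : ℝ) 1,
      Real.exp (birkhoffSum shift E.potential w.length ω -
          D * ∑ k ∈ Finset.range w.length, r ^ (k + 1)) * |u - v| ≤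
        |E.wordMap w u - E.wordMap w v| ∧
      |E.wordMap w u - E.wordMap w v| ≤
        Real.exp (birkhoffSum shift E.potential w.length ω +
          D * ∑ k ∈ Finset.range w.length, r ^ (k + 1)) * |u - v| := by
    intro w
    induction w with
    | nil => simp [wordMap]
    | cons i w ih =>
      intro ω hω u hu v hv
      have hcod := E.coding_eq_wordMap hω
      have hz := E.coding_mem_Icc (shift^[(i :: w).length] ω)
      set z := E.coding (shift^[(i :: w).length] ω)
      rw [mem_cylinder, List.length_cons, initial_succ, List.cons.injEq] at hω
      obtain ⟨hi, hω'⟩ := hω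
      obtain ⟨ih1, ih2⟩ := ih (shift ω) hω' u hu v hv
      obtain ⟨c, hc, hc1, hc2⟩ := E.exists_abs_sub_eq i (E.wordMap_mem w hu) (E.wordMap_mem w hv)
      have hdist := fun (x y : ℝ) (hx : x ∈ Icc (0 : ℝ) 1) (hy : y ∈ Icc (0 : ℝ) 1) =>
        (E.dist_wordMap hl1 hl (i :: w) hx hy).trans (mul_le_of_le_one_right (by positivity)
          (abs_sub_le_iff.2 ⟨by linarith [hx.2, hy.1], by linarith [hy.2, hx.1]⟩))
      -- Both the mean value point and the coded point are within `l⁻¹ ^ (i :: w).length` of the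
      -- image of `u`. The factor 2 reappears as `2 ^ e` in `D`.
      have hcz : |c - E.coding ω| ≤ 2 * l⁻¹ ^ (i :: w).length := by
        rw [hcod]
        have h1 := hdist u v hu hv
        have h2 := hdist u z hu hz
        have h3 : |c - E.wordMap (i :: w) u| ≤ |E.wordMap (i :: w) u - E.wordMap (i :: w) v| := hc1
        have h4 := abs_sub_le c (E.wordMap (i :: w) u) (E.wordMap (i :: w) z)
        linarith
      have hcodmem : E.coding ω ∈ Icc (E.a i) (E.b i) := by
        rw [coding_eq_inv, hi]
        exact (E.inv_spec i (E.coding_mem_Icc _)).1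
      have hφ : E.potential ω = -Real.log |derivWithin (E.H i) (Icc (E.a i) (E.b i))
          (E.coding ω)| := by
        rw [potential, hi]
      have hlogc : |Real.log (|derivWithin (E.H i) (Icc (E.a i) (E.b i)) c|) +
          E.potential ω| ≤ D * r ^ (w.length + 1) := by
        rw [hφ, ← sub_eq_add_neg]
        refine (hlog i c hc _ hcodmem).trans ?_
        rw [hD, mul_assoc]
        refine mul_le_mul_of_nonneg_left ?_ hC
        refine (Real.rpow_le_rpow (abs_nonneg _) hcz he.le).trans_eq ?_
        rw [Real.mul_rpow (by norm_num) (by positivity), hr, ← Real.rpow_natCast,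
          ← Real.rpow_natCast, ← Real.rpow_mul (by positivity), ← Real.rpow_mul (by positivity),
          mul_comm e, List.length_cons]
      set d := |derivWithin (E.H i) (Icc (E.a i) (E.b i)) c| with hd
      have hd0 : 0 < d := hl0.trans_le (hl i c hc)
      have hval : |E.wordMap (i :: w) u - E.wordMap (i :: w) v| =
          Real.exp (-Real.log d) * |E.wordMap w u - E.wordMap w v| := by
        rw [hc2, Real.exp_neg, Real.exp_log hd0, inv_mul_cancel_left₀ hd0.ne']
        rfl
      rw [hval, List.length_cons, birkhoffSum_succ', Finset.sum_range_succ, mul_add]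
      rw [abs_le] at hlogc
      constructor
      · refine le_trans ?_ (mul_le_mul_of_nonneg_left ih1 (Real.exp_pos _).le)
        rw [← mul_assoc, ← Real.exp_add]
        refine mul_le_mul_of_nonneg_right (Real.exp_le_exp.2 ?_) (abs_nonneg _)
        linarith [hlogc.2]
      · refine (mul_le_mul_of_nonneg_left ih2 (Real.exp_pos _).le).trans ?_
        rw [← mul_assoc, ← Real.exp_add]
        refine mul_le_mul_of_nonneg_right (Real.exp_le_exp.2 ?_) (abs_nonneg _)
        linarith [hlogc.1]
  have hsum : ∀ n, ∑ k ∈ Finset.range n, r ^ (k + 1) ≤ (1 - r)⁻¹ := by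
    intro n
    rw [← tsum_geometric_of_lt_one hr0 hr1]
    refine le_trans ?_ ((summable_geometric_of_lt_one hr0 hr1).sum_le_tsum (Finset.range n)
      fun k _ => by positivity)
    refine Finset.sum_le_sum fun k _ => ?_
    exact pow_le_pow_of_le_one hr0 hr1.le k.le_succ
  refine ⟨D * (1 - r)⁻¹, fun w ω hω u hu v hv => ?_⟩
  have hb := mul_le_mul_of_nonneg_left (hsum w.length) hD0
  obtain ⟨h1, h2⟩ := main w ω hω u hu v hv
  constructor
  · refine le_trans ?_ h1
    gcongr
  · refine h2.trans ?_
    gcongr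

/-- The analytic and geometric properties of the potential that the dimension theory uses. -/
theorem exists_potential_bounds (hm : 2 ≤ m) : ∃ M B c : ℝ, 0 < c ∧
    BoundedDistortion E.potential M B ∧ (∀ ω, E.potential ω ≤ -c) ∧
    ∀ w : List (Fin m), ∀ u ∈ Icc (0 : ℝ) 1, ∀ v ∈ Icc (0 : ℝ) 1,
      Real.exp (wordSum E.potential w - B) * |u - v| ≤ |E.wordMap w u - E.wordMap w v| ∧
      |E.wordMap w u - E.wordMap w v| ≤ Real.exp (wordSum E.potential w + B) * |u - v| := by
  obtain ⟨B, hB⟩ := E.exists_abs_wordMap_sub_bounds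
  obtain ⟨l, hl1, hl⟩ := E.expanding
  obtain ⟨M, hM⟩ := E.exists_derivWithin_bound
  have hmem : ∀ ω, E.coding ω ∈ Icc (E.a (ω 0)) (E.b (ω 0)) := by
    intro ω
    rw [coding_eq_inv]
    exact (E.inv_spec _ (E.coding_mem_Icc _)).1
  have hneg : ∀ ω, E.potential ω ≤ -Real.log l := fun ω =>
    neg_le_neg (Real.log_le_log (by linarith) (hl _ _ (hmem ω)))
  have hbd : BoundedDistortion E.potential (Real.log M) (2 * B) := by
    refine ⟨fun ω => ?_, fun w x hx y hy => ?_⟩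
    · have h1 := hneg ω
      have h2 := Real.log_pos hl1
      rw [abs_of_neg (by linarith), potential, neg_neg]
      exact Real.log_le_log (by linarith [hl _ _ (hmem ω)]) (hM _ _ (hmem ω))
    · have h1 := (hB w x hx 0 (by simp) 1 (by simp)).1.trans (hB w y hy 0 (by simp) 1 (by simp)).2
      simp only [zero_sub, abs_neg, abs_one, mul_one, Real.exp_le_exp] at h1
      linarith
  have hB0 := hbd.distortion_nonneg hm
  -- One `B` is the geometric comparison at a point `x`; the other `2 * B` replaces the Birkhoff sum
  -- at `x` by the supremum over the cylinder.
  refine ⟨Real.log M, 3 * B, Real.log l, Real.log_pos hl1,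
    ⟨hbd.bound, fun w x hx y hy => (hbd.distortion w x hx y hy).trans (by linarith)⟩, hneg,
    fun w u hu v hv => ?_⟩
  obtain ⟨x, hx⟩ := cylinder_nonempty hm w
  obtain ⟨h1, h2⟩ := hB w x hx u hu v hv
  have h3 := hbd.birkhoffSum_le_wordSum hx
  have h4 := hbd.wordSum_le hx
  constructor
  · refine le_trans ?_ h1
    gcongr ?_ * _
    rw [Real.exp_le_exp]
    linarith
  · refine h2.trans ?_
    gcongr ?_ * _
    rw [Real.exp_le_exp]
    linarith

end ExpandingMap

/-! ### Summability over words -/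

theorem summable_of_sum_words_le {G : List (Fin m) → ℝ} (h0 : ∀ w, 0 ≤ G w) {C : ℝ}
    (h : ∀ N, ∑ n ∈ Finset.range N, ∑ w ∈ words m n, G w ≤ C) : Summable G := by
  classical
  refine summable_of_sum_le h0 (c := C) fun s => ?_
  have hsub : s ⊆ (Finset.range (s.sup List.length + 1)).biUnion (words m) := by
    intro w hw
    rw [Finset.mem_biUnion]
    exact ⟨w.length, Finset.mem_range.2 (Nat.lt_succ_of_le (Finset.le_sup hw)), mem_words.2 rfl⟩
  refine (Finset.sum_le_sum_of_subset_of_nonneg hsub fun w _ _ => h0 w).trans ?_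
  rw [Finset.sum_biUnion]
  · exact h _
  · intro i _ j _ hij
    refine Finset.disjoint_left.2 fun w hi hj => hij ?_
    rw [← mem_words.1 hi, mem_words.1 hj]

theorem summable_sum_words {G : List (Fin m) → ℝ} (h0 : ∀ w, 0 ≤ G w) (h : Summable G) :
    Summable fun n => ∑ w ∈ words m n, G w := by
  classical
  refine summable_of_sum_range_le (c := ∑' w, G w) (fun n => Finset.sum_nonneg fun w _ => h0 w)
    fun N => ?_
  rw [← Finset.sum_biUnion]
  · exact h.sum_le_tsum _ fun w _ => h0 w
  · intro i _ j _ hij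
    refine Finset.disjoint_left.2 fun w hi hj => hij ?_
    rw [← mem_words.1 hi, mem_words.1 hj]

/-- A submultiplicative weight is summable over all words as soon as its sum over the words of
some positive length is less than one. -/
theorem summable_of_submultiplicative {G : List (Fin m) → ℝ} (h0 : ∀ w, 0 ≤ G w)
    (hmul : ∀ u v, G (u ++ v) ≤ G u * G v) {n : ℕ} (h1 : ∑ w ∈ words m n, G w < 1) :
    Summable G := by
  set Z : ℕ → ℝ := fun k => ∑ w ∈ words m k, G w with hZ
  have hZ0 : ∀ k, 0 ≤ Z k := fun k => Finset.sum_nonneg fun w _ => h0 w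
  have hstep : ∀ k, Z (n + k) ≤ Z n * Z k := by
    intro k
    simp only [Z]
    rw [sum_words_add, Finset.sum_mul_sum]
    exact Finset.sum_le_sum fun u _ => Finset.sum_le_sum fun v _ => hmul u v
  have hq : 0 < 1 - Z n := sub_pos.2 h1
  refine summable_of_sum_words_le h0 (C := (∑ k ∈ Finset.range n, Z k) / (1 - Z n)) fun N => ?_
  have h2 : ∑ k ∈ Finset.range N, Z k ≤ ∑ k ∈ Finset.range (n + N), Z k :=
    Finset.sum_le_sum_of_subset_of_nonneg (Finset.range_subset_range.2 (Nat.le_add_left _ _))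
      fun k _ _ => hZ0 k
  -- The partial sum reappears on the right with factor `Z n < 1`, so the inequality can be solved
  -- for it.
  have h3 : ∑ k ∈ Finset.range (n + N), Z k ≤
      ∑ k ∈ Finset.range n, Z k + Z n * ∑ k ∈ Finset.range N, Z k := by
    rw [Finset.sum_range_add, Finset.mul_sum]
    gcongr with k _
    exact hstep k
  rw [le_div_iff₀ hq]
  change (∑ k ∈ Finset.range N, Z k) * _ ≤ _
  linarith

theorem wordSum_le_mul_length (hm : 2 ≤ m) {f : Code m → ℝ} {c : ℝ} (hf : ∀ ω, f ω ≤ -c)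
    (w : List (Fin m)) : wordSum f w ≤ -c * w.length := by
  refine csSup_le ((cylinder_nonempty hm w).image _) ?_
  rintro _ ⟨x, -, rfl⟩
  refine (birkhoffSum_mono hf _ x).trans_eq ?_
  simp [birkhoffSum, mul_comm]

theorem wordSum_letter_append (hm : 2 ≤ m) (g : Fin m → ℝ) (u v : List (Fin m)) :
    wordSum (fun ω => g (ω 0)) (u ++ v) =
      wordSum (fun ω => g (ω 0)) u + wordSum (fun ω => g (ω 0)) v := by
  obtain ⟨x, hx⟩ := cylinder_nonempty hm (u ++ v)
  have hx' := mem_cylinder_append.1 hx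
  rw [wordSum_letter g hx, wordSum_letter g hx'.1, wordSum_letter g hx'.2, List.length_append,
    birkhoffSum_add]

theorem wordSum_letter_initial (g : Fin m → ℝ) (ω : Code m) (n : ℕ) :
    wordSum (fun ω => g (ω 0)) (initial ω n) = birkhoffSum shift (fun ω => g (ω 0)) n ω := by
  rw [wordSum_letter g (mem_cylinder_initial ω n), length_initial]

/-! ### Poincaré series compared with Gibbs measures -/

namespace BoundedDistortion

variable {φ : Code m → ℝ} {M B : ℝ} (hφ : BoundedDistortion φ M B) (hm : 2 ≤ m)
include hφ hm

/-- Gibbs measures for `δ φ` give the cylinder `[w]` mass comparable to `exp (δ S_w φ)`, if the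
pressure vanishes. -/
theorem exists_gibbs_bounds {δ : ℝ} (hδ : 0 ≤ δ) (hP : pressure (fun ω => δ * φ ω) = 0)
    {μ : Measure (Code m)} (hμ : IsGibbs (fun ω => δ * φ ω) μ) : ∃ c : ℝ, 0 < c ∧
      ∀ w, μ.real (cylinder w) ≤ c * Real.exp (δ * wordSum φ w) ∧
        Real.exp (δ * wordSum φ w) ≤ c * μ.real (cylinder w) := by
  obtain ⟨c, hc, h⟩ := hμ.exists_bounds
  have hc0 : 0 < c := by linarith
  have hB := hφ.distortion_nonneg hm
  refine ⟨c * Real.exp (δ * B), by positivity, fun w => ?_⟩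
  obtain ⟨x, hx⟩ := cylinder_nonempty hm w
  have h1 := h w x hx
  rw [hP, mul_zero, sub_zero, birkhoffSum_const_mul, inv_mul_le_iff₀ hc0] at h1
  have h2 := mul_le_mul_of_nonneg_left (hφ.birkhoffSum_le_wordSum hx) hδ
  have h3 := mul_le_mul_of_nonneg_left (hφ.wordSum_le hx) hδ
  have h4 : 0 ≤ δ * B := by positivity
  constructor
  · refine h1.2.trans ?_
    rw [mul_assoc, ← Real.exp_add]
    gcongr
    linarith
  · refine le_trans ?_ (le_trans (mul_le_mul_of_nonneg_left h1.1 (Real.exp_pos (δ * B)).le)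
      (by rw [mul_left_comm, mul_assoc]))
    rw [← Real.exp_add]
    gcongr
    linarith

theorem summable_exp_of_pressure_neg {s : ℝ} (hs : 0 ≤ s)
    (hP : pressure (fun ω => s * φ ω) < 0) :
    Summable fun w : List (Fin m) => Real.exp (s * wordSum φ w) := by
  have hsφ := hφ.const_mul s
  obtain ⟨n, hn⟩ := exists_nat_gt ((|s| * B) / -pressure (fun ω => s * φ ω))
  rw [div_lt_iff₀ (neg_pos.2 hP)] at hn
  refine summable_of_submultiplicative (n := n) (fun w => (Real.exp_pos _).le) (fun u v => ?_) ?_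
  · rw [← Real.exp_add, ← mul_add]
    gcongr
    exact hφ.wordSum_append_le hm u v
  · simp only [← wordSum_const_mul hs]
    refine (hsφ.partitionSum_le hm n).trans_lt ?_
    rw [Real.exp_lt_one_iff]
    linarith

/-- The mass of a union of level-`n` cylinders is at most a constant times the corresponding sum of
weights, so divergence of masses transfers to the Poincaré series. -/
theorem not_summable_sum_words_of_measure {δ : ℝ} (hδ : 0 ≤ δ)
    (hP : pressure (fun ω => δ * φ ω) = 0) {μ : Measure (Code m)}
    (hμ : IsGibbs (fun ω => δ * φ ω) μ) {W : Set (List (Fin m))}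
    (hW : ¬ Summable fun n => μ.real {ω | initial ω n ∈ W}) :
    ¬ Summable fun n => ∑ w ∈ words m n,
      W.indicator (fun w => Real.exp (δ * wordSum φ w)) w := by
  have := hμ.prob
  obtain ⟨c, hc, h⟩ := hφ.exists_gibbs_bounds hm hδ hP hμ
  intro hs
  refine hW ((hs.mul_left c).of_nonneg_of_le (fun n => measureReal_nonneg) fun n => ?_)
  have hmeas : MeasurableSet {ω : Code m | initial ω n ∈ W} := by
    have hc : Continuous fun ω : Code m => fun k : Fin n => ω k := by fun_prop
    exact ((isClopen_discrete {v : Fin n → Fin m | List.ofFn v ∈ W}).preimage hc).isOpen.measurableSet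
  have hind : ∀ ω : Code m, ({ω | initial ω n ∈ W} : Set (Code m)).indicator (1 : Code m → ℝ) ω =
      W.indicator (1 : List (Fin m) → ℝ) (initial ω n) := fun ω => rfl
  rw [← integral_indicator_one hmeas, integral_eq_sum_words n _ hind, Finset.mul_sum]
  refine Finset.sum_le_sum fun w _ => ?_
  by_cases hw : w ∈ W
  · simpa [hw] using (h w).1
  · simp [hw]

/-- If the drift of the Gibbs measure is not `α`, the Poincaré series with bounded
`S_w (ψ - α)` converge for some exponent less than `δ`. -/
theorem exists_summable_of_drift_ne {δ : ℝ} (hδ : 0 < δ)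
    (hP : pressure (fun ω => δ * φ ω) = 0) {μ : Measure (Code m)}
    (hμ : IsGibbs (fun ω => δ * φ ω) μ) (g : Fin m → ℝ) (hg : ∫ ω, g (ω 0) ∂μ ≠ 0) :
    ∃ s : ℝ, 0 ≤ s ∧ s < δ ∧ ∀ K : ℝ,
      Summable fun w : {w : List (Fin m) // |wordSum (fun ω => g (ω 0)) w| ≤ K} =>
        Real.exp (s * wordSum φ w) := by
  have := hμ.prob
  have hM0 : 0 ≤ M := (abs_nonneg _).trans (hφ.bound fun _ => ⟨0, by omega⟩)
  obtain ⟨c, hc, hcμ⟩ := hφ.exists_gibbs_bounds hm hδ.le hP hμ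
  have hgm : Measurable fun ω : Code m => g (ω 0) :=
    (measurable_of_finite g).comp (measurable_pi_apply 0)
  -- In `η = 1 / (2 * c)` the factor `c` pays for replacing `exp (δ S_w φ)` by `μ[w]`, and 2 pays
  -- for lowering `δ` to `s`.
  obtain ⟨t, n, hn, hlt⟩ := exists_integral_exp_birkhoffSum_lt (hμ.ergodic hm) hgm
    (M := ∑ i, |g i|) (fun ω => Finset.single_le_sum (f := fun i => |g i|)
      (fun _ _ => abs_nonneg _) (Finset.mem_univ _)) hg (η := 1 / (2 * c)) (by positivity)
  rw [integral_eq_sum_words n (fun w => Real.exp (t * wordSum (fun ω => g (ω 0)) w))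
    (fun ω => by rw [wordSum_letter_initial])] at hlt
  have hn' : (0 : ℝ) < n := by exact_mod_cast hn
  have hnM : 0 < n * (M + 1) := by positivity
  have hlog2 : 0 < Real.log 2 := Real.log_pos (by norm_num)
  -- On words of length `n`, where `|S_w φ| ≤ n M`, passing from `δ` to `s` multiplies a weight by
  -- at most 2. Using `M + 1` avoids a zero denominator, and `s ≥ 0` is needed for
  -- submultiplicativity.
  set s : ℝ := max 0 (δ - Real.log 2 / (n * (M + 1))) with hs
  have hsδ : s < δ := max_lt hδ (sub_lt_self _ (by positivity))
  have hs1 : (δ - s) * (n * M) ≤ Real.log 2 := by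
    have h1 : δ - s ≤ Real.log 2 / (n * (M + 1)) := by
      linarith [le_max_right 0 (δ - Real.log 2 / (n * (M + 1)))]
    have h2 : (δ - s) * (n * (M + 1)) ≤ Real.log 2 := by rwa [← le_div_iff₀ hnM]
    nlinarith [mul_pos (sub_pos.2 hsδ) hn']
  refine ⟨s, le_max_left _ _, hsδ, fun K => ?_⟩
  have hsum : Summable fun w : List (Fin m) =>
      Real.exp (s * wordSum φ w + t * wordSum (fun ω => g (ω 0)) w) := by
    refine summable_of_submultiplicative (n := n) (fun w => (Real.exp_pos _).le)
      (fun u v => ?_) ?_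
    · rw [← Real.exp_add, Real.exp_le_exp, wordSum_letter_append hm]
      have := mul_le_mul_of_nonneg_left (hφ.wordSum_append_le hm u v)
        (le_max_left 0 (δ - Real.log 2 / (n * (M + 1))))
      linarith
    · have h3 : ∀ w ∈ words m n, Real.exp (s * wordSum φ w + t * wordSum (fun ω => g (ω 0)) w) ≤
          2 * c * (Real.exp (t * wordSum (fun ω => g (ω 0)) w) * μ.real (cylinder w)) := by
        intro w hw
        have h4 := hφ.abs_wordSum_le hm w
        rw [mem_words.1 hw, abs_le] at h4
        have h5 : s * wordSum φ w ≤ Real.log 2 + δ * wordSum φ w := by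
          nlinarith [mul_le_mul_of_nonneg_left h4.1 (sub_pos.2 hsδ).le]
        have h6 := (Real.exp_le_exp.2 h5)
        rw [Real.exp_add, Real.exp_log (by norm_num)] at h6
        rw [Real.exp_add]
        calc _ ≤ 2 * (c * μ.real (cylinder w)) * Real.exp (t * wordSum (fun ω => g (ω 0)) w) := by
              gcongr
              exact h6.trans (by gcongr; exact (hcμ w).2)
          _ = _ := by ring
      refine (Finset.sum_le_sum h3).trans_lt ?_
      rw [← Finset.mul_sum, mul_comm, ← lt_div_iff₀ (by positivity)]
      exact hlt
  -- On the restricted words the tilting factor is at least `exp (-|t| K)`. This is the only place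
  -- where `K` enters.
  refine ((hsum.mul_left (Real.exp (|t| * K))).comp_injective Subtype.val_injective).of_nonneg_of_le
    (fun w => (Real.exp_pos _).le) fun w => ?_
  simp only [Function.comp]
  rw [← Real.exp_add, Real.exp_le_exp]
  have h7 := mul_le_mul_of_nonneg_left w.2 (abs_nonneg t)
  rw [← abs_mul] at h7
  linarith [neg_abs_le (t * wordSum (fun ω => g (ω 0)) w.1)]

/-- If the drift of the Gibbs measure is `α`, the Poincaré series with bounded `S_w (ψ - α)`
diverge at `δ`, level by level. -/
theorem not_summable_sum_words_of_drift_eq {δ : ℝ} (hδ : 0 ≤ δ)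
    (hP : pressure (fun ω => δ * φ ω) = 0) {μ : Measure (Code m)}
    (hμ : IsGibbs (fun ω => δ * φ ω) μ) (g : Fin m → ℝ) (hg : ∫ ω, g (ω 0) ∂μ = 0) {K : ℝ}
    (hK : 0 < K) :
    ¬ Summable fun n => ∑ w ∈ words m n,
      {w : List (Fin m) | |wordSum (fun ω => g (ω 0)) w| ≤ K}.indicator
        (fun w => Real.exp (δ * wordSum φ w)) w := by
  have := hμ.prob
  have hgm : Measurable fun ω : Code m => g (ω 0) :=
    (measurable_of_finite g).comp (measurable_pi_apply 0)
  have hg2 : MemLp (fun ω : Code m => g (ω 0)) 2 μ :=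
    MemLp.of_bound hgm.aestronglyMeasurable (∑ i, |g i|) (Eventually.of_forall fun ω =>
      Finset.single_le_sum (f := fun i => |g i|) (fun _ _ => abs_nonneg _) (Finset.mem_univ _))
  refine hφ.not_summable_sum_words_of_measure hm hδ hP hμ ?_
  simp only [mem_ofPred_eq, wordSum_letter_initial]
  exact not_summable_measure_abs_birkhoffSum_le (hμ.ergodic hm) hgm hg2 hg hK

end BoundedDistortion

namespace ExpandingMap

variable (E : ExpandingMap m)

/-! ### Upper bounds for Hausdorff dimension -/

/-- For every `N` the limsup set is covered by the intervals `h_w[0,1]` with `w ∈ W` of length at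
least `N`. Their diameters tend to 0 uniformly and their `s`-sums stay below a fixed multiple of the
series, so the `s`-dimensional Hausdorff measure is finite. -/
theorem dimH_le_of_summable (hm : 2 ≤ m) {s : ℝ} (hs : 0 ≤ s) (W : Set (List (Fin m)))
    (hW : Summable fun w : W => Real.exp (s * wordSum E.potential w)) :
    dimH (E.coding '' {ω | ∃ᶠ n in atTop, initial ω n ∈ W}) ≤ ENNReal.ofReal s := by
  obtain ⟨M, B, c, hc, hφ, hneg, hgeo⟩ := E.exists_potential_bounds hm
  set A := E.coding '' {ω | ∃ᶠ n in atTop, initial ω n ∈ W}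
  have hlen := wordSum_le_mul_length hm hneg
  have hdiam : ∀ w, Metric.ediam (E.wordMap w '' Icc 0 1) ≤
      ENNReal.ofReal (Real.exp (wordSum E.potential w + B)) := by
    intro w
    refine Metric.ediam_le ?_
    rintro _ ⟨u, hu, rfl⟩ _ ⟨v, hv, rfl⟩
    rw [edist_dist, Real.dist_eq]
    refine ENNReal.ofReal_le_ofReal ((hgeo w u hu v hv).2.trans ?_)
    exact mul_le_of_le_one_right (Real.exp_pos _).le
      (abs_sub_le_iff.2 ⟨by linarith [hu.2, hv.1], by linarith [hv.2, hu.1]⟩)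
  set r : ℕ → ENNReal := fun N => ENNReal.ofReal (Real.exp (-c * N + B)) with hr
  have hr0 : Tendsto r atTop (𝓝 0) := by
    rw [← ENNReal.ofReal_zero]
    refine ENNReal.tendsto_ofReal ?_
    refine Real.tendsto_exp_atBot.comp (tendsto_atBot_add_const_right _ _ ?_)
    exact tendsto_natCast_atTop_atTop.const_mul_atTop_of_neg (by linarith)
  have hH := Measure.hausdorffMeasure_le_liminf_tsum s A r hr0
    (ι := fun N : ℕ => {w : W // N ≤ w.1.length})
    (fun N w => E.wordMap w.1.1 '' Icc 0 1)
    (Eventually.of_forall fun N w => (hdiam _).trans (ENNReal.ofReal_le_ofReal (by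
      gcongr
      refine (hlen _).trans ?_
      have : (N : ℝ) ≤ w.1.1.length := by exact_mod_cast w.2
      nlinarith)))
    (Eventually.of_forall fun N => by
      rintro _ ⟨ω, hω, rfl⟩
      obtain ⟨n, hn, hnW⟩ := frequently_atTop.1 hω N
      exact mem_iUnion.2 ⟨⟨⟨_, hnW⟩, by simpa using hn⟩, E.coding_mem ω n⟩)
  have hfin : ∑' w : W, ENNReal.ofReal (Real.exp (s * B) *
      Real.exp (s * wordSum E.potential w)) ≠ ⊤ :=
    (hW.mul_left _).tsum_ofReal_ne_top
  have hbound : ∀ N : ℕ, ∑' w : {w : W // N ≤ w.1.length},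
      Metric.ediam (E.wordMap w.1.1 '' Icc 0 1) ^ s ≤
      ∑' w : W, ENNReal.ofReal (Real.exp (s * B) * Real.exp (s * wordSum E.potential w)) := by
    intro N
    refine le_trans (ENNReal.tsum_le_tsum fun w => ?_)
      (ENNReal.tsum_comp_le_tsum_of_injective Subtype.val_injective _)
    refine (ENNReal.rpow_le_rpow (hdiam _) hs).trans_eq ?_
    rw [ENNReal.ofReal_rpow_of_pos (Real.exp_pos _), ← Real.exp_mul, ← Real.exp_add]
    ring_nf
  have hne : μH[s] A ≠ ⊤ := by
    refine ne_top_of_le_ne_top hfin (hH.trans ?_)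
    exact liminf_le_of_le (by isBoundedDefault) fun b hb => (hb.exists).elim fun N hN => hN.trans (hbound N)
  have h := dimH_le_of_hausdorffMeasure_ne_top (d := s.toNNReal) (s := A)
    (by rwa [Real.coe_toNNReal s hs])
  exact h

end ExpandingMap

theorem wordSum_nil (hm : 2 ≤ m) (f : Code m → ℝ) : wordSum f [] = 0 := by
  have h : birkhoffSum shift f ([] : List (Fin m)).length '' cylinder [] = {0} := by
    refine ((cylinder_nonempty hm []).image _).subset_singleton_iff.1 ?_
    rintro _ ⟨x, -, rfl⟩
    simp
  rw [wordSum, h, csSup_singleton]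

/-- A mass distribution principle for images of outer measures. -/
theorem le_dimH_range_of_measure_preimage_le {Ω : Type*} [MeasurableSpace Ω] (ν : Measure Ω)
    [IsProbabilityMeasure ν] (θ : Ω → ℝ) {s : ℝ} (hs : 0 ≤ s) {C : ENNReal} (hC0 : C ≠ 0)
    (hC : C ≠ ⊤) (h : ∀ U : Set ℝ, ν (θ ⁻¹' U) ≤ C * Metric.ediam U ^ s) :
    ENNReal.ofReal s ≤ dimH (range θ) := by
  -- The image is taken as an outer measure, so `θ` need not be measurable and arbitrary sets `U`
  -- may be tested.
  have hle := OuterMeasure.le_mkMetric (fun r : ENNReal => r ^ s)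
    (C⁻¹ • OuterMeasure.map θ ν.toOuterMeasure) 1 one_pos fun U _ => by
      rw [smul_apply, OuterMeasure.map_apply, smul_eq_mul,
        ENNReal.inv_mul_le_iff hC0 hC]
      exact h U
  have h1 := hle (range θ)
  rw [smul_apply, OuterMeasure.map_apply, preimage_range, smul_eq_mul,
    OuterMeasure.coe_mkMetric] at h1
  refine le_dimH_of_hausdorffMeasure_ne_zero (d := s.toNNReal) ?_
  rw [Real.coe_toNNReal s hs]
  refine (lt_of_lt_of_le ?_ h1).ne'
  change 0 < C⁻¹ * ν univ
  rw [measure_univ, mul_one]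
  exact ENNReal.inv_pos.2 hC

/-! ### Codes that are concatenations of blocks -/

/-- The concatenation of the words `W (τ 0), …, W (τ (k - 1))`. -/
def blockPrefix {N : ℕ} (W : Fin N → List (Fin m)) (τ : ℕ → Fin N) : ℕ → List (Fin m)
  | 0 => []
  | k + 1 => blockPrefix W τ k ++ W (τ k)

/-- The concatenation of the words `W (τ 0), W (τ 1), …`, which all have length `L`. -/
def blockCode {N L : ℕ} (W : Fin N → List (Fin m)) (hW : ∀ i, (W i).length = L) (hL : 0 < L)
    (τ : ℕ → Fin N) : Code m :=
  fun k => (W (τ (k / L)))[k % L]'((Nat.mod_lt k hL).trans_eq (hW _).symm)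

section Block

variable {N L : ℕ} (W : Fin N → List (Fin m)) (hW : ∀ i, (W i).length = L) (hL : 0 < L)
  (τ : ℕ → Fin N)

theorem initial_shift_blockCode (k : ℕ) :
    initial (shift^[k * L] (blockCode W hW hL τ)) L = W (τ k) := by
  refine List.ext_getElem ((length_initial _ _).trans (hW _).symm) fun j h1 h2 => ?_
  rw [hW] at h2
  have h3 : (j + k * L) / L = k := by
    rw [Nat.add_mul_div_right _ _ hL, Nat.div_eq_of_lt h2, zero_add]
  have h4 : (j + k * L) % L = j := by
    rw [Nat.add_mul_mod_self_right, Nat.mod_eq_of_lt h2]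
  simp only [initial, List.getElem_ofFn, shift_iterate_apply, blockCode, h3, h4]

theorem initial_blockCode (k : ℕ) :
    initial (blockCode W hW hL τ) (k * L) = blockPrefix W τ k := by
  induction k with
  | zero => simp [initial, blockPrefix]
  | succ k ih => rw [Nat.succ_mul, initial_add, ih, initial_shift_blockCode, blockPrefix]

include hW in
theorem length_blockPrefix (k : ℕ) : (blockPrefix W τ k).length = k * L := by
  induction k with
  | zero => simp [blockPrefix]
  | succ k ih => rw [blockPrefix, List.length_append, ih, hW, Nat.succ_mul]

theorem blockPrefix_congr {τ τ' : ℕ → Fin N} {k : ℕ} (h : ∀ j < k, τ j = τ' j) :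
    blockPrefix W τ k = blockPrefix W τ' k := by
  induction k with
  | zero => rfl
  | succ k ih =>
    rw [blockPrefix, blockPrefix, ih fun j hj => h j (hj.trans k.lt_succ_self),
      h k k.lt_succ_self]

end Block

namespace ExpandingMap

variable (E : ExpandingMap m)

/-! ### Lower bounds for Hausdorff dimension -/

/-- If the images of the blocks are separated and `∑ exp (s S_w φ)` is large, then the
concatenations of the blocks code a set of dimension at least `s`. -/
theorem le_dimH_of_separated_blocks (hm : 2 ≤ m) {s B g : ℝ} (hs : 0 < s) (hg : 0 < g)
    {N L : ℕ} (W : Fin N → List (Fin m)) (hW : ∀ i, (W i).length = L) (hL : 0 < L)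
    (happ : ∀ u v : List (Fin m), wordSum E.potential u + wordSum E.potential v ≤
      wordSum E.potential (u ++ v) + B)
    (hdecay : ∃ c : ℝ, 0 < c ∧ ∀ w : List (Fin m), wordSum E.potential w ≤ -c * w.length)
    (hgeo : ∀ w : List (Fin m), ∀ u ∈ Icc (0 : ℝ) 1, ∀ v ∈ Icc (0 : ℝ) 1,
      Real.exp (wordSum E.potential w - B) * |u - v| ≤ |E.wordMap w u - E.wordMap w v|)
    (hsep : ∀ i j, i ≠ j → ∀ u ∈ Icc (0 : ℝ) 1, ∀ v ∈ Icc (0 : ℝ) 1,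
      g ≤ |E.wordMap (W i) u - E.wordMap (W j) v|)
    (hsum : Real.exp (s * B) ≤ ∑ i, Real.exp (s * wordSum E.potential (W i))) :
    ENNReal.ofReal s ≤ dimH (range fun τ => E.coding (blockCode W hW hL τ)) := by
  set q : Fin N → ℝ := fun i => Real.exp (s * wordSum E.potential (W i)) with hq
  set Z : ℝ := ∑ i, q i with hZ
  have hZ0 : 0 < Z := (Real.exp_pos _).trans_le hsum
  have hq0 : ∀ i, 0 ≤ q i / Z := fun i => div_nonneg (Real.exp_pos _).le hZ0.le
  -- Blocks are drawn independently with probabilities proportional to `exp (s S_w φ)`.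
  set κ : Measure (Fin N) := ∑ i, ENNReal.ofReal (q i / Z) • Measure.dirac i with hκ
  have hκi : ∀ i, κ {i} = ENNReal.ofReal (q i / Z) := by
    intro i
    rw [hκ, Measure.finsetSum_apply, Finset.sum_eq_single i]
    · simp
    · intro j _ hj
      simp [hj]
    · simp
  have hκp : IsProbabilityMeasure κ := by
    constructor
    rw [hκ, Measure.finsetSum_apply]
    simp only [Measure.smul_apply, measure_univ, smul_eq_mul, mul_one]
    rw [← ENNReal.ofReal_sum_of_nonneg fun i _ => hq0 i, ← Finset.sum_div, div_self hZ0.ne',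
      ENNReal.ofReal_one]
  set ν : Measure (ℕ → Fin N) := Measure.infinitePi fun _ => κ with hν
  set θ : (ℕ → Fin N) → ℝ := fun τ => E.coding (blockCode W hW hL τ) with hθ
  -- Each new block loses a factor `exp (s * B)` through distortion; the normalisation `Z ≥ exp (s *
  -- B)` pays for it.
  have hcyl : ∀ τ k, ν {τ' | ∀ j < k, τ' j = τ j} ≤
      ENNReal.ofReal (Real.exp (s * wordSum E.potential (blockPrefix W τ k))) := by
    intro τ k
    have h1 : {τ' : ℕ → Fin N | ∀ j < k, τ' j = τ j} =
        Set.pi (Finset.range k : Set ℕ) fun j => {τ j} := by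
      ext τ'
      simp [Set.mem_pi]
    rw [h1, hν, Measure.infinitePi_pi _ fun j _ => measurableSet_singleton _]
    simp only [hκi]
    rw [← ENNReal.ofReal_prod_of_nonneg fun j _ => hq0 _]
    refine ENNReal.ofReal_le_ofReal ?_
    induction k with
    | zero => simp [blockPrefix, wordSum_nil hm]
    | succ k ih =>
      rw [Finset.prod_range_succ, blockPrefix]
      have h2 := ih (by ext τ'; simp [Set.mem_pi])
      refine (mul_le_mul_of_nonneg_right h2 (hq0 _)).trans ?_
      rw [← mul_div_assoc, div_le_iff₀ hZ0]
      refine le_trans ?_ (mul_le_mul_of_nonneg_left hsum (Real.exp_pos _).le)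
      simp only [q]
      rw [← Real.exp_add, ← Real.exp_add, Real.exp_le_exp, ← mul_add, ← mul_add]
      exact mul_le_mul_of_nonneg_left (happ _ _) hs.le
  have hθsep : ∀ τ τ' k, (∀ j < k, τ j = τ' j) → τ k ≠ τ' k →
      Real.exp (wordSum E.potential (blockPrefix W τ k) - B) * g ≤ |θ τ - θ τ'| := by
    intro τ τ' k hj hk
    have key : ∀ τ, ∃ z ∈ Icc (0 : ℝ) 1,
        θ τ = E.wordMap (blockPrefix W τ k) (E.wordMap (W (τ k)) z) := by
      intro τ
      have h1 := mem_cylinder_initial (blockCode W hW hL τ) ((k + 1) * L)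
      rw [initial_blockCode, blockPrefix] at h1
      have h2 := E.coding_eq_wordMap h1
      rw [wordMap_append] at h2
      exact ⟨_, E.coding_mem_Icc _, h2⟩
    obtain ⟨z, hz, h1⟩ := key τ
    obtain ⟨z', hz', h2⟩ := key τ'
    rw [h1, h2, ← blockPrefix_congr W hj]
    refine le_trans ?_ (hgeo _ _ (E.wordMap_mem _ hz) _ (E.wordMap_mem _ hz'))
    exact mul_le_mul_of_nonneg_left (hsep _ _ hk z hz z' hz') (Real.exp_pos _).le
  set C : ℝ := (Real.exp B / g) ^ s with hC
  have hC0 : 0 < C := by positivity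
  refine le_dimH_range_of_measure_preimage_le ν θ hs.le (C := ENNReal.ofReal C)
    (ENNReal.ofReal_pos.2 hC0).ne' ENNReal.ofReal_ne_top fun U => ?_
  -- If codes in the preimage differ, let `k` be the first index where they do: the preimage lies in
  -- one cylinder of `k` blocks, and separation bounds the diameter of `U` from below. Otherwise the
  -- preimage has at most one code, which is a null set.
  by_cases hU : ∃ k, ∃ τ ∈ θ ⁻¹' U, ∃ τ' ∈ θ ⁻¹' U, τ k ≠ τ' k
  · classical
    obtain ⟨τ, hτ, τ', hτ', hk⟩ := Nat.find_spec hU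
    have hmin : ∀ j < Nat.find hU, ∀ σ ∈ θ ⁻¹' U, σ j = τ j := by
      intro j hj σ hσ
      by_contra hne
      exact Nat.find_min hU hj ⟨σ, hσ, τ, hτ, hne⟩
    set k := Nat.find hU
    have h1 := hθsep τ τ' k (fun j hj => (hmin j hj τ' hτ').symm) hk
    refine (measure_mono fun σ hσ => ?_).trans ((hcyl τ k).trans ?_)
    · exact fun j hj => hmin j hj σ hσ
    set S := wordSum E.potential (blockPrefix W τ k)
    have h2 : ENNReal.ofReal (Real.exp (S - B) * g) ≤ Metric.ediam U := by
      refine le_trans ?_ (Metric.edist_le_ediam_of_mem hτ hτ')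
      rw [edist_dist, Real.dist_eq]
      exact ENNReal.ofReal_le_ofReal h1
    have h3 : ENNReal.ofReal (Real.exp (s * S)) =
        ENNReal.ofReal C * ENNReal.ofReal (Real.exp (S - B) * g) ^ s := by
      rw [ENNReal.ofReal_rpow_of_pos (by positivity), ← ENNReal.ofReal_mul hC0.le, hC,
        ← Real.mul_rpow (by positivity) (by positivity)]
      congr 1
      have : Real.exp B / g * (Real.exp (S - B) * g) = Real.exp S := by
        rw [Real.exp_sub]
        field_simp
      rw [this, ← Real.exp_mul, mul_comm]
    rw [h3]
    gcongr
  · push Not at hU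
    obtain ⟨c, hc, hdec⟩ := hdecay
    rcases (θ ⁻¹' U).eq_empty_or_nonempty with he | ⟨τ, hτ⟩
    · rw [he, measure_empty]
      exact zero_le
    · have h1 : ∀ k : ℕ, ν (θ ⁻¹' U) ≤ ENNReal.ofReal (Real.exp (-(k * (s * c)))) := by
        intro k
        refine (measure_mono fun σ hσ => ?_).trans ((hcyl τ k).trans ?_)
        · exact fun j _ => hU j σ hσ τ hτ
        · refine ENNReal.ofReal_le_ofReal (Real.exp_le_exp.2 ?_)
          have h2 := hdec (blockPrefix W τ k)
          rw [length_blockPrefix W hW] at h2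
          have h3 : (k : ℝ) ≤ ((k * L : ℕ) : ℝ) := by
            exact_mod_cast Nat.le_mul_of_pos_right k hL
          have h4 : c * k ≤ c * ((k * L : ℕ) : ℝ) := mul_le_mul_of_nonneg_left h3 hc.le
          have h5 : wordSum E.potential (blockPrefix W τ k) ≤ -(c * k) := by linarith
          have := mul_le_mul_of_nonneg_left h5 hs.le
          linarith
      have h2 : Tendsto (fun k : ℕ => ENNReal.ofReal (Real.exp (-(k * (s * c))))) atTop (𝓝 0) := by
        rw [← ENNReal.ofReal_zero]
        refine ENNReal.tendsto_ofReal (Real.tendsto_exp_neg_atTop_nhds_zero.comp ?_)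
        exact tendsto_natCast_atTop_atTop.atTop_mul_const (by positivity)
      exact (ge_of_tendsto' h2 h1).trans zero_le

/-! ### Overlaps and separation of the intervals h_w[0,1] -/

theorem injOn_H (i : Fin m) : InjOn (E.H i) (Icc (E.a i) (E.b i)) := by
  obtain ⟨l, hl1, hl⟩ := E.expanding
  intro x hx y hy hxy
  have h := E.expand hl i hx hy
  rw [hxy, sub_self, abs_zero] at h
  have h0 : |x - y| ≤ 0 := by nlinarith [abs_nonneg (x - y)]
  exact sub_eq_zero.1 (abs_nonpos_iff.1 h0)

/-- The branches map endpoints to endpoints. -/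
theorem H_endpoints (i : Fin m) : E.H i (E.a i) ∈ ({0, 1} : Set ℝ) ∧
    E.H i (E.b i) ∈ ({0, 1} : Set ℝ) := by
  have hab := E.a_lt_b i
  have ha : E.a i ∈ Icc (E.a i) (E.b i) := left_mem_Icc.2 hab.le
  have hb : E.b i ∈ Icc (E.a i) (E.b i) := right_mem_Icc.2 hab.le
  obtain ⟨x, hx, hx0⟩ : (0 : ℝ) ∈ E.H i '' Icc (E.a i) (E.b i) := by
    rw [E.full]
    simp
  obtain ⟨y, hy, hy1⟩ : (1 : ℝ) ∈ E.H i '' Icc (E.a i) (E.b i) := by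
    rw [E.full]
    simp
  have hr : ∀ z ∈ Icc (E.a i) (E.b i), E.H i z ∈ Icc (0 : ℝ) 1 := fun z hz =>
    E.full i ▸ mem_image_of_mem _ hz
  have ha' := hr _ ha
  have hb' := hr _ hb
  rw [mem_insert_iff, mem_singleton_iff, mem_insert_iff, mem_singleton_iff]
  rcases (E.contDiffOn i).continuousOn.strictMonoOn_of_injOn_Icc' hab.le (E.injOn_H i) with h | h
  · have h1 := h.monotoneOn ha hx hx.1
    have h2 := h.monotoneOn hy hb hy.2
    exact ⟨Or.inl (le_antisymm (by linarith) ha'.1), Or.inr (le_antisymm hb'.2 (by linarith))⟩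
  · have h1 := h.antitoneOn ha hy hy.1
    have h2 := h.antitoneOn hx hb hx.2
    exact ⟨Or.inr (le_antisymm ha'.2 (by linarith)), Or.inl (le_antisymm (by linarith) hb'.1)⟩

theorem inv_mem_Ioo (i : Fin m) {y : ℝ} (hy : y ∈ Ioo (0 : ℝ) 1) :
    E.inv i y ∈ Ioo (E.a i) (E.b i) := by
  have h := E.inv_spec i (Ioo_subset_Icc_self hy)
  have he := E.H_endpoints i
  refine ⟨lt_of_le_of_ne h.1.1 fun hne => ?_, lt_of_le_of_ne h.1.2 fun hne => ?_⟩
  · rw [hne, h.2] at he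
    rcases he.1 with h' | h'
    · exact hy.1.ne' h'
    · exact hy.2.ne h'
  · rw [← hne, h.2] at he
    rcases he.2 with h' | h'
    · exact hy.1.ne' h'
    · exact hy.2.ne h'

theorem wordMap_mem_Ioo (w : List (Fin m)) {y : ℝ} (hy : y ∈ Ioo (0 : ℝ) 1) :
    E.wordMap w y ∈ Ioo (0 : ℝ) 1 := by
  induction w with
  | nil => exact hy
  | cons i w ih =>
    have := E.inv_mem_Ioo i ih
    exact ⟨(E.zero_le_a i).trans_lt this.1, this.2.trans_le (E.b_le_one i)⟩

theorem eq_of_mem_Ioo {i j : Fin m} {x : ℝ} (hi : x ∈ Ioo (E.a i) (E.b i))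
    (hj : x ∈ Ioo (E.a j) (E.b j)) : i = j := by
  by_contra hne
  exact disjoint_left.1 (E.disjoint hne) (E.Ioo_subset i hi) (E.Ioo_subset j hj)

/-- Images of `(0,1)` stay in the open branch domains, which are disjoint; the first letters agree,
and applying the branch removes them. -/
theorem eq_of_wordMap_eq {w w' : List (Fin m)} (hl : w.length = w'.length) {y y' : ℝ}
    (hy : y ∈ Ioo (0 : ℝ) 1) (hy' : y' ∈ Ioo (0 : ℝ) 1) (h : E.wordMap w y = E.wordMap w' y') :
    w = w' := by
  induction w generalizing w' with
  | nil => exact (List.length_eq_zero_iff.1 hl.symm).symm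
  | cons i w ih =>
    cases w' with
    | nil => simp at hl
    | cons j w' =>
      have h1 := E.wordMap_mem_Ioo w hy
      have h2 := E.wordMap_mem_Ioo w' hy'
      have h3 : E.inv i (E.wordMap w y) = E.inv j (E.wordMap w' y') := h
      have hij : i = j := E.eq_of_mem_Ioo (E.inv_mem_Ioo i h1) (h3 ▸ E.inv_mem_Ioo j h2)
      subst hij
      have h4 : E.wordMap w y = E.wordMap w' y' := by
        rw [← (E.inv_spec i (Ioo_subset_Icc_self h1)).2, h3,
          (E.inv_spec i (Ioo_subset_Icc_self h2)).2]
      rw [ih (by simpa using hl) h4]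

/-- Closed intervals of one level may touch, but not at 0 or 1: two branch domains reaching the same
end of `[0,1]` would overlap. The branch sends that end to 0 or 1 again, so the argument repeats. -/
theorem eq_of_endpoint_eq {w w' : List (Fin m)} (hl : w.length = w'.length) {x y y' : ℝ}
    (hx : x ∈ ({0, 1} : Set ℝ)) (hy : y ∈ Icc (0 : ℝ) 1) (hy' : y' ∈ Icc (0 : ℝ) 1)
    (h : E.wordMap w y = x) (h' : E.wordMap w' y' = x) : w = w' := by
  induction w generalizing w' x with
  | nil => exact (List.length_eq_zero_iff.1 hl.symm).symm
  | cons i w ih =>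
    cases w' with
    | nil => simp at hl
    | cons j w' =>
      have h1 := E.inv_spec i (E.wordMap_mem w hy)
      have h2 := E.inv_spec j (E.wordMap_mem w' hy')
      change E.inv i (E.wordMap w y) = x at h
      change E.inv j (E.wordMap w' y') = x at h'
      rw [h] at h1
      rw [h'] at h2
      have hai := E.zero_le_a i
      have haj := E.zero_le_a j
      have hbi := E.b_le_one i
      have hbj := E.b_le_one j
      have hi := E.a_lt_b i
      have hj := E.a_lt_b j
      have hend : i = j ∧ E.H i x ∈ ({0, 1} : Set ℝ) := by
        rcases hx with rfl | hx
        · have ei : E.a i = 0 := le_antisymm h1.1.1 hai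
          have ej : E.a j = 0 := le_antisymm h2.1.1 haj
          obtain ⟨z, hz0, hz⟩ := exists_between (lt_min (ei ▸ hi) (ej ▸ hj))
          rw [lt_min_iff] at hz
          refine ⟨E.eq_of_mem_Ioo (x := z) ⟨by linarith, hz.1⟩ ⟨by linarith, hz.2⟩, ?_⟩
          have := (E.H_endpoints i).1
          rwa [ei] at this
        · rw [mem_singleton_iff] at hx
          subst hx
          have ei : E.b i = 1 := le_antisymm hbi h1.1.2
          have ej : E.b j = 1 := le_antisymm hbj h2.1.2
          obtain ⟨z, hz, hz0⟩ := exists_between (max_lt (ei ▸ hi) (ej ▸ hj))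
          rw [max_lt_iff] at hz
          refine ⟨E.eq_of_mem_Ioo (x := z) ⟨hz.1, by linarith⟩ ⟨hz.2, by linarith⟩, ?_⟩
          have := (E.H_endpoints i).2
          rwa [ei] at this
      obtain ⟨rfl, hH⟩ := hend
      rw [ih (by simpa using hl) hH h1.2.symm h2.2.symm]

theorem isCompact_wordMap_image (w : List (Fin m)) : IsCompact (E.wordMap w '' Icc 0 1) := by
  obtain ⟨l, hl1, hl⟩ := E.expanding
  refine isCompact_Icc.image_of_continuousOn (LipschitzOnWith.continuousOn (K := 1)
    (LipschitzOnWith.of_dist_le_mul fun x hx y hy => ?_))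
  rw [Real.dist_eq, Real.dist_eq]
  refine (E.dist_wordMap hl1 hl _ hx hy).trans ?_
  have hl0 : 0 < l := by linarith
  have : (l⁻¹) ^ w.length ≤ 1 := pow_le_one₀ (by positivity) (inv_le_one_of_one_le₀ hl1.le)
  simpa using mul_le_mul_of_nonneg_right this (abs_nonneg (x - y))

/-- At most one word of a given length reaches 0 and at most one reaches 1, so a third word reaches
neither. -/
theorem exists_interior_word {n : ℕ} {A : Finset (List (Fin m))} (hA : ∀ w ∈ A, w.length = n)
    (hcard : 2 < A.card) :
    ∃ v ∈ A, ∀ y ∈ Icc (0 : ℝ) 1, E.wordMap v y ∈ Ioo (0 : ℝ) 1 := by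
  classical
  by_contra hno
  push Not at hno
  set A₀ : ℝ → Finset (List (Fin m)) := fun x => {w ∈ A | ∃ y ∈ Icc (0 : ℝ) 1, E.wordMap w y = x}
  have h1 : ∀ x ∈ ({0, 1} : Set ℝ), (A₀ x).card ≤ 1 := by
    intro x hx
    refine Finset.card_le_one.2 fun w hw w' hw' => ?_
    obtain ⟨hw, y, hy, h⟩ := Finset.mem_filter.1 hw
    obtain ⟨hw', y', hy', h'⟩ := Finset.mem_filter.1 hw'
    exact E.eq_of_endpoint_eq ((hA w hw).trans (hA w' hw').symm) hx hy hy' h h'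
  have h2 : A ⊆ A₀ 0 ∪ A₀ 1 := by
    intro w hw
    obtain ⟨y, hy, hno⟩ := hno w hw
    have h3 := E.wordMap_mem w hy
    rw [Finset.mem_union, Finset.mem_filter, Finset.mem_filter]
    by_cases h0 : E.wordMap w y = 0
    · exact Or.inl ⟨hw, y, hy, h0⟩
    · refine Or.inr ⟨hw, y, hy, ?_⟩
      by_contra h1
      exact hno ⟨lt_of_le_of_ne h3.1 (Ne.symm h0), lt_of_le_of_ne h3.2 h1⟩
  have := (Finset.card_le_card h2).trans (Finset.card_union_le _ _)
  have := h1 0 (by simp)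
  have := h1 1 (by simp)
  omega

theorem exists_separation {ι : Type*} [Finite ι] (W : ι → List (Fin m))
    (h : ∀ i j, i ≠ j → Disjoint (E.wordMap (W i) '' Icc 0 1) (E.wordMap (W j) '' Icc 0 1)) :
    ∃ g : ℝ, 0 < g ∧ ∀ i j, i ≠ j → ∀ u ∈ Icc (0 : ℝ) 1, ∀ v ∈ Icc (0 : ℝ) 1,
      g ≤ |E.wordMap (W i) u - E.wordMap (W j) v| := by
  have h1 : ∀ i j, ∀ᶠ g : ℝ in 𝓝[>] 0, i ≠ j → ∀ u ∈ Icc (0 : ℝ) 1, ∀ v ∈ Icc (0 : ℝ) 1,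
      g ≤ |E.wordMap (W i) u - E.wordMap (W j) v| := by
    intro i j
    rcases eq_or_ne i j with rfl | hij
    · exact Eventually.of_forall fun g hne => absurd rfl hne
    obtain ⟨r, hr, hd⟩ := Metric.exists_pos_forall_lt_edist (E.isCompact_wordMap_image (W i))
      (E.isCompact_wordMap_image (W j)).isClosed (h i j hij)
    filter_upwards [Ioo_mem_nhdsGT (show (0 : ℝ) < r from hr)] with g hg _ u hu v hv
    have h2 := hd _ (mem_image_of_mem _ hu) _ (mem_image_of_mem _ hv)
    rw [edist_nndist, ENNReal.coe_lt_coe, ← NNReal.coe_lt_coe, coe_nndist, Real.dist_eq] at h2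
    exact hg.2.le.trans h2.le
  obtain ⟨g, hg, hg0⟩ := ((eventually_all.2 fun i => eventually_all.2 (h1 i)).and
    self_mem_nhdsWithin).exists
  exact ⟨g, hg0, hg⟩

/-- If a set `G` of words is closed under concatenation and its Poincaré series diverges at `δ`,
level by level, then the concatenations of words in `G` of a fixed length code a set of dimension
at least `δ`. -/
theorem le_dimH_of_not_summable (hm : 2 ≤ m) {δ : ℝ} {G : Set (List (Fin m))}
    (hG : ∀ u ∈ G, ∀ v ∈ G, u ++ v ∈ G)
    (hdiv : ¬ Summable fun n => ∑ w ∈ words m n,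
      G.indicator (fun w => Real.exp (δ * wordSum E.potential w)) w) :
    ENNReal.ofReal δ ≤ dimH (E.coding ''
      {ω | ∃ L : ℕ, 0 < L ∧ ∀ k : ℕ, initial (shift^[k * L] ω) L ∈ G}) := by
  classical
  obtain ⟨M, B, c, hc, hφ, hneg, hgeo⟩ := E.exists_potential_bounds hm
  have hlen := wordSum_le_mul_length hm hneg
  refine le_of_forall_lt fun d hd => ?_
  have hdtop : d ≠ ⊤ := (hd.trans ENNReal.ofReal_lt_top).ne
  obtain ⟨s, hs, hds, hsδ⟩ : ∃ s : ℝ, 0 < s ∧ d < ENNReal.ofReal s ∧ s < δ := by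
    obtain ⟨s, hs1, hs2⟩ := exists_between ((ENNReal.lt_ofReal_iff_toReal_lt hdtop).1 hd)
    exact ⟨s, ENNReal.toReal_nonneg.trans_lt hs1,
      (ENNReal.lt_ofReal_iff_toReal_lt hdtop).2 hs1, hs2⟩
  refine hds.trans_le ?_
  set S : ℕ → ℝ := fun n => ∑ w ∈ words m n,
    G.indicator (fun w => Real.exp (s * wordSum E.potential w)) w with hS
  -- Passing from `s` up to `δ` gains the factor `exp (-(δ - s) c n)` at level `n`; bounded sums at
  -- `s` would give a geometric majorant at `δ`.
  have hunb : ∀ R : ℝ, ∃ n, R < S n := by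
    intro R
    by_contra hR
    push Not at hR
    set r : ℝ := Real.exp (-((δ - s) * c)) with hr
    have hr1 : r < 1 := Real.exp_lt_one_iff.2 (neg_lt_zero.2 (mul_pos (sub_pos.2 hsδ) hc))
    refine hdiv (((summable_geometric_of_lt_one (Real.exp_pos _).le hr1).mul_left R).of_nonneg_of_le
      (fun n => Finset.sum_nonneg fun w _ => indicator_nonneg (fun _ _ => (Real.exp_pos _).le) _)
      fun n => ?_)
    refine le_trans ?_ (mul_le_mul_of_nonneg_right (hR n) (pow_nonneg (Real.exp_pos _).le n))
    rw [hS, Finset.sum_mul]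
    refine Finset.sum_le_sum fun w hw => ?_
    by_cases hwG : w ∈ G
    · rw [indicator_of_mem hwG, indicator_of_mem hwG, ← Real.exp_nat_mul, ← Real.exp_add,
        Real.exp_le_exp]
      have h1 := hlen w
      rw [mem_words.1 hw] at h1
      nlinarith [mul_le_mul_of_nonneg_left h1 (sub_pos.2 hsδ).le]
    · rw [indicator_of_notMem hwG, indicator_of_notMem hwG, zero_mul]
  set A : ℕ → Finset (List (Fin m)) := fun n => {w ∈ words m n | w ∈ G} with hA
  have hSA : ∀ n, S n = ∑ w ∈ A n, Real.exp (s * wordSum E.potential w) := by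
    intro n
    rw [hA, Finset.sum_filter]
    rfl
  have hAlen : ∀ n, ∀ w ∈ A n, w.length = n := fun n w hw =>
    mem_words.1 (Finset.mem_filter.1 hw).1
  have hAG : ∀ n, ∀ w ∈ A n, w ∈ G := fun n w hw => (Finset.mem_filter.1 hw).2
  obtain ⟨n₀, hn₀⟩ := hunb 2
  obtain ⟨v, hv, hvI⟩ : ∃ v ∈ A n₀, ∀ y ∈ Icc (0 : ℝ) 1, E.wordMap v y ∈ Ioo (0 : ℝ) 1 := by
    refine E.exists_interior_word (hAlen n₀) ?_
    have h1 : S n₀ ≤ (A n₀).card := by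
      rw [hSA]
      refine (Finset.sum_le_card_nsmul _ _ 1 fun w _ => ?_).trans_eq (by simp)
      rw [Real.exp_le_one_iff]
      refine mul_nonpos_of_nonneg_of_nonpos hs.le ((hlen w).trans ?_)
      have : 0 ≤ c * w.length := by positivity
      linarith
    have h2 : (2 : ℝ) < (A n₀).card := hn₀.trans_le h1
    exact_mod_cast h2
  have hv0 : 0 < v.length := by
    rw [List.length_pos_iff]
    rintro rfl
    exact (lt_irrefl _ (hvI 0 (by simp)).1)
  -- The threshold compensates the weight of the suffix `v`, the distortion `B` of appending it, and
  -- the `B` demanded by `le_dimH_of_separated_blocks`.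
  obtain ⟨n, hn⟩ := hunb (Real.exp (s * (2 * B - wordSum E.potential v)))
  set e := (A n).equivFin.symm with he
  -- The suffix `v` pushes each compact image into the open image of `(0,1)` under its first part.
  -- These are disjoint for distinct words of equal length, so touching endpoints are avoided.
  set W : Fin (A n).card → List (Fin m) := fun i => (e i : List (Fin m)) ++ v with hW
  have hWlen : ∀ i, (W i).length = n + v.length := fun i => by
    rw [hW, List.length_append, hAlen n _ (e i).2]
  obtain ⟨g, hg, hsep⟩ := E.exists_separation W fun i j hij => by
    rw [Set.disjoint_left]
    rintro _ ⟨x, hx, rfl⟩ ⟨y, hy, h⟩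
    simp only [W] at h
    rw [wordMap_append, wordMap_append] at h
    have h1 := E.eq_of_wordMap_eq ((hAlen n _ (e j).2).trans (hAlen n _ (e i).2).symm)
      (hvI y hy) (hvI x hx) h
    exact hij (e.injective (Subtype.ext h1)).symm
  have hL : 0 < n + v.length := by omega
  refine (E.le_dimH_of_separated_blocks hm hs hg W hWlen hL (hφ.le_wordSum_append hm)
    ⟨c, hc, hlen⟩ (fun w u hu v hv => (hgeo w u hu v hv).1) hsep ?_).trans (dimH_mono ?_)
  · have h1 : ∑ i, Real.exp (s * wordSum E.potential (e i : List (Fin m))) = S n := by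
      rw [hSA, ← Finset.sum_coe_sort (A n)]
      exact e.sum_comp fun w : A n => Real.exp (s * wordSum E.potential (w : List (Fin m)))
    calc Real.exp (s * B) = Real.exp (s * (wordSum E.potential v - B)) *
          Real.exp (s * (2 * B - wordSum E.potential v)) := by
          rw [← Real.exp_add]
          ring_nf
      _ ≤ Real.exp (s * (wordSum E.potential v - B)) * S n := by gcongr
      _ ≤ _ := by
          rw [← h1, Finset.mul_sum]
          refine Finset.sum_le_sum fun i _ => ?_
          rw [← Real.exp_add, ← mul_add, Real.exp_le_exp]
          refine mul_le_mul_of_nonneg_left ?_ hs.le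
          have := hφ.le_wordSum_append hm (e i : List (Fin m)) v
          simp only [W]
          linarith
  · rintro _ ⟨τ, rfl⟩
    refine mem_image_of_mem _ ⟨n + v.length, hL, fun k => ?_⟩
    rw [initial_shift_blockCode]
    exact hG _ (hAG n _ (e (τ k)).2) _ (hAG n₀ _ hv)

end ExpandingMap

/-! ### Poincaré exponents -/

theorem bddBelow_exponents (φ ψ : Code m → ℝ) (K α : ℝ) : BddBelow {s : ℝ | 0 ≤ s ∧
    Summable fun w : {w : List (Fin m) // |wordSum (fun ω => ψ ω - α) w| ≤ K} =>
      Real.exp (s * wordSum φ w)} :=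
  ⟨0, fun _ hs => hs.1⟩

theorem integral_stepFunction_sub {μ : Measure (Code m)} [IsProbabilityMeasure μ] (p : Fin m → ℤ)
    (α : ℝ) : ∫ ω, ((p (ω 0) : ℝ) - α) ∂μ = ∫ ω, stepFunction p ω ∂μ - α := by
  have hint : Integrable (stepFunction p : Code m → ℝ) μ := by
    have hm : Measurable (stepFunction p : Code m → ℝ) :=
      (measurable_of_finite fun i => (p i : ℝ)).comp (measurable_pi_apply 0)
    exact Integrable.of_bound hm.aestronglyMeasurable (∑ i, |(p i : ℝ)|)
      (Eventually.of_forall fun ω => Finset.single_le_sum (f := fun i => |(p i : ℝ)|)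
        (fun _ _ => abs_nonneg _) (Finset.mem_univ _))
  have h := integral_sub hint (integrable_const α)
  rw [integral_const, probReal_univ, one_smul] at h
  exact h

namespace BoundedDistortion

variable {φ : Code m → ℝ} {M B : ℝ} (hφ : BoundedDistortion φ M B) (hm : 2 ≤ m) {δ : ℝ}
include hφ hm

theorem poincareExponent_le (hδ : 0 ≤ δ) (hP : ∀ s, δ < s → pressure (fun ω => s * φ ω) < 0)
    (ψ : Code m → ℝ) (K α : ℝ) : poincareExponent φ ψ K α ≤ δ := by
  refine le_of_forall_gt_imp_ge_of_dense fun s hs => csInf_le (bddBelow_exponents φ ψ K α) ?_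
  have hs0 : 0 ≤ s := hδ.trans hs.le
  exact ⟨hs0, (hφ.summable_exp_of_pressure_neg hm hs0 (hP s hs)).comp_injective
    Subtype.val_injective⟩

theorem poincareExponent_lt (hδ : 0 < δ) (hP : pressure (fun ω => δ * φ ω) = 0)
    {μ : Measure (Code m)} (hμ : IsGibbs (fun ω => δ * φ ω) μ) (p : Fin m → ℤ) (K : ℝ) {α : ℝ}
    (h : ∫ ω, stepFunction p ω ∂μ ≠ α) : poincareExponent φ (stepFunction p) K α < δ := by
  have := hμ.prob
  obtain ⟨s, hs0, hsδ, hs⟩ := hφ.exists_summable_of_drift_ne hm hδ hP hμ (fun i => (p i : ℝ) - α)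
    (by rw [integral_stepFunction_sub]; exact sub_ne_zero.2 h)
  exact (csInf_le (bddBelow_exponents φ (stepFunction p) K α) ⟨hs0, hs K⟩).trans_lt hsδ

theorem le_poincareExponent (hδ : 0 ≤ δ) (hP : pressure (fun ω => δ * φ ω) = 0)
    (hP' : ∀ s, δ < s → pressure (fun ω => s * φ ω) < 0) {c : ℝ} (hc : 0 < c)
    (hneg : ∀ ω, φ ω ≤ -c) {μ : Measure (Code m)} (hμ : IsGibbs (fun ω => δ * φ ω) μ)
    (p : Fin m → ℤ) {K : ℝ} (hK : 0 < K) :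
    δ ≤ poincareExponent φ (stepFunction p) K (∫ ω, stepFunction p ω ∂μ) := by
  have := hμ.prob
  set α := ∫ ω, stepFunction p ω ∂μ with hα
  -- The exponent `δ + 1` shows that the set is nonempty; the real infimum of the empty set would be
  -- 0.
  refine le_csInf ⟨δ + 1, by linarith, (hφ.summable_exp_of_pressure_neg hm (by linarith)
    (hP' _ (lt_add_one δ))).comp_injective Subtype.val_injective⟩ ?_
  rintro s ⟨-, hs⟩
  by_contra hlt
  rw [not_le] at hlt
  refine hφ.not_summable_sum_words_of_drift_eq hm hδ hP hμ (fun i => (p i : ℝ) - α)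
    (by rw [integral_stepFunction_sub, hα, sub_self]) hK ?_
  refine summable_sum_words (fun w => indicator_nonneg (fun _ _ => (Real.exp_pos _).le) w) ?_
  rw [← summable_subtype_iff_indicator]
  refine hs.of_nonneg_of_le (fun w => (Real.exp_pos _).le) fun w => ?_
  rw [Function.comp, Real.exp_le_exp]
  -- As `S_w φ ≤ 0`, convergence at some `s < δ` would imply convergence at `δ`.
  refine mul_le_mul_of_nonpos_right hlt.le ((wordSum_le_mul_length hm hneg _).trans ?_)
  have : 0 ≤ c * (w : List (Fin m)).length := by positivity
  linarith

end BoundedDistortion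

namespace ExpandingMap

variable (E : ExpandingMap m)

/-! ### The lifted dynamics -/

theorem coding_mem_Ioo {ω : Code m} (h : E.coding ω ∉ E.exceptional) :
    E.coding ω ∈ Ioo (0 : ℝ) 1 := by
  have h1 := E.coding_mem_Icc ω
  have h2 : ∀ e ∈ ({0, 1} : Set ℝ), E.coding ω ≠ e := fun e he heq =>
    h (mem_iUnion.2 ⟨[], e, he, heq.symm⟩)
  exact ⟨lt_of_le_of_ne h1.1 (h2 0 (by simp)).symm, lt_of_le_of_ne h1.2 (h2 1 (by simp))⟩

theorem coding_shift_notMem {ω : Code m} (h : E.coding ω ∉ E.exceptional) :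
    E.coding (shift ω) ∉ E.exceptional := by
  intro h'
  obtain ⟨w, e, he, hw⟩ := mem_iUnion.1 h'
  refine h (mem_iUnion.2 ⟨ω 0 :: w, e, he, ?_⟩)
  rw [E.coding_eq_inv ω, ← hw]
  rfl

theorem lift_coding {Ψ : ℝ → ℤ} {p : Fin m → ℤ} (hΨ : ∀ i, ∀ x ∈ E.J i, Ψ x = p i) {ω : Code m}
    (h : E.coding ω ∉ E.exceptional) (k : ℤ) :
    E.lift Ψ (E.coding ω + k) = E.coding (shift ω) + ((k + p (ω 0) : ℤ) : ℝ) := by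
  have hy := E.coding_mem_Ioo h
  have hz := E.coding_mem_Ioo (E.coding_shift_notMem h)
  have hJ : E.coding ω ∈ E.J (ω 0) := by
    rw [coding_eq_inv]
    exact E.Ioo_subset _ (E.inv_mem_Ioo _ hz)
  have hF : E.F (E.coding ω) = E.coding (shift ω) := by
    rw [E.eqOn _ hJ]
    conv_lhs => rw [coding_eq_inv]
    exact (E.inv_spec _ (Ioo_subset_Icc_self hz)).2
  rw [lift, finsum_eq_single _ k]
  · rw [add_sub_cancel_right, indicator_of_mem (Ioo_subset_Icc_self hy), hF, hΨ _ _ hJ]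
    push_cast
    ring
  -- The fractional position lies in the open unit interval because the exceptional set contains 0
  -- and 1, so no second integer translate contributes.
  · intro j hj
    refine indicator_of_notMem (fun hmem => hj ?_) _
    have h1 : (-1 : ℝ) < ((k - j : ℤ) : ℝ) := by
      push_cast
      linarith [hmem.1, hy.2]
    have h2 : ((k - j : ℤ) : ℝ) < 1 := by
      push_cast
      linarith [hmem.2, hy.1]
    have h3 : -1 < k - j := by exact_mod_cast h1
    have h4 : k - j < 1 := by exact_mod_cast h2
    omega

theorem lift_iterate_coding {Ψ : ℝ → ℤ} {p : Fin m → ℤ} (hΨ : ∀ i, ∀ x ∈ E.J i, Ψ x = p i)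
    {ω : Code m} (h : E.coding ω ∉ E.exceptional) (k : ℤ) (n : ℕ) :
    (E.lift Ψ)^[n] (E.coding ω + k) =
      E.coding (shift^[n] ω) + (k + birkhoffSum shift (stepFunction p) n ω) := by
  induction n generalizing ω k with
  | zero => simp
  | succ n ih =>
    rw [Function.iterate_succ_apply, E.lift_coding hΨ h, ih (E.coding_shift_notMem h),
      birkhoffSum_succ', Function.iterate_succ_apply, stepFunction]
    push_cast
    ring

theorem abs_lift_iterate_sub_le {Ψ : ℝ → ℤ} {p : Fin m → ℤ} (hΨ : ∀ i, ∀ x ∈ E.J i, Ψ x = p i)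
    {ω : Code m} (h : E.coding ω ∉ E.exceptional) (k : ℤ) (n : ℕ) :
    |(E.lift Ψ)^[n] (E.coding ω + k) - (k + birkhoffSum shift (stepFunction p) n ω)| ≤ 1 := by
  rw [E.lift_iterate_coding hΨ h, add_sub_cancel_right, abs_of_nonneg (E.coding_mem_Icc _).1]
  exact (E.coding_mem_Icc _).2

theorem countable_exceptional : E.exceptional.Countable :=
  countable_iUnion fun _ => (Set.toFinite _).countable.image _

theorem dimH_add_const_image (A : Set ℝ) (c : ℝ) : dimH ((fun x => x + c) '' A) = dimH A :=
  (IsometryEquiv.addRight c).isometry.dimH_image A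

theorem dimH_diff_exceptional (A : Set ℝ) : dimH (A \ E.exceptional) = dimH A := by
  refine le_antisymm (dimH_mono sdiff_subset) ?_
  refine (dimH_mono (fun x hx => ?_ : A ⊆ (A \ E.exceptional) ∪ E.exceptional)).trans ?_
  · by_cases h : x ∈ E.exceptional
    · exact Or.inr h
    · exact Or.inl ⟨hx, h⟩
  · rw [dimH_union, dimH_countable E.countable_exceptional]
    simp

theorem dimH_periodicRepeller : dimH E.periodicRepeller = dimH E.repeller := by
  apply le_antisymm
  · have h : E.periodicRepeller ⊆ ⋃ k : ℤ, (fun x => x + (k : ℝ)) '' E.repeller := by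
      rintro x ⟨y, hy, k, rfl⟩
      exact mem_iUnion.2 ⟨k, y, hy.1, rfl⟩
    refine (dimH_mono h).trans ?_
    rw [dimH_iUnion]
    exact iSup_le fun k => (dimH_add_const_image _ _).le
  · rw [← E.dimH_diff_exceptional]
    exact dimH_mono fun y hy => ⟨y, hy, 0, by simp⟩

theorem uniformlyRecurrentSet_subset (Ψ : ℝ → ℤ) :
    E.uniformlyRecurrentSet Ψ ⊆ E.recurrentSet Ψ := by
  rintro x ⟨hx, K, hK⟩
  exact ⟨hx, K, Frequently.of_forall hK⟩

theorem dimH_recurrentSet_le {Ψ : ℝ → ℤ} {p : Fin m → ℤ} (hΨ : ∀ i, ∀ x ∈ E.J i, Ψ x = p i)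
    {d : ENNReal} (h : ∀ K : ℕ, dimH (E.coding '' {ω | ∃ᶠ n in atTop,
      |birkhoffSum shift (stepFunction p) n ω| ≤ K}) ≤ d) :
    dimH (E.recurrentSet Ψ) ≤ d := by
  have hsub : E.recurrentSet Ψ ⊆ ⋃ k : ℤ, ⋃ K : ℕ, (fun x => x + (k : ℝ)) ''
      (E.coding '' {ω | ∃ᶠ n in atTop, |birkhoffSum shift (stepFunction p) n ω| ≤ K}) := by
    rintro x ⟨⟨y, ⟨⟨ω, rfl⟩, hy⟩, k, rfl⟩, K, hK⟩
    -- The orbit differs from the Birkhoff sum by the starting integer `k` and a fractional part of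
    -- at most 1.
    obtain ⟨N, hN⟩ := exists_nat_ge (K + 1 + |(k : ℝ)|)
    refine mem_iUnion₂.2 ⟨k, N, mem_image_of_mem _ ⟨ω, hK.mono fun n hn => ?_, rfl⟩⟩
    have h1 := abs_le.1 (E.abs_lift_iterate_sub_le hΨ hy k n)
    have h2 := abs_le.1 hn
    rw [abs_le]
    constructor <;> linarith [h1.1, h1.2, h2.1, h2.2, le_abs_self (k : ℝ), neg_abs_le (k : ℝ)]
  refine (dimH_mono hsub).trans ?_
  simp only [dimH_iUnion]
  exact iSup_le fun k => iSup_le fun K => (dimH_add_const_image _ _).le.trans (h K)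

/-- The Birkhoff sums vanish at multiples of `L`, so at any time only an incomplete block of fewer
than `L` bounded steps contributes. -/
theorem coding_mem_uniformlyRecurrentSet {Ψ : ℝ → ℤ} {p : Fin m → ℤ}
    (hΨ : ∀ i, ∀ x ∈ E.J i, Ψ x = p i) {ω : Code m} (hω : E.coding ω ∉ E.exceptional) {L : ℕ}
    (hL : 0 < L) (h : ∀ k, birkhoffSum shift (stepFunction p) L (shift^[k * L] ω) = 0) :
    E.coding ω ∈ E.uniformlyRecurrentSet Ψ := by
  refine ⟨⟨_, ⟨mem_range_self ω, hω⟩, 0, by simp⟩, L * (∑ i, |(p i : ℝ)|) + 1, fun n => ?_⟩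
  have hblock : ∀ k, birkhoffSum shift (stepFunction p) (k * L) ω = 0 := by
    intro k
    induction k with
    | zero => simp
    | succ k ih => rw [Nat.succ_mul, birkhoffSum_add, ih, h, add_zero]
  have h1 := E.abs_lift_iterate_sub_le hΨ hω 0 n
  have h2 : |birkhoffSum shift (stepFunction p) n ω| ≤ L * ∑ i, |(p i : ℝ)| := by
    conv_lhs => rw [← Nat.div_add_mod' n L]
    rw [birkhoffSum_add, hblock, zero_add]
    refine (abs_birkhoffSum_le (M := ∑ i, |(p i : ℝ)|) (fun η => ?_) _ _).trans ?_
    · exact Finset.single_le_sum (f := fun i => |(p i : ℝ)|) (fun _ _ => abs_nonneg _)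
        (Finset.mem_univ (η 0))
    · have : ((n % L : ℕ) : ℝ) ≤ L := by exact_mod_cast (Nat.mod_lt n hL).le
      exact mul_le_mul_of_nonneg_right this (Finset.sum_nonneg fun _ _ => abs_nonneg _)
  simp only [Int.cast_zero, zero_add, add_zero] at h1
  have h3 := abs_sub_abs_le_abs_sub ((E.lift Ψ)^[n] (E.coding ω))
    (birkhoffSum shift (stepFunction p) n ω)
  linarith

end ExpandingMap

/-! ### Dimension of the repeller and of the recurrent sets -/

namespace ExpandingMap

variable (E : ExpandingMap m) (hm : 2 ≤ m) {δ : ℝ}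
include hm

theorem dimH_repeller (hδ : 0 < δ) (hP : pressure (fun ω => δ * E.potential ω) = 0)
    (hP' : ∀ s, δ < s → pressure (fun ω => s * E.potential ω) < 0) {μ : Measure (Code m)}
    (hμ : IsGibbs (fun ω => δ * E.potential ω) μ) : dimH E.repeller = ENNReal.ofReal δ := by
  obtain ⟨M, B, c, hc, hφ, hneg, -⟩ := E.exists_potential_bounds hm
  have := hμ.prob
  apply le_antisymm
  · have h1 : Tendsto ENNReal.ofReal (𝓝[>] δ) (𝓝 (ENNReal.ofReal δ)) :=
      (ENNReal.continuous_ofReal.tendsto δ).mono_left nhdsWithin_le_nhds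
    refine ge_of_tendsto h1 ?_
    filter_upwards [self_mem_nhdsWithin] with s hs
    have hs0 : 0 ≤ s := hδ.le.trans (le_of_lt hs)
    have h2 := E.dimH_le_of_summable hm hs0 univ
      ((hφ.summable_exp_of_pressure_neg hm hs0 (hP' s hs)).comp_injective Subtype.val_injective)
    refine (dimH_mono ?_).trans h2
    rintro _ ⟨ω, rfl⟩
    exact ⟨ω, Frequently.of_forall fun _ => mem_univ _, rfl⟩
  -- With all words allowed, each level has mass 1, so divergence at `δ` is immediate.
  · have h1 := hφ.not_summable_sum_words_of_measure hm hδ.le hP hμ (W := univ) (by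
      simp [summable_const_iff])
    refine (E.le_dimH_of_not_summable hm (fun _ _ _ _ => mem_univ _) h1).trans (dimH_mono ?_)
    exact image_subset_range _ _

theorem dimH_recurrentSet_lt {Ψ : ℝ → ℤ} {p : Fin m → ℤ} (hΨ : ∀ i, ∀ x ∈ E.J i, Ψ x = p i)
    (hδ : 0 < δ) (hP : pressure (fun ω => δ * E.potential ω) = 0) {μ : Measure (Code m)}
    (hμ : IsGibbs (fun ω => δ * E.potential ω) μ) (h : ∫ ω, stepFunction p ω ∂μ ≠ 0) :
    dimH (E.recurrentSet Ψ) < ENNReal.ofReal δ := by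
  obtain ⟨M, B, c, hc, hφ, hneg, -⟩ := E.exists_potential_bounds hm
  obtain ⟨s, hs0, hsδ, hs⟩ := hφ.exists_summable_of_drift_ne hm hδ hP hμ (fun i => (p i : ℝ)) h
  refine (E.dimH_recurrentSet_le hΨ fun K => ?_).trans_lt ((ENNReal.ofReal_lt_ofReal_iff hδ).2 hsδ)
  refine le_trans (dimH_mono (image_mono fun ω hω => ?_)) (E.dimH_le_of_summable hm hs0
    {w : List (Fin m) | |wordSum (fun ω => (p (ω 0) : ℝ)) w| ≤ K} (hs K))
  refine Frequently.mono hω fun n hn => ?_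
  rw [mem_ofPred_eq, wordSum_letter_initial fun i => (p i : ℝ)]
  exact hn

theorem le_dimH_uniformlyRecurrentSet {Ψ : ℝ → ℤ} {p : Fin m → ℤ}
    (hΨ : ∀ i, ∀ x ∈ E.J i, Ψ x = p i) (hδ : 0 < δ)
    (hP : pressure (fun ω => δ * E.potential ω) = 0) {μ : Measure (Code m)}
    (hμ : IsGibbs (fun ω => δ * E.potential ω) μ) (h : ∫ ω, stepFunction p ω ∂μ = 0) :
    ENNReal.ofReal δ ≤ dimH (E.uniformlyRecurrentSet Ψ) := by
  obtain ⟨M, B, c, hc, hφ, hneg, -⟩ := E.exists_potential_bounds hm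
  have hdiv := hφ.not_summable_sum_words_of_drift_eq hm hδ.le hP hμ (fun i => (p i : ℝ)) h
    (K := 1 / 2) (by norm_num)
  -- An integer of absolute value below 1 is 0. The choice `K = 1 / 2` thus makes the admissible
  -- words closed under concatenation.
  have hG : ∀ w : List (Fin m), |wordSum (fun ω => (p (ω 0) : ℝ)) w| ≤ 1 / 2 →
      wordSum (fun ω => (p (ω 0) : ℝ)) w = 0 := by
    intro w hw
    obtain ⟨x, hx⟩ := cylinder_nonempty hm w
    rw [wordSum_letter (fun i => (p i : ℝ)) hx] at hw ⊢
    have h1 : birkhoffSum shift (fun ω : Code m => (p (ω 0) : ℝ)) w.length x =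
        ((birkhoffSum shift (fun ω : Code m => p (ω 0)) w.length x : ℤ) : ℝ) := by
      simp [birkhoffSum]
    rw [h1] at hw ⊢
    have h2 : |birkhoffSum shift (fun ω : Code m => p (ω 0)) w.length x| < 1 := by
      have h3 := hw.trans_lt (by norm_num : (1 / 2 : ℝ) < 1)
      exact_mod_cast h3
    rw [Int.abs_lt_one_iff.1 h2, Int.cast_zero]
  have h1 := E.le_dimH_of_not_summable hm (fun u hu v hv => by
    rw [mem_ofPred_eq] at hu hv ⊢
    rw [wordSum_letter_append hm (fun i => (p i : ℝ)), hG u hu, hG v hv]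
    norm_num) hdiv
  rw [← E.dimH_diff_exceptional] at h1
  refine h1.trans (dimH_mono ?_)
  rintro _ ⟨⟨ω, ⟨L, hL, hω⟩, rfl⟩, hne⟩
  refine E.coding_mem_uniformlyRecurrentSet hΨ hne hL fun k => ?_
  have h2 := hG _ (hω k)
  rwa [wordSum_letter_initial (fun i => (p i : ℝ))] at h2

end ExpandingMap

end SkewPeriodic

end

/-! ### The main theorem -/

open SkewPeriodic
theorem mainTheorem2 {m : ℕ} (hm : 2 ≤ m) (E : ExpandingMap m)
    (Ψ : ℝ → ℤ) (p : Fin m → ℤ) (hΨ : ∀ i, ∀ x ∈ E.J i, Ψ x = p i) :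
    -- `δ > 0` is the unique zero of the pressure function and the dimension of the repeller
    ∃ δ : ℝ, 0 < δ ∧ (∀ s : ℝ, pressure (fun ω => s * E.potential ω) = 0 ↔ s = δ) ∧
      dimH E.repeller = ENNReal.ofReal δ ∧
      -- `μ` is the unique Gibbs measure for `δ φ`
      ∃ μ : Measure (Code m),
        (∀ ν : Measure (Code m), IsGibbs (fun ω => δ * E.potential ω) ν ↔ ν = μ) ∧
        -- `δ_α = δ` if and only if the drift `μ(ψ)` equals `α`
        (∀ K : ℝ, 0 < K → ∀ α : ℝ,
          poincareExponent E.potential (stepFunction p) K α = δ ↔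
            ∫ ω, stepFunction p ω ∂μ = α) ∧
        -- a dimension gap occurs if and only if the drift is non-zero
        (∀ K : ℝ, 0 < K →
          (poincareExponent E.potential (stepFunction p) K 0 < δ ↔
            ∫ ω, stepFunction p ω ∂μ ≠ 0)) ∧
        (dimH (E.recurrentSet Ψ) < dimH E.periodicRepeller ↔ ∫ ω, stepFunction p ω ∂μ ≠ 0) ∧
        (dimH (E.uniformlyRecurrentSet Ψ) < dimH E.periodicRepeller ↔
          ∫ ω, stepFunction p ω ∂μ ≠ 0) := by
  obtain ⟨M, B, c, hc, hφ, hneg, -⟩ := E.exists_potential_bounds hm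
  obtain ⟨δ, hδ, hzero, hP'⟩ := exists_pressure_zero hm hφ hc hneg
  have hP : pressure (fun ω => δ * E.potential ω) = 0 := (hzero δ).2 rfl
  obtain ⟨μ, hμ⟩ := (hφ.const_mul δ).exists_isGibbs hm hP
  have hdim := E.dimH_repeller hm hδ hP hP' hμ
  have hexp : ∀ K : ℝ, 0 < K → ∀ α : ℝ,
      poincareExponent E.potential (stepFunction p) K α = δ ↔
        ∫ ω, stepFunction p ω ∂μ = α := by
    intro K hK α
    constructor
    · intro h
      by_contra hne
      exact (hφ.poincareExponent_lt hm hδ hP hμ p K hne).ne h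
    · rintro rfl
      exact le_antisymm (hφ.poincareExponent_le hm hδ.le hP' _ _ _)
        (hφ.le_poincareExponent hm hδ.le hP hP' hc hneg hμ p hK)
  refine ⟨δ, hδ, hzero, hdim, μ, fun ν => ⟨fun hν => hμ.eq_of_isGibbs hm hν, ?_⟩, hexp, ?_, ?_, ?_⟩
  · rintro rfl
    exact hμ
  · intro K hK
    rw [(hφ.poincareExponent_le hm hδ.le hP' _ _ _).lt_iff_ne, Ne, hexp K hK]
  · rw [E.dimH_periodicRepeller, hdim]
    -- Zero drift already gives the uniformly recurrent set full dimension, and non-zero drift makes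
    -- even the larger recurrent set small; the inclusion settles both equivalences.
    refine ⟨fun hlt h => ?_, E.dimH_recurrentSet_lt hm hΨ hδ hP hμ⟩
    exact hlt.not_ge ((E.le_dimH_uniformlyRecurrentSet hm hΨ hδ hP hμ h).trans
      (dimH_mono (E.uniformlyRecurrentSet_subset Ψ)))
  · rw [E.dimH_periodicRepeller, hdim]
    refine ⟨fun hlt h => hlt.not_ge (E.le_dimH_uniformlyRecurrentSet hm hΨ hδ hP hμ h), fun h => ?_⟩
    exact (dimH_mono (E.uniformlyRecurrentSet_subset Ψ)).trans_lt
      (E.dimH_recurrentSet_lt hm hΨ hδ hP hμ h)
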